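/- Let $k,m,L$ be non-negative integers. **Conventions.** For a real symmetric $k\times k$ matrix $D$ and $j\ge 1$ let $\mathcal D_j=\mathcal D_j(D)$ be the $jk\times jk$ block tridiagonal matrix with the $k\times k$ block $-D$ along the diagonal and the $k\times k$ unit matrix along the two side diagonals, and let $\mathcal S(k,L)$ be the set of real symmetric $k\times k$ matrices $D$ for which $\mathcal D_1,\dots,\mathcal D_L$ are all invertible. $\mathcal M(h)$ denotes multiplication by $h$, and $\mathcal F$ is the unitary Fourier transform on $L^2(\mathbb R^k)$, $(\mathcal Ff)(y)=(2\pi)^{-k/2}\int e^{ix\cdot y}f(x)\,dx$ for $f\in L^1\cap L^2$. A function $h$ on $\mathbb R^k$ is exponentially decaying if $|h(x)|\le Ce^{-c|x|}$ for some $C$ and some $c>0$. Let $n$ be the smallest integer with $n\ge m/2$ and $\mathcal I=\{1,\dots,m\}$. On smooth functions of a real symmetric $m\times m$ matrix $M$ let $\tilde\partial_{jj}=\partial/\partial M_{jj}$ and $\tilde\partial_{jk}=\frac12\,\partial/\partial M_{jk}$ for $j\ne k$ (where $M_{jk}=M_{kj}$ is one variable). For subsets $\bar a=\{\bar k_1<\dots<\bar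 k_c\}$ and $a=\{k_1<\dots<k_c\}$ of $\mathcal I$ of equal cardinality let $D_{\bar a,a}=\det(\tilde\partial_{\bar k_i,k_j})_{i,j}$ ($D_{\emptyset,\emptyset}$ is the identity). Let $\mathcal P^n$ be the set of $n$-tuples $(\bar{\mathbf a},\mathbf a)=((\bar a_l,a_l))_{l=1}^n$ of such pairs, $D_{\bar{\mathbf a},\mathbf a}=\prod_l D_{\bar a_l,a_l}$, $|\mathbf a|=\sum_l|a_l|$, and $\mathbf I=(\mathcal I,\dots,\mathcal I)$. For $\varphi\in\mathbb R^{m\times 2n}$ with Lebesgue measure and $1\le p\le\infty$ put $$|||f|||_p^2=\sum_{(\bar{\mathbf a},\mathbf a)\in\mathcal P^n}4^{|\mathbf a|}\,\bigl\|\varphi\mapsto (D_{\bar{\mathbf a},\mathbf a}f)(\varphi\varphi^\top)\bigr\|_{L^p(\mathbb R^{m\times 2n})}^2,$$ and for functions $g(M_+,M_-)$ of two symmetric matrices $$||||g||||_p^2=\sum_{(\bar{\mathbf a},\mathbf a),(\bar{\mathbf b},\mathbf b)\in\mathcal P^n}4^{|\mathbf a|+|\mathbf b|}\,\bigl\|(\varphi_+,\varphi_-)\mapsto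 (D^{(+)}_{\bar{\mathbf a},\mathbf a}D^{(-)}_{\bar{\mathbf b},\mathbf b}g)(\varphi_+\varphi_+^\top,\varphi_-\varphi_-^\top)\bigr\|_{L^p((\mathbb R^{m\times 2n})^2)}^2,$$ where $D^{(\pm)}$ acts in the variable $M_\pm$. For a symmetric matrix $B$ let $\zeta_B(M)=e^{\frac i2\mathrm{Tr}(BM)}$, and for real symmetric $B$ let $\xi_B(M_+,M_-)=e^{\frac i2\mathrm{Tr}(BM_+-BM_-)}$. Let $PE(m)$ be the complex vector space spanned by the functions $p(M)\zeta_B(M)$, where $p$ is a polynomial in the entries of $M$ and $B$ is complex symmetric with $\mathrm{Im}\,B>0$. Its elements are regarded as functions on the cone of positive semidefinite matrices or, equivalently, via the same formula, on all real symmetric matrices. Let $\mathcal H_p$ and $\mathcal K_p$ be the completions of $PE(m)$ and of $PE(m)\otimes PE(m)$ with respect to $|||\cdot|||_2+|||\cdot|||_p$ and $||||\cdot||||_2+||||\cdot||||_p$ respectively. The transforms $T$ and $\mathcal T=T\otimes T$ are given by $$(Tf)(\varphi'\varphi'^\top)=\frac{(-1)^{mn}}{\pi^{mn}}\int e^{i\,\mathrm{Tr}(\varphi'\varphi^\top)}(D_{\mathbf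 I,\mathbf I}f)(\varphi\varphi^\top)\,d\varphi,$$ $$(\mathcal Tg)(\varphi_+'\varphi_+'^\top,\varphi_-'\varphi_-'^\top)=\frac1{\pi^{2mn}}\iint e^{i\,\mathrm{Tr}(\varphi_+'\varphi_+^\top+\varphi_-'\varphi_-^\top)}(D^{(+)}_{\mathbf I,\mathbf I}D^{(-)}_{\mathbf I,\mathbf I}g)(\varphi_+\varphi_+^\top,\varphi_-\varphi_-^\top)\,d\varphi_+d\varphi_-.$$ **Proposition.** (i) Let $h_1,h_2$ be exponentially decaying, continuous complex functions on $\mathbb R^k$ and let $D\in\mathcal S(k,L)$. Then $$\mathcal M(h_1)\mathcal F\mathcal M(h_2)\quad\text{and}\quad \mathcal M(h_1)\bigl(\mathcal F\mathcal M(e^{\frac i2x\cdot Dx})\bigr)^{L+1}\mathcal M(h_2)$$ are compact operators from $L^2(\mathbb R^k)$ to $L^p(\mathbb R^k)$ for every $p\in[1,\infty]$. (ii) The formula for $T$ defines a map $T:PE(m)\to PE(m)$. For $f_1,f_2\in PE(m)$ and $B\in\mathcal S(m,L)$ the operators $$\mathcal M(f_1)T\mathcal M(f_2)\quad\text{and}\quad\mathcal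 M(f_1)\bigl(T\mathcal M(\zeta_B)\bigr)^{L+1}\mathcal M(f_2),$$ which map $PE(m)$ to itself, extend to compact operators from $\mathcal H_p$ to $\mathcal H_q$ for all $p,q\in[1,\infty]$. (iii) The formula for $\mathcal T$ defines a map of $PE(m)\otimes PE(m)$ to itself. For $g_1,g_2\in PE(m)\otimes PE(m)$ and $B\in\mathcal S(m,L)$ the operators $$\mathcal M(g_1)\mathcal T\mathcal M(g_2)\quad\text{and}\quad\mathcal M(g_1)\bigl(\mathcal T\mathcal M(\xi_B)\bigr)^{L+1}\mathcal M(g_2)$$ extend from $PE(m)\otimes PE(m)$ to compact operators from $\mathcal K_p$ to $\mathcal K_q$ for all $p,q\in[1,\infty]$. -/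

import Mathlib

open MeasureTheory FourierTransform
open scoped ENNReal

noncomputable section

/-! ### Operators on `L²(ℝᵏ)` -/

/-- The space `L²(ℝᵏ)` of complex valued functions. -/
abbrev L2 (k : ℕ) : Type := Lp ℂ 2 (volume : Measure (EuclideanSpace ℝ (Fin k)))

theorem memLp_fourier_dilation {k : ℕ} (f : L2 k) :
    MemLp (fun y : EuclideanSpace ℝ (Fin k) =>
      (((2 * Real.pi) ^ (-(k : ℝ) / 2) : ℝ) : ℂ) * (𝓕⁻ f : L2 k) ((2 * Real.pi)⁻¹ • y)) 2 volume := by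
  apply MemLp.const_mul
  have hne : (2 * Real.pi)⁻¹ ≠ 0 := by positivity
  have hm : Measurable (fun y : EuclideanSpace ℝ (Fin k) => (2 * Real.pi)⁻¹ • y) :=
    measurable_const_smul _
  have hmap : MemLp (𝓕⁻ f : L2 k) 2 (Measure.map
      (fun y : EuclideanSpace ℝ (Fin k) => (2 * Real.pi)⁻¹ • y) volume) := by
    have := Measure.map_addHaar_smul (volume : Measure (EuclideanSpace ℝ (Fin k))) hne
    rw [this]
    exact (Lp.memLp _).smul_measure ENNReal.ofReal_ne_top
  exact hmap.comp_of_map hm.aemeasurable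

/-- The unitary Fourier transform on `L²(ℝᵏ)` with the normalization
`(ℱ f)(y) = (2π)^{-k/2} ∫ e^{i x·y} f(x) dx` (for `f ∈ L¹ ∩ L²`). As Mathlib's `𝓕⁻` on `L²` is
`(𝓕⁻ f)(w) = ∫ e^{2πi x·w} f(x) dx`, this is `(2π)^{-k/2} (𝓕⁻ f)(y / 2π)`. -/
def fourierL2 {k : ℕ} (f : L2 k) : L2 k := (memLp_fourier_dilation f).toLp

open Classical in
/-- The multiplication operator `ℳ(h)` on `L²(ℝᵏ)`. For bounded measurable `h` the product `h f` is
in `L²` for all `f ∈ L²` (and only such `h` are used). -/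
def mulL2 {k : ℕ} (h : EuclideanSpace ℝ (Fin k) → ℂ) (f : L2 k) : L2 k :=
  if hf : MemLp (fun x => h x * f x) 2 volume then hf.toLp else 0

/-- `h` decays exponentially. -/
def ExpDecay {k : ℕ} (h : EuclideanSpace ℝ (Fin k) → ℂ) : Prop :=
  ∃ C c : ℝ, 0 < c ∧ ∀ x, ‖h x‖ ≤ C * Real.exp (-c * ‖x‖)

/-- `ℳ(h₁) A ℳ(h₂)` is a compact operator from `L²(ℝᵏ)` to `Lᵖ(ℝᵏ)`: for all `f ∈ L²` the function
`h₁ · A (h₂ f)` is in `Lᵖ`, and `f ↦ h₁ · A (h₂ f)` is linear, bounded and compact. -/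
def IsCompactSandwich {k : ℕ} (h₁ : EuclideanSpace ℝ (Fin k) → ℂ) (A : L2 k → L2 k)
    (h₂ : EuclideanSpace ℝ (Fin k) → ℂ) (p : ℝ≥0∞) [Fact (1 ≤ p)] : Prop :=
  ∃ S : L2 k →L[ℂ] Lp ℂ p (volume : Measure (EuclideanSpace ℝ (Fin k))),
    IsCompactOperator S ∧ ∀ f : L2 k, S f =ᵐ[volume] fun x => h₁ x * A (mulL2 h₂ f) x

/-! ### Real symmetric matrices and the set `𝒮(k, L)` -/

/-- The real vector space `Sym(m)` of real symmetric `m × m` matrices. -/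
def SymMat (m : ℕ) : Submodule ℝ (Matrix (Fin m) (Fin m) ℝ) where
  carrier := {M | M.IsSymm}
  add_mem' ha hb := Matrix.IsSymm.add ha hb
  zero_mem' := Matrix.isSymm_zero
  smul_mem' c _ h := Matrix.IsSymm.smul h c

/-- The phase `e^{(i/2) x·Dx}` on `ℝᵏ`. -/
def phase {k : ℕ} (D : SymMat k) (x : EuclideanSpace ℝ (Fin k)) : ℂ :=
  Complex.exp (Complex.I / 2 * ((∑ i, ∑ j, x i * D.1 i j * x j : ℝ) : ℂ))

/-- The `jk × jk` tridiagonal block matrix `𝒟_j` with the `k × k` block `-D` in each of the `j`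
diagonal places and the unit block on the two side diagonals. -/
def blockTridiag {k : ℕ} (D : SymMat k) (j : ℕ) : Matrix (Fin j × Fin k) (Fin j × Fin k) ℝ :=
  Matrix.of fun x y =>
    if x.1 = y.1 then -(D.1 x.2 y.2)
    else if x.1.val + 1 = y.1.val ∨ y.1.val + 1 = x.1.val then
      (1 : Matrix (Fin k) (Fin k) ℝ) x.2 y.2
    else 0

/-- The set `𝒮(k, L)` of real symmetric `k × k` matrices `D` for which `𝒟_1, …, 𝒟_L` are
invertible. -/
def nondegSet (k L : ℕ) : Set (SymMat k) :=
  {D | ∀ j, 1 ≤ j → j ≤ L → IsUnit (blockTridiag D j)}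

/-! ### Differential operators on functions of symmetric matrices -/

/-- The smallest integer `n` with `n ≥ m / 2`. -/
def halfDim (m : ℕ) : ℕ := (m + 1) / 2

/-- The symmetrized matrix unit `(E_{jk} + E_{kj}) / 2`. -/
def symUnit {m : ℕ} (j k : Fin m) : SymMat m :=
  ⟨(2⁻¹ : ℝ) • (Matrix.single j k 1 + Matrix.single k j 1), by
    change Matrix.IsSymm _
    refine Matrix.IsSymm.smul ?_ _
    rw [Matrix.IsSymm, Matrix.transpose_add, Matrix.transpose_single, Matrix.transpose_single,
      add_comm]⟩

/-- The operator `∂̃_{jk}`: it is `∂/∂M_{jj}` for `j = k` and, for `j ≠ k`, one half of the derivative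
with respect to the entry `M_{jk} = M_{kj}` of the symmetric matrix `M`. -/
def symDeriv {m : ℕ} (j k : Fin m) (f : SymMat m → ℂ) : SymMat m → ℂ :=
  fun M => lineDeriv ℝ f M (symUnit j k)

/-- The composition `A₀ ∘ A₁ ∘ ⋯ ∘ A_{c-1}` of operators. -/
def compAll {X : Type*} {c : ℕ} (A : Fin c → X → X) (x : X) : X :=
  (List.ofFn A).foldr (fun g y => g y) x

/-- Pairs `(ā, a)` of subsets of `{1, …, m}` of the same cardinality. -/
abbrev SetPair (m : ℕ) : Type :=
  {x : Finset (Fin m) × Finset (Fin m) // x.1.card = x.2.card}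

/-- The operator `D_{ā,a} = det (∂̃_{k̄_i, k_j})_{i,j}`, where `k̄_1 < ⋯ < k̄_c` are the elements of `ā`
and `k_1 < ⋯ < k_c` those of `a`. The determinant is written out by the Leibniz formula; the
operators `∂̃_{jk}` commute on smooth functions. -/
def minorDeriv {m : ℕ} (x : SetPair m) (f : SymMat m → ℂ) : SymMat m → ℂ :=
  ∑ σ : Equiv.Perm (Fin x.1.1.card), ((Equiv.Perm.sign σ : ℤ) : ℂ) •
    compAll (fun i => symDeriv (x.1.1.orderEmbOfFin rfl i)
      (x.1.2.orderEmbOfFin x.2.symm (σ i))) f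

/-- The set `𝒫ⁿ` of `n`-tuples of pairs, with `n = n(m)`. -/
abbrev MultiPair (m : ℕ) : Type := Fin (halfDim m) → SetPair m

/-- `|𝐚| = |a_1| + ⋯ + |a_n|`. -/
def MultiPair.size {m : ℕ} (a : MultiPair m) : ℕ := ∑ l, (a l).1.2.card

/-- The pair `(𝐈, 𝐈)`, where every subset is all of `{1, …, m}`. -/
def MultiPair.full (m : ℕ) : MultiPair m := fun _ => ⟨(Finset.univ, Finset.univ), rfl⟩

/-- The operator `D_{𝐚̄,𝐚} = ∏_l D_{ā_l, a_l}`. -/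
def multiDeriv {m : ℕ} (a : MultiPair m) (f : SymMat m → ℂ) : SymMat m → ℂ :=
  compAll (fun l => minorDeriv (a l)) f

/-- The operator `D_{𝐚̄,𝐚}` with respect to the first variable `M₊`. -/
def multiDerivPlus {m : ℕ} (a : MultiPair m) (g : SymMat m × SymMat m → ℂ) :
    SymMat m × SymMat m → ℂ :=
  fun M => multiDeriv a (fun M' => g (M', M.2)) M.1

/-- The operator `D_{𝐚̄,𝐚}` with respect to the second variable `M₋`. -/
def multiDerivMinus {m : ℕ} (a : MultiPair m) (g : SymMat m × SymMat m → ℂ) :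
    SymMat m × SymMat m → ℂ :=
  fun M => multiDeriv a (fun M' => g (M.1, M')) M.2

/-- The space `ℝ^{m × 2n} ≅ ℝ^{2mn}` of real `m × 2n` matrices `φ`, with Lebesgue measure. -/
abbrev PhiSpace (m : ℕ) : Type := EuclideanSpace ℝ (Fin m × Fin (2 * halfDim m))

/-- The positive semidefinite matrix `φ φᵀ`. -/
def gram {m : ℕ} (φ : PhiSpace m) : SymMat m :=
  ⟨Matrix.of fun j k => ∑ l, φ (j, l) * φ (k, l), by
    change Matrix.IsSymm _
    ext j k
    simp [mul_comm]⟩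

/-! ### The spaces `PE(m)` and `PE(m) ⊗ PE(m)` -/

/-- `ζ_B(M) = e^{(i/2) Tr(BM)}`. -/
def zeta {m : ℕ} (B : Matrix (Fin m) (Fin m) ℂ) (M : SymMat m) : ℂ :=
  Complex.exp (Complex.I / 2 * (B * M.1.map (fun t : ℝ => (t : ℂ))).trace)

/-- The function `p(M) ζ_B(M)` for a polynomial `p` in the entries of `M`. -/
def polyZeta {m : ℕ} (p : MvPolynomial (Fin m × Fin m) ℂ) (B : Matrix (Fin m) (Fin m) ℂ)
    (M : SymMat m) : ℂ :=
  MvPolynomial.eval (fun x => ((M.1 x.1 x.2 : ℝ) : ℂ)) p * zeta B M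

/-- The space `PE(m)` spanned by the functions `p(M) ζ_B(M)` for polynomials `p` and complex symmetric
`B` with positive definite imaginary part. The functions in `PE(m)` are given by the same formula on
all of `Sym(m)`; as they are real analytic, they are determined by their values on the cone of
positive semidefinite matrices. -/
def PE (m : ℕ) : Submodule ℂ (SymMat m → ℂ) :=
  Submodule.span ℂ {f | ∃ (p : MvPolynomial (Fin m × Fin m) ℂ) (B : Matrix (Fin m) (Fin m) ℂ),
    B.IsSymm ∧ (B.map Complex.im).PosDef ∧ f = polyZeta p B}

/-- The algebraic tensor product `PE(m) ⊗ PE(m)`, as a space of functions `g(M₊, M₋)`. -/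
def PE2 (m : ℕ) : Submodule ℂ (SymMat m × SymMat m → ℂ) :=
  Submodule.span ℂ {g | ∃ f₁ ∈ PE m, ∃ f₂ ∈ PE m, g = fun M => f₁ M.1 * f₂ M.2}

/-! ### Norms -/

/-- The norm `|||f|||_p` of a function of one symmetric matrix. For `p = ∞` the `L^∞` norms are the
suprema. -/
def susyNorm {m : ℕ} (p : ℝ≥0∞) (f : SymMat m → ℂ) : ℝ :=
  Real.sqrt (∑ a : MultiPair m, (4 : ℝ) ^ a.size *
    (eLpNorm (fun φ : PhiSpace m => multiDeriv a f (gram φ)) p volume).toReal ^ 2)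

/-- The norm `||||g||||_p` of a function of two symmetric matrices. -/
def susyNorm2 {m : ℕ} (p : ℝ≥0∞) (g : SymMat m × SymMat m → ℂ) : ℝ :=
  Real.sqrt (∑ ab : MultiPair m × MultiPair m, (4 : ℝ) ^ (ab.1.size + ab.2.size) *
    (eLpNorm (fun φ : PhiSpace m × PhiSpace m =>
      multiDerivPlus ab.1 (multiDerivMinus ab.2 g) (gram φ.1, gram φ.2)) p volume).toReal ^ 2)

/-! ### Auxiliary facts: the norms are finite and satisfy the triangle inequality -/

/-- `A` maps `V` to `V` and is linear there. -/
structure LinearOnSub {X : Type*} (V : Submodule ℂ (X → ℂ)) (A : (X → ℂ) → (X → ℂ)) : Prop where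
  mem : ∀ f ∈ V, A f ∈ V
  add : ∀ f ∈ V, ∀ g ∈ V, A (f + g) = A f + A g
  smul : ∀ (c : ℂ), ∀ f ∈ V, A (c • f) = c • A f

theorem LinearOnSub.comp {X : Type*} {V : Submodule ℂ (X → ℂ)} {A B : (X → ℂ) → (X → ℂ)}
    (hA : LinearOnSub V A) (hB : LinearOnSub V B) : LinearOnSub V (fun f => A (B f)) where
  mem f hf := hA.mem _ (hB.mem _ hf)
  add f hf g hg := by rw [hB.add f hf g hg, hA.add _ (hB.mem _ hf) _ (hB.mem _ hg)]
  smul c f hf := by rw [hB.smul c f hf, hA.smul c _ (hB.mem _ hf)]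

theorem LinearOnSub.compAll {X : Type*} {V : Submodule ℂ (X → ℂ)} {c : ℕ}
    {A : Fin c → (X → ℂ) → (X → ℂ)} (hA : ∀ i, LinearOnSub V (A i)) :
    LinearOnSub V (compAll A) := by
  have key : ∀ l : List ((X → ℂ) → (X → ℂ)), (∀ B ∈ l, LinearOnSub V B) →
      LinearOnSub V (fun f => l.foldr (fun g y => g y) f) := by
    intro l
    induction l with
    | nil =>
      intro _
      exact ⟨fun f hf => hf, fun _ _ _ _ => rfl, fun _ _ _ => rfl⟩
    | cons B l ih =>
      intro h
      exact (h B (by simp)).comp (ih fun C hC => h C (by simp [hC]))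
  refine key (List.ofFn A) ?_
  intro B hB
  obtain ⟨i, rfl⟩ := (List.mem_ofFn' _ _).1 hB
  exact hA i

theorem LinearOnSub.sum_smul {X ι : Type*} [Fintype ι] {V : Submodule ℂ (X → ℂ)}
    {A : ι → (X → ℂ) → (X → ℂ)} (w : ι → ℂ) (hA : ∀ i, LinearOnSub V (A i)) :
    LinearOnSub V (fun f => ∑ i, w i • A i f) where
  mem f hf := V.sum_mem fun i _ => V.smul_mem _ ((hA i).mem f hf)
  add f hf g hg := by
    rw [← Finset.sum_add_distrib]
    exact Finset.sum_congr rfl fun i _ => by rw [(hA i).add f hf g hg, smul_add]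
  smul c f hf := by
    rw [Finset.smul_sum]
    exact Finset.sum_congr rfl fun i _ => by rw [(hA i).smul c f hf, smul_comm]

theorem hasDerivAt_entries {m : ℕ} (v : SymMat m) (p : MvPolynomial (Fin m × Fin m) ℂ) :
    ∃ q : MvPolynomial (Fin m × Fin m) ℂ, ∀ M : SymMat m,
      HasDerivAt (fun t : ℝ =>
        MvPolynomial.eval (fun x => ((((M + t • v : SymMat m)).1 x.1 x.2 : ℝ) : ℂ)) p)
        (MvPolynomial.eval (fun x => ((M.1 x.1 x.2 : ℝ) : ℂ)) q) 0 := by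
  induction p using MvPolynomial.induction_on with
  | C a => exact ⟨0, fun M => by simpa using hasDerivAt_const (0 : ℝ) a⟩
  | add p q hp hq =>
    obtain ⟨p', hp⟩ := hp
    obtain ⟨q', hq⟩ := hq
    exact ⟨p' + q', fun M => by simp only [map_add]; exact (hp M).add (hq M)⟩
  | mul_X p i hp =>
    obtain ⟨p', hp⟩ := hp
    refine ⟨p' * MvPolynomial.X i + p * MvPolynomial.C ((v.1 i.1 i.2 : ℝ) : ℂ), fun M => ?_⟩
    have h1 : HasDerivAt (fun t : ℝ => ((((M + t • v : SymMat m)).1 i.1 i.2 : ℝ) : ℂ))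
        ((v.1 i.1 i.2 : ℝ) : ℂ) 0 := by
      apply HasDerivAt.ofReal_comp
      have := ((hasDerivAt_id (0 : ℝ)).mul_const (v.1 i.1 i.2)).const_add (M.1 i.1 i.2)
      simpa using this
    simp only [map_mul, MvPolynomial.eval_X]
    refine ((hp M).mul h1).congr_deriv ?_
    simp

theorem hasDerivAt_zeta {m : ℕ} (v : SymMat m) (B : Matrix (Fin m) (Fin m) ℂ) (M : SymMat m) :
    HasDerivAt (fun t : ℝ => zeta B (M + t • v))
      ((Complex.I / 2 * (B * v.1.map (fun t : ℝ => (t : ℂ))).trace) * zeta B M) 0 := by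
  have h1 : ∀ t : ℝ, zeta B (M + t • v) = zeta B M *
      Complex.exp (t * (Complex.I / 2 * (B * v.1.map (fun t : ℝ => (t : ℂ))).trace)) := by
    intro t
    have : (M + t • v : SymMat m).1.map (fun t : ℝ => (t : ℂ)) =
        M.1.map (fun t : ℝ => (t : ℂ)) + (t : ℂ) • v.1.map (fun t : ℝ => (t : ℂ)) := by
      ext i j
      simp
    rw [zeta, zeta, this, ← Complex.exp_add, Matrix.mul_add, Matrix.trace_add, Matrix.mul_smul,
      Matrix.trace_smul, smul_eq_mul]
    congr 1
    ring
  set c := Complex.I / 2 * (B * v.1.map (fun t : ℝ => (t : ℂ))).trace with hc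
  simp_rw [h1]
  have h2 : HasDerivAt (fun t : ℝ => (t : ℂ) * c) c 0 := by
    have := (Complex.ofRealCLM.hasDerivAt (x := (0 : ℝ))).mul_const c
    simpa using this
  have h3 := (h2.cexp).const_mul (zeta B M)
  simpa [mul_comm] using h3

theorem PE_hasLineDerivAt {m : ℕ} (v : SymMat m) (f : SymMat m → ℂ) (hf : f ∈ PE m) :
    ∃ g ∈ PE m, ∀ M, HasLineDerivAt ℝ f (g M) M v := by
  induction hf using Submodule.span_induction with
  | mem f hf =>
    obtain ⟨p, B, hB, hB', rfl⟩ := hf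
    obtain ⟨q, hq⟩ := hasDerivAt_entries v p
    refine ⟨polyZeta (q + p * MvPolynomial.C
      (Complex.I / 2 * (B * v.1.map (fun t : ℝ => (t : ℂ))).trace)) B,
      Submodule.subset_span ⟨_, B, hB, hB', rfl⟩, fun M => ?_⟩
    have := (hq M).mul (hasDerivAt_zeta v B M)
    rw [HasLineDerivAt]
    refine this.congr_deriv ?_
    simp only [zero_smul, add_zero, polyZeta, map_add, map_mul, MvPolynomial.eval_C]
    ring
  | zero => exact ⟨0, Submodule.zero_mem _, fun M => by
      simpa [HasLineDerivAt] using hasDerivAt_const (0 : ℝ) (0 : ℂ)⟩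
  | add f g _ _ hf hg =>
    obtain ⟨f', hf', hf⟩ := hf
    obtain ⟨g', hg', hg⟩ := hg
    exact ⟨f' + g', Submodule.add_mem _ hf' hg', fun M => HasDerivAt.add (hf M) (hg M)⟩
  | smul c f _ hf =>
    obtain ⟨f', hf', hf⟩ := hf
    exact ⟨c • f', Submodule.smul_mem _ c hf', fun M => HasDerivAt.const_smul c (hf M)⟩

theorem linearOnSub_symDeriv {m : ℕ} (j k : Fin m) : LinearOnSub (PE m) (symDeriv j k) where
  mem f hf := by
    obtain ⟨g, hg, h⟩ := PE_hasLineDerivAt (symUnit j k) f hf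
    have : symDeriv j k f = g := funext fun M => (h M).lineDeriv
    rwa [this]
  add f hf g hg := by
    obtain ⟨f', hf', h⟩ := PE_hasLineDerivAt (symUnit j k) f hf
    obtain ⟨g', hg', h'⟩ := PE_hasLineDerivAt (symUnit j k) g hg
    funext M
    have h3 : HasLineDerivAt ℝ (f + g) (f' M + g' M) M (symUnit j k) :=
      HasDerivAt.add (h M) (h' M)
    simp only [symDeriv, Pi.add_apply]
    rw [h3.lineDeriv, (h M).lineDeriv, (h' M).lineDeriv]
  smul c f hf := by
    obtain ⟨f', hf', h⟩ := PE_hasLineDerivAt (symUnit j k) f hf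
    funext M
    have h3 : HasLineDerivAt ℝ (c • f) (c • f' M) M (symUnit j k) :=
      HasDerivAt.const_smul c (h M)
    simp only [symDeriv, Pi.smul_apply]
    rw [h3.lineDeriv, (h M).lineDeriv]

theorem linearOnSub_multiDeriv {m : ℕ} (a : MultiPair m) :
    LinearOnSub (PE m) (multiDeriv a) := by
  refine LinearOnSub.compAll fun l => ?_
  refine LinearOnSub.sum_smul _ fun σ => ?_
  exact LinearOnSub.compAll fun i => linearOnSub_symDeriv _ _

theorem PE2_slice_right {m : ℕ} (M : SymMat m) (g : SymMat m × SymMat m → ℂ) (hg : g ∈ PE2 m) :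
    (fun M' => g (M, M')) ∈ PE m := by
  induction hg using Submodule.span_induction with
  | mem g hg =>
    obtain ⟨f₁, h₁, f₂, h₂, rfl⟩ := hg
    exact (PE m).smul_mem (f₁ M) h₂
  | zero => exact (PE m).zero_mem
  | add f g _ _ hf hg => exact (PE m).add_mem hf hg
  | smul c f _ hf => exact (PE m).smul_mem c hf

theorem PE2_slice_left {m : ℕ} (M : SymMat m) (g : SymMat m × SymMat m → ℂ) (hg : g ∈ PE2 m) :
    (fun M' => g (M', M)) ∈ PE m := by
  induction hg using Submodule.span_induction with
  | mem g hg =>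
    obtain ⟨f₁, h₁, f₂, h₂, rfl⟩ := hg
    have := (PE m).smul_mem (f₂ M) h₁
    convert this using 1
    funext M'
    simp [mul_comm]
  | zero => exact (PE m).zero_mem
  | add f g _ _ hf hg => exact (PE m).add_mem hf hg
  | smul c f _ hf => exact (PE m).smul_mem c hf

theorem linearOnSub_multiDerivMinus {m : ℕ} (a : MultiPair m) :
    LinearOnSub (PE2 m) (multiDerivMinus a) := by
  have hadd : ∀ f ∈ PE2 m, ∀ g ∈ PE2 m,
      multiDerivMinus a (f + g) = multiDerivMinus a f + multiDerivMinus a g := by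
    intro f hf g hg
    funext M
    exact congrFun ((linearOnSub_multiDeriv a).add _ (PE2_slice_right M.1 f hf) _
      (PE2_slice_right M.1 g hg)) M.2
  have hsmul : ∀ (c : ℂ), ∀ f ∈ PE2 m, multiDerivMinus a (c • f) = c • multiDerivMinus a f := by
    intro c f hf
    funext M
    exact congrFun ((linearOnSub_multiDeriv a).smul c _ (PE2_slice_right M.1 f hf)) M.2
  refine ⟨fun g hg => ?_, hadd, hsmul⟩
  induction hg using Submodule.span_induction with
  | mem g hg =>
    obtain ⟨f₁, h₁, f₂, h₂, rfl⟩ := hg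
    refine Submodule.subset_span ⟨f₁, h₁, _, (linearOnSub_multiDeriv a).mem f₂ h₂, ?_⟩
    funext M
    exact congrFun ((linearOnSub_multiDeriv a).smul (f₁ M.1) f₂ h₂) M.2
  | zero =>
    have := hsmul 0 0 (PE2 m).zero_mem
    rw [zero_smul, zero_smul] at this
    rw [this]
    exact (PE2 m).zero_mem
  | add f g hf hg hf' hg' =>
    rw [hadd f hf g hg]
    exact (PE2 m).add_mem hf' hg'
  | smul c f hf hf' =>
    rw [hsmul c f hf]
    exact (PE2 m).smul_mem c hf'

theorem linearOnSub_multiDerivPlus {m : ℕ} (a : MultiPair m) :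
    LinearOnSub (PE2 m) (multiDerivPlus a) := by
  have hadd : ∀ f ∈ PE2 m, ∀ g ∈ PE2 m,
      multiDerivPlus a (f + g) = multiDerivPlus a f + multiDerivPlus a g := by
    intro f hf g hg
    funext M
    exact congrFun ((linearOnSub_multiDeriv a).add _ (PE2_slice_left M.2 f hf) _
      (PE2_slice_left M.2 g hg)) M.1
  have hsmul : ∀ (c : ℂ), ∀ f ∈ PE2 m, multiDerivPlus a (c • f) = c • multiDerivPlus a f := by
    intro c f hf
    funext M
    exact congrFun ((linearOnSub_multiDeriv a).smul c _ (PE2_slice_left M.2 f hf)) M.1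
  refine ⟨fun g hg => ?_, hadd, hsmul⟩
  induction hg using Submodule.span_induction with
  | mem g hg =>
    obtain ⟨f₁, h₁, f₂, h₂, rfl⟩ := hg
    refine Submodule.subset_span ⟨_, (linearOnSub_multiDeriv a).mem f₁ h₁, f₂, h₂, ?_⟩
    funext M
    have h := congrFun ((linearOnSub_multiDeriv a).smul (f₂ M.2) f₁ h₁) M.1
    have e : (f₂ M.2 • f₁) = fun M' => f₁ M' * f₂ M.2 := by
      funext M'
      simp [mul_comm]
    rw [e] at h
    rw [multiDerivPlus, h, Pi.smul_apply, smul_eq_mul, mul_comm]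
  | zero =>
    have := hsmul 0 0 (PE2 m).zero_mem
    rw [zero_smul, zero_smul] at this
    rw [this]
    exact (PE2 m).zero_mem
  | add f g hf hg hf' hg' =>
    rw [hadd f hf g hg]
    exact (PE2 m).add_mem hf' hg'
  | smul c f hf hf' =>
    rw [hsmul c f hf]
    exact (PE2 m).smul_mem c hf'

/-- Rapidly decaying continuous functions. -/
structure RapidDecay {X : Type*} [NormedAddCommGroup X] (g : X → ℂ) : Prop where
  cont : Continuous g
  decay : ∀ N : ℕ, ∃ C : ℝ, ∀ x, ‖g x‖ * (1 + ‖x‖) ^ N ≤ C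

theorem RapidDecay.memLp {X : Type*} [NormedAddCommGroup X] [NormedSpace ℝ X]
    [FiniteDimensional ℝ X] [MeasurableSpace X] [BorelSpace X] (μ : Measure X) [μ.IsAddHaarMeasure]
    {g : X → ℂ} (hg : RapidDecay g) {p : ℝ≥0∞} (hp : 1 ≤ p) : MemLp g p μ := by
  obtain ⟨C, hC⟩ := hg.decay (Module.finrank ℝ X + 1)
  have hpos : ∀ x : X, 0 < 1 + ‖x‖ := fun x => by positivity
  have hle : ∀ x, ‖g x‖ ≤ C * ((1 + ‖x‖) ^ (Module.finrank ℝ X + 1))⁻¹ := fun x => by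
    rw [← div_eq_mul_inv, le_div_iff₀ (pow_pos (hpos x) _)]
    exact hC x
  have hC0 : 0 ≤ C := le_trans (by positivity) (hC 0)
  have hle' : ∀ x, ‖g x‖ ≤ C := fun x => (hle x).trans (by
    apply mul_le_of_le_one_right hC0
    apply inv_le_one_of_one_le₀
    exact one_le_pow₀ (by linarith [norm_nonneg x]))
  have hmeas : AEStronglyMeasurable g μ := hg.cont.aestronglyMeasurable
  have h1 : Integrable g μ := by
    have hr : (Module.finrank ℝ X : ℝ) < ((Module.finrank ℝ X + 1 : ℕ) : ℝ) := by
      push_cast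
      linarith
    refine ((integrable_one_add_norm (μ := μ) hr).const_mul C).mono' hmeas
      (Filter.Eventually.of_forall fun x => ?_)
    rw [Real.rpow_neg (hpos x).le, Real.rpow_natCast]
    exact hle x
  have htop : MemLp g ∞ μ := memLp_top_of_bound hmeas C (Filter.Eventually.of_forall hle')
  rcases eq_or_ne p ∞ with rfl | hp'
  · exact htop
  have hp0 : p ≠ 0 := (lt_of_lt_of_le zero_lt_one hp).ne'
  have hpr : 1 ≤ p.toReal := by
    rw [← ENNReal.toReal_one]
    exact (ENNReal.toReal_le_toReal ENNReal.one_ne_top hp').2 hp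
  rw [← integrable_norm_rpow_iff hmeas hp0 hp']
  refine (h1.norm.const_mul (C ^ (p.toReal - 1))).mono'
    ((hmeas.norm.aemeasurable.pow_const _).aestronglyMeasurable)
    (Filter.Eventually.of_forall fun x => ?_)
  rw [Real.norm_of_nonneg (by positivity)]
  have : ‖g x‖ ^ p.toReal = ‖g x‖ ^ (p.toReal - 1) * ‖g x‖ := by
    rcases eq_or_lt_of_le (norm_nonneg (g x)) with h | h
    · rw [← h, Real.zero_rpow (by linarith), mul_zero]
    · rw [← Real.rpow_add_one h.ne']
      ring_nf
  rw [this]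
  gcongr
  exact hle' x

theorem RapidDecay.add {X : Type*} [NormedAddCommGroup X] {f g : X → ℂ} (hf : RapidDecay f)
    (hg : RapidDecay g) : RapidDecay (f + g) where
  cont := hf.cont.add hg.cont
  decay N := by
    obtain ⟨C, hC⟩ := hf.decay N
    obtain ⟨C', hC'⟩ := hg.decay N
    refine ⟨C + C', fun x => ?_⟩
    calc ‖f x + g x‖ * (1 + ‖x‖) ^ N ≤ (‖f x‖ + ‖g x‖) * (1 + ‖x‖) ^ N := by
          gcongr
          exact norm_add_le _ _
      _ ≤ C + C' := by
          rw [add_mul]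
          exact add_le_add (hC x) (hC' x)

theorem RapidDecay.const_smul {X : Type*} [NormedAddCommGroup X] {f : X → ℂ} (c : ℂ)
    (hf : RapidDecay f) : RapidDecay (c • f) where
  cont := hf.cont.const_smul c
  decay N := by
    obtain ⟨C, hC⟩ := hf.decay N
    refine ⟨‖c‖ * C, fun x => ?_⟩
    rw [Pi.smul_apply, norm_smul, mul_assoc]
    exact mul_le_mul_of_nonneg_left (hC x) (norm_nonneg c)

theorem RapidDecay.zero {X : Type*} [NormedAddCommGroup X] : RapidDecay (0 : X → ℂ) where
  cont := continuous_const
  decay N := ⟨0, fun x => by simp⟩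

theorem RapidDecay.mul_prod {X Y : Type*} [NormedAddCommGroup X] [NormedAddCommGroup Y]
    {f : X → ℂ} {g : Y → ℂ} (hf : RapidDecay f) (hg : RapidDecay g) :
    RapidDecay (fun z : X × Y => f z.1 * g z.2) where
  cont := (hf.cont.comp continuous_fst).mul (hg.cont.comp continuous_snd)
  decay N := by
    obtain ⟨C, hC⟩ := hf.decay N
    obtain ⟨C', hC'⟩ := hg.decay N
    refine ⟨C * C', fun z => ?_⟩
    have h1 : 1 + ‖z‖ ≤ (1 + ‖z.1‖) * (1 + ‖z.2‖) := by
      have : ‖z‖ ≤ ‖z.1‖ + ‖z.2‖ := by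
        rw [Prod.norm_def]
        exact max_le (by linarith [norm_nonneg z.2]) (by linarith [norm_nonneg z.1])
      nlinarith [mul_nonneg (norm_nonneg z.1) (norm_nonneg z.2)]
    calc ‖f z.1 * g z.2‖ * (1 + ‖z‖) ^ N
        ≤ ‖f z.1 * g z.2‖ * ((1 + ‖z.1‖) * (1 + ‖z.2‖)) ^ N := by gcongr
      _ = (‖f z.1‖ * (1 + ‖z.1‖) ^ N) * (‖g z.2‖ * (1 + ‖z.2‖) ^ N) := by
          rw [norm_mul, mul_pow]
          ring
      _ ≤ C * C' := by
          refine mul_le_mul (hC _) (hC' _) (by positivity) (le_trans (by positivity) (hC z.1))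

theorem posDef_lower_bound {m : ℕ} {Y : Matrix (Fin m) (Fin m) ℝ} (hY : Y.PosDef) :
    ∃ c : ℝ, 0 < c ∧ ∀ x : Fin m → ℝ, c * ∑ i, x i ^ 2 ≤ ∑ i, ∑ j, x i * Y i j * x j := by
  have hq : ∀ x : Fin m → ℝ, x ≠ 0 → 0 < ∑ i, ∑ j, x i * Y i j * x j := by
    intro x hx
    have := hY.dotProduct_mulVec_pos hx
    simpa [dotProduct, Matrix.mulVec, Finset.mul_sum, mul_assoc] using this
  set S := Metric.sphere (0 : EuclideanSpace ℝ (Fin m)) 1 with hS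
  have hScomp : IsCompact S := isCompact_sphere 0 1
  let Q : EuclideanSpace ℝ (Fin m) → ℝ := fun x => ∑ i, ∑ j, x i * Y i j * x j
  have hQ : Continuous Q := by
    simp only [Q]
    fun_prop
  rcases S.eq_empty_or_nonempty with he | hne
  · refine ⟨1, one_pos, fun x => ?_⟩
    have hx : x = 0 := by
      by_contra hx
      set y : EuclideanSpace ℝ (Fin m) := WithLp.toLp 2 x with hy
      have hy0 : y ≠ 0 := by
        intro h
        apply hx
        funext i
        exact congrArg (fun z : EuclideanSpace ℝ (Fin m) => z i) h
      have : (‖y‖⁻¹ • y) ∈ S := by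
        rw [hS, mem_sphere_zero_iff_norm, norm_smul, norm_inv, norm_norm,
          inv_mul_cancel₀ (norm_ne_zero_iff.2 hy0)]
      rw [he] at this
      exact this
    subst hx
    simp
  · obtain ⟨x0, hx0, hmin⟩ := hScomp.exists_isMinOn hne hQ.continuousOn
    have hx00 : (fun i => x0 i) ≠ 0 := by
      intro h
      have : x0 = 0 := by
        ext i
        exact congrFun h i
      rw [hS, mem_sphere_zero_iff_norm, this, norm_zero] at hx0
      exact zero_ne_one hx0
    refine ⟨Q x0, hq _ hx00, fun x => ?_⟩
    set y : EuclideanSpace ℝ (Fin m) := WithLp.toLp 2 x with hy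
    have hyx : ∀ i, y i = x i := fun i => rfl
    have hsum : ∑ i, x i ^ 2 = ‖y‖ ^ 2 := by
      rw [EuclideanSpace.norm_sq_eq]
      simp [hyx]
    rw [hsum]
    rcases eq_or_ne y 0 with h0 | h0
    · have hx0' : ∀ i, x i = 0 := fun i => by rw [← hyx, h0]; rfl
      simp [h0, hx0']
    have hpos : 0 < ‖y‖ := norm_pos_iff.2 h0
    have hmem : (‖y‖⁻¹ • y) ∈ S := by
      rw [hS, mem_sphere_zero_iff_norm, norm_smul, norm_inv, norm_norm, inv_mul_cancel₀ hpos.ne']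
    have hle : Q x0 ≤ Q (‖y‖⁻¹ • y) := hmin hmem
    have hQs : Q (‖y‖⁻¹ • y) = (‖y‖ ^ 2)⁻¹ * ∑ i, ∑ j, x i * Y i j * x j := by
      simp only [Q, PiLp.smul_apply, smul_eq_mul, hyx, Finset.mul_sum]
      refine Finset.sum_congr rfl fun i _ => Finset.sum_congr rfl fun j _ => ?_
      field_simp
    rw [hQs, inv_mul_eq_div, le_div_iff₀ (by positivity)] at hle
    exact hle

theorem norm_zeta_gram_le {m : ℕ} {B : Matrix (Fin m) (Fin m) ℂ}
    (hB : (B.map Complex.im).PosDef) :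
    ∃ c : ℝ, 0 < c ∧ ∀ φ : PhiSpace m, ‖zeta B (gram φ)‖ ≤ Real.exp (-c * ‖φ‖ ^ 2) := by
  obtain ⟨c, hc, h⟩ := posDef_lower_bound hB
  refine ⟨c / 2, by positivity, fun φ => ?_⟩
  rw [zeta, Complex.norm_exp, Real.exp_le_exp]
  have htr : (B * (gram φ).1.map (fun t : ℝ => (t : ℂ))).trace =
      ∑ l, ∑ i, ∑ j, ((φ (i, l) : ℝ) : ℂ) * B i j * ((φ (j, l) : ℝ) : ℂ) := by
    simp only [Matrix.trace, Matrix.diag_apply, Matrix.mul_apply, Matrix.map_apply, gram,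
      Matrix.of_apply, Complex.ofReal_sum, Complex.ofReal_mul, Finset.mul_sum]
    symm
    rw [Finset.sum_comm]
    refine Finset.sum_congr rfl fun i _ => ?_
    rw [Finset.sum_comm]
    refine Finset.sum_congr rfl fun j _ => Finset.sum_congr rfl fun l _ => ?_
    ring
  have him : (Complex.I / 2 * (B * (gram φ).1.map (fun t : ℝ => (t : ℂ))).trace).re =
      -(1 / 2) * ∑ l, ∑ i, ∑ j, φ (i, l) * (B i j).im * φ (j, l) := by
    have h1 : ∀ z : ℂ, (Complex.I / 2 * z).re = -(1 / 2) * z.im := by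
      intro z
      have : Complex.I / 2 = ((1 / 2 : ℝ) : ℂ) * Complex.I := by
        push_cast
        ring
      rw [this, mul_assoc, Complex.re_ofReal_mul, Complex.I_mul_re]
      ring
    rw [h1, htr]
    simp only [Complex.im_sum]
    congr 1
    refine Finset.sum_congr rfl fun l _ => Finset.sum_congr rfl fun i _ =>
      Finset.sum_congr rfl fun j _ => ?_
    rw [Complex.im_mul_ofReal, Complex.im_ofReal_mul]
  rw [him]
  have hnorm : ‖φ‖ ^ 2 = ∑ l, ∑ i, φ (i, l) ^ 2 := by
    rw [EuclideanSpace.norm_sq_eq, Fintype.sum_prod_type, Finset.sum_comm]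
    simp
  have hsum : c * ‖φ‖ ^ 2 ≤ ∑ l, ∑ i, ∑ j, φ (i, l) * (B i j).im * φ (j, l) := by
    rw [hnorm, Finset.mul_sum]
    exact Finset.sum_le_sum fun l _ => h fun i => φ (i, l)
  linarith

theorem norm_eval_gram_le {m : ℕ} (p : MvPolynomial (Fin m × Fin m) ℂ) :
    ∃ (C : ℝ) (N : ℕ), 0 ≤ C ∧ ∀ φ : PhiSpace m,
      ‖MvPolynomial.eval (fun x => (((gram φ).1 x.1 x.2 : ℝ) : ℂ)) p‖ ≤ C * (1 + ‖φ‖) ^ N := by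
  induction p using MvPolynomial.induction_on with
  | C a => exact ⟨‖a‖, 0, norm_nonneg a, fun φ => by simp⟩
  | add p q hp hq =>
    obtain ⟨C, N, hC, hp⟩ := hp
    obtain ⟨C', N', hC', hq⟩ := hq
    refine ⟨C + C', N + N', by positivity, fun φ => ?_⟩
    have h1 : (1 : ℝ) ≤ 1 + ‖φ‖ := by linarith [norm_nonneg φ]
    rw [map_add]
    calc _ ≤ C * (1 + ‖φ‖) ^ N + C' * (1 + ‖φ‖) ^ N' := (norm_add_le _ _).trans
            (add_le_add (hp φ) (hq φ))
      _ ≤ C * (1 + ‖φ‖) ^ (N + N') + C' * (1 + ‖φ‖) ^ (N + N') := by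
          gcongr <;> first | exact h1 | omega
      _ = _ := by ring
  | mul_X p i hp =>
    obtain ⟨C, N, hC, hp⟩ := hp
    refine ⟨C * (2 * halfDim m : ℕ), N + 2, by positivity, fun φ => ?_⟩
    have hcoord : ∀ x, |φ x| ≤ 1 + ‖φ‖ := fun x => by
      have := PiLp.norm_apply_le φ x
      rw [Real.norm_eq_abs] at this
      linarith
    have hent : |(gram φ).1 i.1 i.2| ≤ (2 * halfDim m : ℕ) * (1 + ‖φ‖) ^ 2 := by
      simp only [gram, Matrix.of_apply]
      refine (Finset.abs_sum_le_sum_abs _ _).trans ?_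
      refine (Finset.sum_le_card_nsmul _ _ ((1 + ‖φ‖) ^ 2) fun l _ => ?_).trans ?_
      · rw [abs_mul, sq]
        exact mul_le_mul (hcoord _) (hcoord _) (abs_nonneg _) (by positivity)
      · simp
    rw [map_mul, MvPolynomial.eval_X, norm_mul, Complex.norm_real, Real.norm_eq_abs]
    calc _ ≤ (C * (1 + ‖φ‖) ^ N) * ((2 * halfDim m : ℕ) * (1 + ‖φ‖) ^ 2) :=
          mul_le_mul (hp φ) hent (abs_nonneg _) (by positivity)
      _ = _ := by ring

theorem continuous_gram_entry {m : ℕ} (j k : Fin m) :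
    Continuous (fun φ : PhiSpace m => (gram φ).1 j k) := by
  simp only [gram, Matrix.of_apply]
  fun_prop

theorem rapidDecay_polyZeta {m : ℕ} (p : MvPolynomial (Fin m × Fin m) ℂ)
    {B : Matrix (Fin m) (Fin m) ℂ} (hB : (B.map Complex.im).PosDef) :
    RapidDecay (fun φ : PhiSpace m => polyZeta p B (gram φ)) where
  cont := by
    have hc := fun j k => continuous_gram_entry (m := m) j k
    refine Continuous.mul ?_ ?_
    · induction p using MvPolynomial.induction_on with
      | C a => simpa using continuous_const
      | add p q hp hq =>
        simp only [map_add]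
        exact hp.add hq
      | mul_X p i hp =>
        simp only [map_mul, MvPolynomial.eval_X]
        exact hp.mul (Complex.continuous_ofReal.comp (hc _ _))
    · simp only [zeta, Matrix.trace, Matrix.diag_apply, Matrix.mul_apply, Matrix.map_apply]
      refine Complex.continuous_exp.comp (continuous_const.mul ?_)
      refine continuous_finsetSum _ fun i _ => continuous_finsetSum _ fun j _ => ?_
      exact continuous_const.mul (Complex.continuous_ofReal.comp (hc _ _))
  decay K := by
    obtain ⟨c, hc, hz⟩ := norm_zeta_gram_le hB
    obtain ⟨C, N, hC, hp⟩ := norm_eval_gram_le p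
    refine ⟨C * ((N + K).factorial * Real.exp (1 / (4 * c) + 1)), fun φ => ?_⟩
    set r := ‖φ‖ with hr
    have hr0 : 0 ≤ r := norm_nonneg φ
    have h1 : (1 + r) ^ (N + K) ≤ (N + K).factorial * Real.exp (1 + r) := by
      have := Real.pow_div_factorial_le_exp (1 + r) (by positivity) (N + K)
      rwa [div_le_iff₀ (by positivity), mul_comm] at this
    have h2 : Real.exp (1 + r) * Real.exp (-c * r ^ 2) ≤ Real.exp (1 / (4 * c) + 1) := by
      rw [← Real.exp_add, Real.exp_le_exp]
      have : 1 / (4 * c) + 1 - (1 + r + -c * r ^ 2) = c * (r - 1 / (2 * c)) ^ 2 := by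
        field_simp
        ring
      nlinarith [mul_nonneg hc.le (sq_nonneg (r - 1 / (2 * c)))]
    rw [polyZeta, norm_mul]
    calc _ ≤ (C * (1 + r) ^ N) * Real.exp (-c * r ^ 2) * (1 + r) ^ K := by
          gcongr
          · exact hp φ
          · exact hz φ
      _ = C * ((1 + r) ^ (N + K) * Real.exp (-c * r ^ 2)) := by
          rw [pow_add]
          ring
      _ ≤ C * ((N + K).factorial * Real.exp (1 + r) * Real.exp (-c * r ^ 2)) := by gcongr
      _ ≤ _ := by
          rw [mul_assoc ((N + K).factorial : ℝ)]
          gcongr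

theorem rapidDecay_PE {m : ℕ} (f : SymMat m → ℂ) (hf : f ∈ PE m) :
    RapidDecay (fun φ : PhiSpace m => f (gram φ)) := by
  induction hf using Submodule.span_induction with
  | mem f hf =>
    obtain ⟨p, B, _, hB, rfl⟩ := hf
    exact rapidDecay_polyZeta p hB
  | zero => exact RapidDecay.zero
  | add f g _ _ hf hg => exact hf.add hg
  | smul c f _ hf => exact hf.const_smul c

theorem rapidDecay_PE2 {m : ℕ} (g : SymMat m × SymMat m → ℂ) (hg : g ∈ PE2 m) :
    RapidDecay (fun φ : PhiSpace m × PhiSpace m => g (gram φ.1, gram φ.2)) := by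
  induction hg using Submodule.span_induction with
  | mem g hg =>
    obtain ⟨f₁, h₁, f₂, h₂, rfl⟩ := hg
    exact (rapidDecay_PE f₁ h₁).mul_prod (rapidDecay_PE f₂ h₂)
  | zero => exact RapidDecay.zero
  | add f g _ _ hf hg => exact hf.add hg
  | smul c f _ hf => exact hf.const_smul c

theorem sqrt_sum_add_le {ι : Type*} [Fintype ι] (w x y z : ι → ℝ) (hw : ∀ i, 0 ≤ w i)
    (hz : ∀ i, 0 ≤ z i) (h : ∀ i, z i ≤ x i + y i) :
    Real.sqrt (∑ i, w i * z i ^ 2) ≤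
      Real.sqrt (∑ i, w i * x i ^ 2) + Real.sqrt (∑ i, w i * y i ^ 2) := by
  have key : ∀ v : ι → ℝ, Real.sqrt (∑ i, w i * v i ^ 2) =
      ‖(WithLp.toLp 2 fun i => Real.sqrt (w i) * v i : EuclideanSpace ℝ ι)‖ := by
    intro v
    rw [EuclideanSpace.norm_eq]
    congr 1
    refine Finset.sum_congr rfl fun i _ => ?_
    rw [Real.norm_eq_abs, sq_abs, mul_pow, Real.sq_sqrt (hw i)]
  calc Real.sqrt (∑ i, w i * z i ^ 2) ≤ Real.sqrt (∑ i, w i * (x i + y i) ^ 2) := by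
        apply Real.sqrt_le_sqrt
        refine Finset.sum_le_sum fun i _ => ?_
        exact mul_le_mul_of_nonneg_left (pow_le_pow_left₀ (hz i) (h i) 2) (hw i)
    _ ≤ _ := by
        rw [key x, key y]
        refine le_trans (le_of_eq ?_) (norm_add_le _ _)
        have := key fun i => x i + y i
        rw [this]
        congr 1
        ext i
        simp [mul_add]

theorem sqrt_sum_smul {ι : Type*} [Fintype ι] (w x z : ι → ℝ) (c : ℝ) (hc : 0 ≤ c)
    (h : ∀ i, z i = c * x i) :
    Real.sqrt (∑ i, w i * z i ^ 2) = c * Real.sqrt (∑ i, w i * x i ^ 2) := by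
  have : ∑ i, w i * z i ^ 2 = c ^ 2 * ∑ i, w i * x i ^ 2 := by
    rw [Finset.mul_sum]
    refine Finset.sum_congr rfl fun i _ => ?_
    rw [h i]
    ring
  rw [this, Real.sqrt_mul (sq_nonneg c), Real.sqrt_sq hc]

theorem toReal_eLpNorm_add_le {X : Type*} [MeasurableSpace X] {μ : Measure X} {p : ℝ≥0∞}
    (hp : 1 ≤ p) {f g : X → ℂ} (hf : MemLp f p μ) (hg : MemLp g p μ) :
    (eLpNorm (f + g) p μ).toReal ≤ (eLpNorm f p μ).toReal + (eLpNorm g p μ).toReal := by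
  rw [← ENNReal.toReal_add hf.eLpNorm_ne_top hg.eLpNorm_ne_top]
  exact ENNReal.toReal_mono (ENNReal.add_ne_top.2 ⟨hf.eLpNorm_ne_top, hg.eLpNorm_ne_top⟩)
    (eLpNorm_add_le hf.1 hg.1 hp)

theorem toReal_eLpNorm_smul {X : Type*} [MeasurableSpace X] {μ : Measure X} {p : ℝ≥0∞}
    (c : ℂ) (f : X → ℂ) :
    (eLpNorm (c • f) p μ).toReal = ‖c‖ * (eLpNorm f p μ).toReal := by
  rw [eLpNorm_const_smul, ENNReal.toReal_mul, toReal_enorm]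

theorem susyNorm_add_le {m : ℕ} {p : ℝ≥0∞} (hp : 1 ≤ p) {f g : SymMat m → ℂ}
    (hf : f ∈ PE m) (hg : g ∈ PE m) : susyNorm p (f + g) ≤ susyNorm p f + susyNorm p g := by
  refine sqrt_sum_add_le _ _ _ _ (fun _ => by positivity) (fun _ => ENNReal.toReal_nonneg)
    fun a => ?_
  rw [(linearOnSub_multiDeriv a).add f hf g hg]
  exact toReal_eLpNorm_add_le hp
    ((rapidDecay_PE _ ((linearOnSub_multiDeriv a).mem f hf)).memLp volume hp)
    ((rapidDecay_PE _ ((linearOnSub_multiDeriv a).mem g hg)).memLp volume hp)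

theorem susyNorm_smul {m : ℕ} {p : ℝ≥0∞} (c : ℂ) {f : SymMat m → ℂ} (hf : f ∈ PE m) :
    susyNorm p (c • f) = ‖c‖ * susyNorm p f := by
  refine sqrt_sum_smul _ _ _ _ (norm_nonneg c) fun a => ?_
  rw [(linearOnSub_multiDeriv a).smul c f hf]
  exact toReal_eLpNorm_smul c _

theorem susyNorm2_add_le {m : ℕ} {p : ℝ≥0∞} (hp : 1 ≤ p) {f g : SymMat m × SymMat m → ℂ}
    (hf : f ∈ PE2 m) (hg : g ∈ PE2 m) :
    susyNorm2 p (f + g) ≤ susyNorm2 p f + susyNorm2 p g := by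
  refine sqrt_sum_add_le _ _ _ _ (fun _ => by positivity) (fun _ => ENNReal.toReal_nonneg)
    fun a => ?_
  have h := (linearOnSub_multiDerivPlus a.1).comp (linearOnSub_multiDerivMinus a.2)
  have hh := h.add f hf g hg
  have : (volume : Measure (PhiSpace m × PhiSpace m)).IsAddHaarMeasure :=
    Measure.prod.instIsAddHaarMeasure _ _
  rw [hh]
  exact toReal_eLpNorm_add_le hp
    ((rapidDecay_PE2 _ (h.mem f hf)).memLp (volume : Measure (PhiSpace m × PhiSpace m)) hp)
    ((rapidDecay_PE2 _ (h.mem g hg)).memLp (volume : Measure (PhiSpace m × PhiSpace m)) hp)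

theorem susyNorm2_smul {m : ℕ} {p : ℝ≥0∞} (c : ℂ) {f : SymMat m × SymMat m → ℂ}
    (hf : f ∈ PE2 m) : susyNorm2 p (c • f) = ‖c‖ * susyNorm2 p f := by
  refine sqrt_sum_smul _ _ _ _ (norm_nonneg c) fun a => ?_
  have h := (linearOnSub_multiDerivPlus a.1).comp (linearOnSub_multiDerivMinus a.2)
  have hh := h.smul c f hf
  rw [hh]
  exact toReal_eLpNorm_smul c _

/-! ### The Banach spaces `ℋ_p` and `𝒦_p` -/

/-- The space `PE(m)`, equipped below with the norm `|||f|||_{2,p} = |||f|||_2 + |||f|||_p`. -/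
def NormedPE (m : ℕ) (_p : ℝ≥0∞) : Type := PE m

instance (m : ℕ) (p : ℝ≥0∞) : AddCommGroup (NormedPE m p) := inferInstanceAs (AddCommGroup (PE m))

instance (m : ℕ) (p : ℝ≥0∞) : Module ℂ (NormedPE m p) := inferInstanceAs (Module ℂ (PE m))

/-- The norm `|||f|||_{2,p} = |||f|||_2 + |||f|||_p` on `PE(m)`. -/
def normPE (m : ℕ) (p : ℝ≥0∞) [hp : Fact (1 ≤ p)] : Seminorm ℂ (NormedPE m p) :=
  Seminorm.of (fun f : PE m => susyNorm 2 f.1 + susyNorm p f.1)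
    (fun f g => by
      have h2 := susyNorm_add_le (p := 2) one_le_two f.2 g.2
      have h := susyNorm_add_le hp.out f.2 g.2
      change susyNorm 2 (f.1 + g.1) + susyNorm p (f.1 + g.1) ≤ _
      linarith)
    (fun c f => by
      change susyNorm 2 (c • f.1) + susyNorm p (c • f.1) = _
      rw [susyNorm_smul c f.2, susyNorm_smul c f.2, mul_add])

instance (m : ℕ) (p : ℝ≥0∞) [Fact (1 ≤ p)] : SeminormedAddCommGroup (NormedPE m p) :=
  (normPE m p).toAddGroupSeminorm.toSeminormedAddCommGroup

instance (m : ℕ) (p : ℝ≥0∞) [Fact (1 ≤ p)] : NormedSpace ℂ (NormedPE m p) where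
  norm_smul_le c f := ((normPE m p).smul' c f).le

/-- The Banach space `ℋ_p`, the completion of `PE(m)` with respect to `|||·|||_{2,p}`. -/
abbrev SpaceH (m : ℕ) (p : ℝ≥0∞) [Fact (1 ≤ p)] : Type := UniformSpace.Completion (NormedPE m p)

/-- The inclusion of `PE(m)` in `ℋ_p`. -/
def toH {m : ℕ} (p : ℝ≥0∞) [Fact (1 ≤ p)] (f : PE m) : SpaceH m p :=
  ((show NormedPE m p from f : NormedPE m p) : UniformSpace.Completion (NormedPE m p))

/-- The space `PE(m) ⊗ PE(m)`, equipped below with the norm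
`||||g||||_{2,p} = ||||g||||_2 + ||||g||||_p`. -/
def NormedPE2 (m : ℕ) (_p : ℝ≥0∞) : Type := PE2 m

instance (m : ℕ) (p : ℝ≥0∞) : AddCommGroup (NormedPE2 m p) :=
  inferInstanceAs (AddCommGroup (PE2 m))

instance (m : ℕ) (p : ℝ≥0∞) : Module ℂ (NormedPE2 m p) := inferInstanceAs (Module ℂ (PE2 m))

/-- The norm `||||g||||_{2,p} = ||||g||||_2 + ||||g||||_p` on `PE(m) ⊗ PE(m)`. -/
def normPE2 (m : ℕ) (p : ℝ≥0∞) [hp : Fact (1 ≤ p)] : Seminorm ℂ (NormedPE2 m p) :=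
  Seminorm.of (fun g : PE2 m => susyNorm2 2 g.1 + susyNorm2 p g.1)
    (fun f g => by
      have h2 := susyNorm2_add_le (p := 2) one_le_two f.2 g.2
      have h := susyNorm2_add_le hp.out f.2 g.2
      change susyNorm2 2 (f.1 + g.1) + susyNorm2 p (f.1 + g.1) ≤ _
      linarith)
    (fun c f => by
      change susyNorm2 2 (c • f.1) + susyNorm2 p (c • f.1) = _
      rw [susyNorm2_smul c f.2, susyNorm2_smul c f.2, mul_add])

instance (m : ℕ) (p : ℝ≥0∞) [Fact (1 ≤ p)] : SeminormedAddCommGroup (NormedPE2 m p) :=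
  (normPE2 m p).toAddGroupSeminorm.toSeminormedAddCommGroup

instance (m : ℕ) (p : ℝ≥0∞) [Fact (1 ≤ p)] : NormedSpace ℂ (NormedPE2 m p) where
  norm_smul_le c f := ((normPE2 m p).smul' c f).le

/-- The Banach space `𝒦_p`, the completion of `PE(m) ⊗ PE(m)` with respect to `||||·||||_{2,p}`. -/
abbrev SpaceK (m : ℕ) (p : ℝ≥0∞) [Fact (1 ≤ p)] : Type := UniformSpace.Completion (NormedPE2 m p)

/-- The inclusion of `PE(m) ⊗ PE(m)` in `𝒦_p`. -/
def toK {m : ℕ} (p : ℝ≥0∞) [Fact (1 ≤ p)] (g : PE2 m) : SpaceK m p :=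
  ((show NormedPE2 m p from g : NormedPE2 m p) : UniformSpace.Completion (NormedPE2 m p))

/-! ### Multiplication operators on `PE(m)` and `PE(m) ⊗ PE(m)` -/

theorem zeta_mul {m : ℕ} (B C : Matrix (Fin m) (Fin m) ℂ) (M : SymMat m) :
    zeta B M * zeta C M = zeta (B + C) M := by
  rw [zeta, zeta, zeta, ← Complex.exp_add, Matrix.add_mul, Matrix.trace_add, mul_add]

theorem PE_mul_mem {m : ℕ} {f g : SymMat m → ℂ} (hf : f ∈ PE m) (hg : g ∈ PE m) :
    (fun M => f M * g M) ∈ PE m := by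
  induction hf using Submodule.span_induction with
  | mem f hf =>
    obtain ⟨p, B, hBs, hB, rfl⟩ := hf
    induction hg using Submodule.span_induction with
    | mem g hg =>
      obtain ⟨q, C, hCs, hC, rfl⟩ := hg
      refine Submodule.subset_span ⟨p * q, B + C, hBs.add hCs, ?_, ?_⟩
      · have : (B + C).map Complex.im = B.map Complex.im + C.map Complex.im := by
          ext i j
          simp
        rw [this]
        exact hB.add hC
      · funext M
        simp only [polyZeta, map_mul, ← zeta_mul]
        ring
    | zero =>
      convert (PE m).zero_mem using 1
      funext M
      simp
    | add g g' _ _ hg hg' =>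
      convert (PE m).add_mem hg hg' using 1
      funext M
      simp [mul_add]
    | smul c g _ hg =>
      convert (PE m).smul_mem c hg using 1
      funext M
      simp only [Pi.smul_apply, smul_eq_mul]
      ring
  | zero =>
    convert (PE m).zero_mem using 1
    funext M
    simp
  | add f f' _ _ hf hf' =>
    convert (PE m).add_mem hf hf' using 1
    funext M
    simp [add_mul]
  | smul c f _ hf =>
    convert (PE m).smul_mem c hf using 1
    funext M
    simp only [Pi.smul_apply, smul_eq_mul]
    ring

/-- A real symmetric matrix, as a complex matrix. -/
def complexify {m : ℕ} (B : SymMat m) : Matrix (Fin m) (Fin m) ℂ :=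
  B.1.map fun t : ℝ => (t : ℂ)

theorem PE_zeta_mul_mem {m : ℕ} (B : SymMat m) {f : SymMat m → ℂ} (hf : f ∈ PE m) :
    (fun M => zeta (complexify B) M * f M) ∈ PE m := by
  induction hf using Submodule.span_induction with
  | mem f hf =>
    obtain ⟨p, C, hCs, hC, rfl⟩ := hf
    refine Submodule.subset_span ⟨p, complexify B + C, Matrix.IsSymm.add ?_ hCs, ?_, ?_⟩
    · have hB : B.1.IsSymm := B.2
      exact hB.map _
    · have : (complexify B + C).map Complex.im = C.map Complex.im := by
        ext i j
        simp [complexify]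
      rwa [this]
    · funext M
      simp only [polyZeta, ← zeta_mul]
      ring
  | zero =>
    convert (PE m).zero_mem using 1
    funext M
    simp
  | add f f' _ _ hf hf' =>
    convert (PE m).add_mem hf hf' using 1
    funext M
    simp [mul_add]
  | smul c f _ hf =>
    convert (PE m).smul_mem c hf using 1
    funext M
    simp only [Pi.smul_apply, smul_eq_mul]
    ring

/-- `ξ_B(M₊, M₋) = e^{(i/2) Tr(B M₊ - B M₋)}` for real symmetric `B`. -/
def xi {m : ℕ} (B : SymMat m) (M : SymMat m × SymMat m) : ℂ :=
  Complex.exp (Complex.I / 2 * (((B.1 * M.1.1).trace - (B.1 * M.2.1).trace : ℝ) : ℂ))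

theorem xi_eq {m : ℕ} (B : SymMat m) (M : SymMat m × SymMat m) :
    xi B M = zeta (complexify B) M.1 * zeta (complexify (-B)) M.2 := by
  have h : ∀ A N : SymMat m, (complexify A * N.1.map (fun t : ℝ => (t : ℂ))).trace =
      (((A.1 * N.1).trace : ℝ) : ℂ) := by
    intro A N
    simp [complexify, Matrix.trace, Matrix.mul_apply]
  rw [xi, zeta, zeta, h, h, ← Complex.exp_add]
  have hneg : ((-B : SymMat m).1 * M.2.1).trace = -(B.1 * M.2.1).trace := by
    rw [← Matrix.trace_neg, ← Matrix.neg_mul]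
    rfl
  rw [hneg]
  congr 1
  push_cast
  ring

theorem PE2_mul_mem {m : ℕ} {f g : SymMat m × SymMat m → ℂ} (hf : f ∈ PE2 m) (hg : g ∈ PE2 m) :
    (fun M => f M * g M) ∈ PE2 m := by
  induction hf using Submodule.span_induction with
  | mem f hf =>
    obtain ⟨f₁, h₁, f₂, h₂, rfl⟩ := hf
    induction hg using Submodule.span_induction with
    | mem g hg =>
      obtain ⟨g₁, k₁, g₂, k₂, rfl⟩ := hg
      refine Submodule.subset_span ⟨_, PE_mul_mem h₁ k₁, _, PE_mul_mem h₂ k₂, ?_⟩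
      funext M
      ring
    | zero =>
      convert (PE2 m).zero_mem using 1
      funext M
      simp
    | add g g' _ _ hg hg' =>
      convert (PE2 m).add_mem hg hg' using 1
      funext M
      simp [mul_add]
    | smul c g _ hg =>
      convert (PE2 m).smul_mem c hg using 1
      funext M
      simp only [Pi.smul_apply, smul_eq_mul]
      ring
  | zero =>
    convert (PE2 m).zero_mem using 1
    funext M
    simp
  | add f f' _ _ hf hf' =>
    convert (PE2 m).add_mem hf hf' using 1
    funext M
    simp [add_mul]
  | smul c f _ hf =>
    convert (PE2 m).smul_mem c hf using 1
    funext M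
    simp only [Pi.smul_apply, smul_eq_mul]
    ring

theorem PE2_xi_mul_mem {m : ℕ} (B : SymMat m) {f : SymMat m × SymMat m → ℂ} (hf : f ∈ PE2 m) :
    (fun M => xi B M * f M) ∈ PE2 m := by
  induction hf using Submodule.span_induction with
  | mem f hf =>
    obtain ⟨f₁, h₁, f₂, h₂, rfl⟩ := hf
    refine Submodule.subset_span
      ⟨_, PE_zeta_mul_mem B h₁, _, PE_zeta_mul_mem (-B) h₂, ?_⟩
    funext M
    rw [xi_eq]
    ring
  | zero =>
    convert (PE2 m).zero_mem using 1
    funext M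
    simp
  | add f f' _ _ hf hf' =>
    convert (PE2 m).add_mem hf hf' using 1
    funext M
    simp [mul_add]
  | smul c f _ hf =>
    convert (PE2 m).smul_mem c hf using 1
    funext M
    simp only [Pi.smul_apply, smul_eq_mul]
    ring

/-- The multiplication operator `ℳ(f)` on `PE(m)` for `f ∈ PE(m)`. -/
def mulPE {m : ℕ} (f g : PE m) : PE m := ⟨fun M => f.1 M * g.1 M, PE_mul_mem f.2 g.2⟩

/-- The multiplication operator `ℳ(ζ_B)` on `PE(m)` for real symmetric `B`. -/
def mulZeta {m : ℕ} (B : SymMat m) (f : PE m) : PE m :=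
  ⟨fun M => zeta (complexify B) M * f.1 M, PE_zeta_mul_mem B f.2⟩

/-- The multiplication operator `ℳ(g)` on `PE(m) ⊗ PE(m)` for `g ∈ PE(m) ⊗ PE(m)`. -/
def mulPE2 {m : ℕ} (f g : PE2 m) : PE2 m := ⟨fun M => f.1 M * g.1 M, PE2_mul_mem f.2 g.2⟩

/-- The multiplication operator `ℳ(ξ_B)` on `PE(m) ⊗ PE(m)` for real symmetric `B`. -/
def mulXi {m : ℕ} (B : SymMat m) (f : PE2 m) : PE2 m :=
  ⟨fun M => xi B M * f.1 M, PE2_xi_mul_mem B f.2⟩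

/-! ### The supersymmetric Fourier transforms `T` and `𝒯` -/

/-- `Tr(φ' φᵀ)`. -/
def pairing {m : ℕ} (φ' φ : PhiSpace m) : ℝ := ∑ x, φ' x * φ x

/-- The function
`φ' ↦ ((-1)^{mn} / π^{mn}) ∫ e^{i Tr(φ' φᵀ)} (D_{𝐈,𝐈} f)(φ φᵀ) dφ`, which defines `(T f)(φ' φ'ᵀ)`. -/
def susyIntegral {m : ℕ} (f : SymMat m → ℂ) (φ' : PhiSpace m) : ℂ :=
  (-1) ^ (m * halfDim m) / (Real.pi : ℂ) ^ (m * halfDim m) *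
    ∫ φ : PhiSpace m, Complex.exp (Complex.I * (pairing φ' φ : ℂ)) *
      multiDeriv (MultiPair.full m) f (gram φ)

/-- The function of `(φ'₊, φ'₋)` which defines `(𝒯 g)(φ'₊ φ'₊ᵀ, φ'₋ φ'₋ᵀ)`. -/
def susyIntegral2 {m : ℕ} (g : SymMat m × SymMat m → ℂ) (φ' : PhiSpace m × PhiSpace m) : ℂ :=
  1 / (Real.pi : ℂ) ^ (2 * m * halfDim m) *
    ∫ φ : PhiSpace m × PhiSpace m,
      Complex.exp (Complex.I * ((pairing φ'.1 φ.1 + pairing φ'.2 φ.2 : ℝ) : ℂ)) *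
        multiDerivPlus (MultiPair.full m) (multiDerivMinus (MultiPair.full m) g)
          (gram φ.1, gram φ.2)

open Classical in
/-- The supersymmetric Fourier transform `T : PE(m) → PE(m)`: `T f` is the unique function in `PE(m)`
with `(T f)(φ' φ'ᵀ) = susyIntegral f φ'` for all `φ'`. -/
def susyT {m : ℕ} (f : PE m) : PE m :=
  if h : ∃ g : PE m, ∀ φ', g.1 (gram φ') = susyIntegral f.1 φ' then h.choose else 0

open Classical in
/-- The supersymmetric Fourier transform `𝒯 = T ⊗ T` on `PE(m) ⊗ PE(m)`: `𝒯 g` is the unique function in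
`PE(m) ⊗ PE(m)` with `(𝒯 g)(φ'₊ φ'₊ᵀ, φ'₋ φ'₋ᵀ) = susyIntegral2 g (φ'₊, φ'₋)`. -/
def susyT2 {m : ℕ} (g : PE2 m) : PE2 m :=
  if h : ∃ u : PE2 m, ∀ φ', u.1 (gram φ'.1, gram φ'.2) = susyIntegral2 g.1 φ' then h.choose else 0

/-- The operator `A`, given on the dense subspace `PE(m)`, extends to a (necessarily unique) bounded
operator from `ℋ_p` to `ℋ_q`, which is compact. -/
def IsCompactFromHToH {m : ℕ} (A : PE m → PE m) (p q : ℝ≥0∞) [Fact (1 ≤ p)] [Fact (1 ≤ q)] : Prop :=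
  ∃ S : SpaceH m p →L[ℂ] SpaceH m q, IsCompactOperator S ∧ ∀ f : PE m, S (toH p f) = toH q (A f)

/-- The operator `A`, given on the dense subspace `PE(m) ⊗ PE(m)`, extends to a (necessarily unique)
bounded operator from `𝒦_p` to `𝒦_q`, which is compact. -/
def IsCompactFromKToK {m : ℕ} (A : PE2 m → PE2 m) (p q : ℝ≥0∞) [Fact (1 ≤ p)] [Fact (1 ≤ q)] :
    Prop :=
  ∃ S : SpaceK m p →L[ℂ] SpaceK m q, IsCompactOperator S ∧ ∀ f : PE2 m, S (toK p f) = toK q (A f)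

end

/-! ### The Fourier transform on `L¹ ∩ L²` -/

section FourierIntegral

variable {k : ℕ}

/-! Oscillatory kernels. On L¹ ∩ L² the power n + 1 of the operator "multiply by the phase of D,
then apply ℱ" is an integral operator with kernel e^{(i/2) x·P_n x} e^{i x·ρ(y)} χ(y), where ρ is
continuous and χ is continuous and bounded (`HasOscKernel`). One more factor on the left leads to a
Fresnel integral with the quadratic form E = D + P_n. If E is invertible, the result is a constant
times the phase of -E⁻¹ at x + ρ(y) (`fourierL2_phase_mul`), and expanding this phase restores the
shape of the kernel. Hence P_0 = 0 and P_{n+1} = -(D + P_n)⁻¹. The matrices -(D + P_n) are the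
pivots of block elimination in the tridiagonal matrices 𝒟_j, so D ∈ 𝒮(k, L) makes the L denominators
that occur invertible (`isUnit_add_contFrac`).

Compactness. Between two decaying multipliers such an operator takes f to h₁(x) κ_x(f), where κ_x is
a functional on L² that is bounded and norm continuous in x. A factor (1 + |x|)⁻¹, paid for by the
decay of h₁, makes the family of functionals relatively compact. Evaluation on a compact set of
functionals is compact by Arzelà–Ascoli, and what is left of h₁ lies in every Lᵖ
(`exists_compact_of_family`).

Supersymmetric operators. The exponentials ζ_B are joint eigenfunctions of all D_{𝐚̄,𝐚}, with
products of minors of (i/2)B as eigenvalues. Expanding a minor of A + B into products of minors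
gives a Leibniz rule. The Gaussian integral gives T ζ_B = ζ_{-B⁻¹}, and Jacobi's theorem on
complementary minors of an inverse shows that each D_{𝐚̄,𝐚} T f is a constant times the Fourier
integral of a single D_{𝐛̄,𝐛} f (`exists_multiDeriv_susyT`). Such identities pass from the ζ_B to
all of PE(m) by differentiation in B, which brings down the entries of M (`IsExpDiff.eq_of_zeta`).
The derivatives in M and in B commute already as operators on the polynomial coefficients, so this
step needs little analysis.

Transfer. The functions φ ↦ (D_{𝐚̄,𝐚} f)(φφᵀ) are called jets here. On jets T acts as ℱ on
L²(ℝ^{2mn}) and ζ_B as the phase of a block diagonal matrix with blocks B; for 𝒯 and ξ_B the blocks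
are B and -B. The nondegeneracy of B passes to these block matrices (`blockPhase_mem_nondegSet`).
Each jet of the image is thus a finite sum of compact operators applied to L² jets of f. Since the
norms are weighted sums over jets, compactness descends to the completions
(`exists_compact_extension`). Only L² jets of f enter, which is why p and q are independent. -/

theorem fourierInv_L2_ae_eq (f : L2 k) (hf : Integrable f volume) :
    (𝓕⁻ f : L2 k) =ᵐ[volume] 𝓕⁻ (f : EuclideanSpace ℝ (Fin k) → ℂ) := by
  have hcont : Continuous (𝓕⁻ (f : EuclideanSpace ℝ (Fin k) → ℂ)) :=
    VectorFourier.fourierIntegral_continuous Real.continuous_fourierChar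
      (by exact (continuous_inner (𝕜 := ℝ)).neg) hf
  -- Both sides are locally integrable, so it suffices to test them against smooth functions of
  -- compact support, that is, to compare them as distributions.
  refine ae_eq_of_integral_contDiff_smul_eq ((Lp.memLp _).locallyIntegrable one_le_two)
    hcont.locallyIntegrable fun g hg hgs => ?_
  let G : SchwartzMap (EuclideanSpace ℝ (Fin k)) ℂ :=
    HasCompactSupport.toSchwartzMap (f := fun x => (g x : ℂ))
      (hgs.comp_left (g := fun t : ℝ => (t : ℂ)) Complex.ofReal_zero)
      (Complex.ofRealCLM.contDiff.comp hg)
  have hG : ∀ x, G x = (g x : ℂ) := fun x => rfl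
  have h1 := congrArg (fun T => T G) (Lp.fourierInv_toTemperedDistribution_eq f)
  simp only [TemperedDistribution.fourierInv_apply, Lp.toTemperedDistribution_apply] at h1
  -- Fubini moves the transform from the test function to f. The kernel is symmetric, so the flipped
  -- form is the original one.
  have h2 : ∫ x, (𝓕⁻ G) x • f x = ∫ x, G x • 𝓕⁻ (f : EuclideanSpace ℝ (Fin k) → ℂ) x := by
    rw [SchwartzMap.fourierInv_coe]
    have := VectorFourier.integral_fourierIntegral_smul_eq_flip (μ := volume) (ν := volume)
      (L := -innerₗ (EuclideanSpace ℝ (Fin k))) (f := G)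
      (g := (f : EuclideanSpace ℝ (Fin k) → ℂ)) Real.continuous_fourierChar
      (by exact (continuous_inner (𝕜 := ℝ)).neg) G.integrable hf
    have hflip : (-innerₗ (EuclideanSpace ℝ (Fin k))).flip =
        -innerₗ (EuclideanSpace ℝ (Fin k)) := by
      ext x y
      simp [real_inner_comm]
    rw [hflip] at this
    exact this
  calc ∫ x, g x • (𝓕⁻ f : L2 k) x = ∫ x, G x • (𝓕⁻ f : L2 k) x := rfl
    _ = ∫ x, G x • 𝓕⁻ (f : EuclideanSpace ℝ (Fin k) → ℂ) x := by rw [← h1, h2]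
    _ = _ := rfl

theorem fourierL2_ae_eq (f : L2 k) (hf : Integrable f volume) :
    fourierL2 f =ᵐ[volume] fun y => (((2 * Real.pi) ^ (-(k : ℝ) / 2) : ℝ) : ℂ) *
      ∫ x, Complex.exp (Complex.I * (inner ℝ y x : ℝ)) * f x := by
  have hne : (2 * Real.pi)⁻¹ ≠ 0 := by positivity
  have hq : Measure.QuasiMeasurePreserving
      (fun y : EuclideanSpace ℝ (Fin k) => (2 * Real.pi)⁻¹ • y) volume volume := by
    refine ⟨measurable_const_smul _, ?_⟩
    rw [Measure.map_addHaar_smul volume hne]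
    exact Measure.smul_absolutelyContinuous
  have h1 := hq.ae_eq_comp (fourierInv_L2_ae_eq f hf)
  filter_upwards [(memLp_fourier_dilation f).coeFn_toLp, h1] with y hy hy1
  rw [fourierL2, hy]
  simp only [Function.comp_apply] at hy1
  rw [hy1, Real.fourierInv_eq']
  congr 2
  funext v
  rw [inner_smul_right, smul_eq_mul, real_inner_comm]
  congr 2
  have : 2 * Real.pi * ((2 * Real.pi)⁻¹ * inner ℝ y v) = inner ℝ y v := by
    field_simp
  rw [this, mul_comm]

theorem fourierL2_sub (f g : L2 k) : fourierL2 (f - g) = fourierL2 f - fourierL2 g := by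
  have hne : (2 * Real.pi)⁻¹ ≠ 0 := by positivity
  have hq : Measure.QuasiMeasurePreserving
      (fun y : EuclideanSpace ℝ (Fin k) => (2 * Real.pi)⁻¹ • y) volume volume := by
    refine ⟨measurable_const_smul _, ?_⟩
    rw [Measure.map_addHaar_smul volume hne]
    exact Measure.smul_absolutelyContinuous
  have e : (𝓕⁻ (f - g) : L2 k) = 𝓕⁻ f - 𝓕⁻ g := map_sub (Lp.fourierTransformₗᵢ _ ℂ).symm f g
  have h1 := hq.ae_eq_comp (Lp.coeFn_sub (𝓕⁻ f : L2 k) (𝓕⁻ g))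
  apply Lp.ext
  filter_upwards [(memLp_fourier_dilation f).coeFn_toLp, (memLp_fourier_dilation g).coeFn_toLp,
    (memLp_fourier_dilation (f - g)).coeFn_toLp, h1, Lp.coeFn_sub (fourierL2 f) (fourierL2 g)]
    with y h2 h3 h4 h5 h6
  rw [h6, Pi.sub_apply, fourierL2, fourierL2, fourierL2, h2, h3, h4, e]
  simp only [Function.comp_apply, Pi.sub_apply] at h5
  rw [h5, mul_sub]

/-- Only continuity is used later, so the constant stays unevaluated: it is the normalization times
a power of the Jacobian of the dilation by 1/(2π), and 𝓕⁻ itself is an isometry. -/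
theorem norm_fourierL2_le : ∃ C : ℝ, ∀ f : L2 k, ‖fourierL2 f‖ ≤ C * ‖f‖ := by
  have hne : (2 * Real.pi)⁻¹ ≠ 0 := by positivity
  set c : ℂ := (((2 * Real.pi) ^ (-(k : ℝ) / 2) : ℝ) : ℂ) with hc
  set r : ℝ≥0∞ := ENNReal.ofReal
    |((2 * Real.pi)⁻¹ ^ Module.finrank ℝ (EuclideanSpace ℝ (Fin k)))⁻¹| with hr
  have hrt : r ^ (1 / (2 : ℝ≥0∞)).toReal ≠ ∞ :=
    ENNReal.rpow_ne_top_of_nonneg ENNReal.toReal_nonneg ENNReal.ofReal_ne_top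
  refine ⟨‖c‖ * (r ^ (1 / (2 : ℝ≥0∞)).toReal).toReal, fun f => ?_⟩
  rw [fourierL2, Lp.norm_toLp]
  have h1 : eLpNorm (fun y : EuclideanSpace ℝ (Fin k) =>
      c * (𝓕⁻ f : L2 k) ((2 * Real.pi)⁻¹ • y)) 2 volume =
      ‖c‖ₑ * (r ^ (1 / (2 : ℝ≥0∞)).toReal * eLpNorm (𝓕⁻ f : L2 k) 2 volume) := by
    have h2 : (fun y : EuclideanSpace ℝ (Fin k) => c * (𝓕⁻ f : L2 k) ((2 * Real.pi)⁻¹ • y)) =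
      c • ((𝓕⁻ f : L2 k) ∘ fun y => (2 * Real.pi)⁻¹ • y) := rfl
    rw [h2, eLpNorm_const_smul, ← eLpNorm_map_measure ?_ (measurable_const_smul _).aemeasurable,
      Measure.map_addHaar_smul volume hne, eLpNorm_smul_measure_of_ne_top (by simp), smul_eq_mul]
    rw [Measure.map_addHaar_smul volume hne]
    exact (Lp.aestronglyMeasurable _).smul_measure _
  rw [h1, ENNReal.toReal_mul, ENNReal.toReal_mul, toReal_enorm, ← Lp.norm_def]
  have h3 : ‖(𝓕⁻ f : L2 k)‖ = ‖f‖ := (Lp.fourierTransformₗᵢ _ ℂ).symm.norm_map f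
  rw [h3, mul_assoc]

theorem continuous_fourierL2 : Continuous (fourierL2 (k := k)) := by
  obtain ⟨C, hC⟩ := norm_fourierL2_le (k := k)
  refine (LipschitzWith.of_dist_le_mul (K := C.toNNReal) fun f g => ?_).continuous
  rw [dist_eq_norm, dist_eq_norm, ← fourierL2_sub]
  exact (hC _).trans (mul_le_mul_of_nonneg_right (Real.le_coe_toNNReal C) (norm_nonneg _))

end FourierIntegral

/-! ### Simultaneous diagonalization -/

section Diagonalization

open Matrix

variable {J : Type*} [Fintype J] [DecidableEq J]

/-- The complex matrix with the entries of a real one. -/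
abbrev toC {I J : Type*} (A : Matrix I J ℝ) : Matrix I J ℂ := A.map fun t : ℝ => (t : ℂ)

theorem toC_mul {I J K : Type*} [Fintype J] (A : Matrix I J ℝ) (B : Matrix J K ℝ) :
    toC (A * B) = toC A * toC B := by
  ext i k
  simp [Matrix.mul_apply]

theorem toC_apply {I J : Type*} (A : Matrix I J ℝ) (i : I) (j : J) :
    toC A i j = (A i j : ℂ) := rfl

theorem toC_transpose {I J : Type*} (A : Matrix I J ℝ) : toC Aᵀ = (toC A)ᵀ := rfl

theorem toC_one {I : Type*} [DecidableEq I] : toC (1 : Matrix I I ℝ) = 1 := by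
  ext i k
  by_cases h : i = k
  · subst h
    simp
  · simp [h]

theorem det_toC (A : Matrix J J ℝ) : (toC A).det = (A.det : ℂ) := by
  exact (RingHom.map_det Complex.ofRealHom A).symm

theorem exists_orthogonal_diagonalization {A : Matrix J J ℝ} (hA : A.IsSymm) :
    ∃ (U : Matrix J J ℝ) (d : J → ℝ), Uᵀ * U = 1 ∧ A = Uᵀ * diagonal d * U ∧
      (A.PosDef → ∀ i, 0 < d i) := by
  have hH : A.IsHermitian := by
    rw [Matrix.IsHermitian, Matrix.conjTranspose_eq_transpose_of_trivial]
    exact hA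
  refine ⟨(star (hH.eigenvectorUnitary : Matrix J J ℝ)), hH.eigenvalues, ?_, ?_, ?_⟩
  · have := (hH.eigenvectorUnitary).2.2
    rw [star_eq_conjTranspose, Matrix.conjTranspose_eq_transpose_of_trivial] at this ⊢
    simpa using this
  · have := hH.spectral_theorem
    rw [Unitary.conjStarAlgAut_apply] at this
    rw [star_eq_conjTranspose, Matrix.conjTranspose_eq_transpose_of_trivial] at this ⊢
    simpa using this
  · intro h
    exact h.eigenvalues_pos

/-- A complex symmetric matrix with positive definite imaginary part is congruent to a diagonal
matrix with entries of imaginary part `1`. -/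
theorem exists_congruence_diagonal {B : Matrix J J ℂ} (hB : B.IsSymm)
    (hY : (B.map Complex.im).PosDef) :
    ∃ (W : Matrix J J ℝ) (d : J → ℝ), IsUnit W.det ∧
      B = (toC W)ᵀ * diagonal (fun i => (d i : ℂ) + Complex.I) * toC W := by
  set X : Matrix J J ℝ := B.map Complex.re with hX
  set Y : Matrix J J ℝ := B.map Complex.im with hYdef
  have hXs : X.IsSymm := hB.map _
  have hYs : Y.IsSymm := hB.map _
  obtain ⟨U, e, hU, hYU, he⟩ := exists_orthogonal_diagonalization hYs
  have he := he hY
  -- The imaginary part is Y = NᵀN, so the congruence by N⁻¹ turns it into the identity.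
  set N : Matrix J J ℝ := diagonal (fun i => Real.sqrt (e i)) * U with hN
  have hYN : Y = Nᵀ * N := by
    rw [hN, transpose_mul, diagonal_transpose, Matrix.mul_assoc, ← Matrix.mul_assoc _ _ U,
      diagonal_mul_diagonal, ← Matrix.mul_assoc]
    simp_rw [Real.mul_self_sqrt (he _).le]
    exact hYU
  have hdetN : IsUnit N.det := by
    have h := hY.det_pos
    rw [hYN, det_mul, det_transpose] at h
    exact isUnit_iff_ne_zero.2 fun h0 => by rw [h0] at h; simp at h
  clear_value N
  clear hN
  have hNi : N⁻¹ * N = 1 := nonsing_inv_mul _ hdetN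
  have hNt : Nᵀ * N⁻¹ᵀ = 1 := by rw [← transpose_mul, hNi, transpose_one]
  -- The transformed real part can now be diagonalized by an orthogonal matrix, which leaves the
  -- identity in the imaginary part unchanged.
  obtain ⟨V, d, hV, hXV, -⟩ := exists_orthogonal_diagonalization
    (A := N⁻¹ᵀ * X * N⁻¹) (by
      rw [Matrix.IsSymm, transpose_mul, transpose_mul, transpose_transpose, hXs.eq,
        Matrix.mul_assoc])
  have hX' : X = Nᵀ * (N⁻¹ᵀ * X * N⁻¹) * N := by
    calc X = (Nᵀ * N⁻¹ᵀ) * X * (N⁻¹ * N) := by rw [hNt, hNi, Matrix.one_mul, Matrix.mul_one]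
      _ = _ := by simp only [Matrix.mul_assoc]
  have hV' : IsUnit V.det := by
    have := congrArg det hV
    rw [det_mul, det_one] at this
    exact IsUnit.of_mul_eq_one_right _ this
  refine ⟨V * N, d, by rw [det_mul]; exact hV'.mul hdetN, ?_⟩
  have hBXY : B = toC X + Complex.I • toC Y := by
    ext i j
    simp only [hX, hYdef, toC, Matrix.add_apply, Matrix.smul_apply, Matrix.map_apply, smul_eq_mul]
    rw [mul_comm, Complex.re_add_im]
  have h1 : X = (V * N)ᵀ * diagonal d * (V * N) := by
    rw [hX', hXV, transpose_mul]
    simp only [Matrix.mul_assoc]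
  have h2 : Y = (V * N)ᵀ * (V * N) := by
    rw [hYN, transpose_mul, Matrix.mul_assoc, ← Matrix.mul_assoc Vᵀ, hV, Matrix.one_mul]
  have h3 : diagonal (fun i => (d i : ℂ) + Complex.I) =
      toC (diagonal d) + Complex.I • (1 : Matrix J J ℂ) := by
    ext i j
    by_cases h : i = j <;> simp [h]
  rw [hBXY, h3, Matrix.mul_add, Matrix.add_mul, h1, h2]
  simp only [toC_mul, Matrix.mul_smul, Matrix.smul_mul, Matrix.mul_one,
    toC_transpose]

theorem im_ofReal_add_I_inv (d : ℝ) : (-((d : ℂ) + Complex.I)⁻¹).im = (d ^ 2 + 1)⁻¹ := by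
  have : Complex.normSq ((d : ℂ) + Complex.I) = d ^ 2 + 1 := by
    simp [Complex.normSq_apply]
    ring
  rw [Complex.neg_im, Complex.inv_im, this]
  simp [neg_div]

theorem ofReal_add_I_ne_zero (d : ℝ) : (d : ℂ) + Complex.I ≠ 0 := by
  intro h
  have := congrArg Complex.im h
  simp at this

/-- In the congruent diagonal form the entries are d + i with d real, and these do not vanish. -/
theorem det_ne_zero_of_im_posDef {B : Matrix J J ℂ} (hB : B.IsSymm)
    (hY : (B.map Complex.im).PosDef) : IsUnit B.det := by
  obtain ⟨W, d, hW, rfl⟩ := exists_congruence_diagonal hB hY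
  rw [isUnit_iff_ne_zero, det_mul, det_mul, det_transpose, det_toC, det_diagonal]
  have hW' : (W.det : ℂ) ≠ 0 := Complex.ofReal_ne_zero.2 hW.ne_zero
  exact mul_ne_zero (mul_ne_zero hW' (Finset.prod_ne_zero_iff.2 fun i _ =>
    ofReal_add_I_ne_zero _)) hW'

theorem inv_congruence_diagonal {W : Matrix J J ℝ} (d : J → ℝ) (hW : IsUnit W.det) :
    ((toC W)ᵀ * diagonal (fun i => (d i : ℂ) + Complex.I) * toC W)⁻¹ =
      toC W⁻¹ * diagonal (fun i => ((d i : ℂ) + Complex.I)⁻¹) * (toC W⁻¹)ᵀ := by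
  have h1 : toC W * toC W⁻¹ = 1 := by rw [← toC_mul, mul_nonsing_inv _ hW, toC_one]
  have h1' : (toC W)ᵀ * (toC W⁻¹)ᵀ = 1 := by
    rw [← transpose_mul, ← toC_mul, nonsing_inv_mul _ hW, toC_one, transpose_one]
  have h2 : diagonal (fun i => (d i : ℂ) + Complex.I) *
      diagonal (fun i => ((d i : ℂ) + Complex.I)⁻¹) = 1 := by
    rw [diagonal_mul_diagonal]
    simp [mul_inv_cancel₀ (ofReal_add_I_ne_zero _)]
  apply inv_eq_right_inv
  calc _ = (toC W)ᵀ * (diagonal (fun i => (d i : ℂ) + Complex.I) * ((toC W * toC W⁻¹) *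
        diagonal (fun i => ((d i : ℂ) + Complex.I)⁻¹)) * (toC W⁻¹)ᵀ) := by
        simp only [Matrix.mul_assoc]
    _ = 1 := by rw [h1, Matrix.one_mul, h2, Matrix.one_mul, h1']

/-- The map B ↦ -B⁻¹ preserves the Siegel upper half space: in the diagonal form, -1/(d + i) has
imaginary part 1/(d² + 1). -/
theorem im_neg_inv_posDef {B : Matrix J J ℂ} (hB : B.IsSymm)
    (hY : (B.map Complex.im).PosDef) : ((-B⁻¹).map Complex.im).PosDef := by
  obtain ⟨W, d, hW, rfl⟩ := exists_congruence_diagonal hB hY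
  rw [inv_congruence_diagonal d hW]
  have h : (-(toC W⁻¹ * diagonal (fun i => ((d i : ℂ) + Complex.I)⁻¹) * (toC W⁻¹)ᵀ)).map
      Complex.im = W⁻¹ * diagonal (fun i => (d i ^ 2 + 1)⁻¹) * (W⁻¹)ᴴ := by
    ext i j
    rw [Matrix.map_apply, Matrix.neg_apply, Matrix.mul_apply, Matrix.mul_apply, Complex.neg_im,
      Complex.im_sum, ← Finset.sum_neg_distrib]
    refine Finset.sum_congr rfl fun l _ => ?_
    rw [Matrix.mul_diagonal, Matrix.mul_diagonal, Matrix.transpose_apply,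
      Matrix.conjTranspose_apply, star_trivial, ← im_ofReal_add_I_inv, toC_apply, toC_apply,
      Complex.im_mul_ofReal, Complex.im_ofReal_mul, Complex.neg_im]
    ring
  rw [h]
  refine PosDef.mul_mul_conjTranspose_same
    (Matrix.posDef_diagonal_iff.2 fun i => by positivity) ?_
  refine Matrix.vecMul_injective_iff_isUnit.2 ?_
  rw [Matrix.isUnit_iff_isUnit_det, Matrix.det_nonsing_inv]
  exact hW.ringInverse

theorem isSymm_neg_inv {B : Matrix J J ℂ} (hB : B.IsSymm) : (-B⁻¹).IsSymm := by
  rw [Matrix.IsSymm, transpose_neg, transpose_nonsing_inv, hB.eq]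

end Diagonalization

/-! ### Gaussian integrals -/

section Gaussian

open Matrix

variable {J : Type*} [Fintype J]

/-- The quadratic form `x · A x` of a complex matrix at a real vector. -/
def quadC (A : Matrix J J ℂ) (x : J → ℝ) : ℂ := ∑ i, ∑ j, (x i : ℂ) * A i j * x j

theorem quadC_eq_dotProduct (A : Matrix J J ℂ) (x : J → ℝ) :
    quadC A x = (fun i => (x i : ℂ)) ⬝ᵥ (A *ᵥ fun i => (x i : ℂ)) := by
  simp only [quadC, dotProduct, Matrix.mulVec, Finset.mul_sum, mul_assoc]

theorem toC_mulVec (W : Matrix J J ℝ) (x : J → ℝ) :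
    (toC W) *ᵥ (fun i => (x i : ℂ)) = fun i => ((W *ᵥ x) i : ℂ) := by
  funext i
  simp [Matrix.mulVec, dotProduct]

theorem norm_exp_quadC_le_one {A : Matrix J J ℂ} (hA : (A.map Complex.im).PosDef) (x : J → ℝ) :
    ‖Complex.exp (Complex.I / 2 * quadC A x)‖ ≤ 1 := by
  have h := hA.posSemidef.dotProduct_mulVec_nonneg x
  have h1 : (quadC A x).im = star x ⬝ᵥ ((A.map Complex.im) *ᵥ x) := by
    simp only [quadC, Complex.im_sum, Complex.im_mul_ofReal, Complex.im_ofReal_mul, dotProduct,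
      Matrix.mulVec, Finset.mul_sum, Matrix.map_apply, mul_assoc, star_trivial]
  rw [Complex.norm_exp, ← Real.exp_zero, Real.exp_le_exp]
  have h2 : (Complex.I / 2 * quadC A x).re = -(quadC A x).im / 2 := by
    have : Complex.I / 2 * quadC A x = ((1 / 2 : ℝ) : ℂ) * (Complex.I * quadC A x) := by
      push_cast
      ring
    rw [this, Complex.re_ofReal_mul, Complex.I_mul_re]
    ring
  rw [h2, h1]
  linarith

variable [DecidableEq J]

theorem quadC_congruence (W : Matrix J J ℝ) (e : J → ℂ) (x : J → ℝ) :
    quadC ((toC W)ᵀ * diagonal e * toC W) x = ∑ i, e i * ((W *ᵥ x) i : ℂ) ^ 2 := by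
  rw [quadC_eq_dotProduct, ← Matrix.mulVec_mulVec, ← Matrix.mulVec_mulVec, toC_mulVec,
    Matrix.mulVec_transpose, dotProduct_comm, ← Matrix.dotProduct_mulVec, toC_mulVec]
  simp only [dotProduct, Matrix.mulVec_diagonal]
  exact Finset.sum_congr rfl fun i _ => by ring

/-- The substitution u = Wv splits the integral into one-dimensional Gaussians with coefficients
-(i/2)(d + i), whose real part is 1/2. Roots are taken factor by factor, so no branch of the square
root of a determinant has to be chosen. -/
theorem gaussian_congruence {W : Matrix J J ℝ} (hW : IsUnit W.det) (d : J → ℝ) (y : J → ℝ) :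
    Integrable (fun v : J → ℝ => Complex.exp (Complex.I * ((∑ j, y j * v j : ℝ) : ℂ) +
      Complex.I / 2 * quadC ((toC W)ᵀ * diagonal (fun i => (d i : ℂ) + Complex.I) * toC W) v)) ∧
    ∫ v : J → ℝ, Complex.exp (Complex.I * ((∑ j, y j * v j : ℝ) : ℂ) +
      Complex.I / 2 * quadC ((toC W)ᵀ * diagonal (fun i => (d i : ℂ) + Complex.I) * toC W) v) =
    (|W.det|⁻¹ : ℝ) * (∏ i, (2 * Real.pi * Complex.I / ((d i : ℂ) + Complex.I)) ^ (1 / 2 : ℂ)) *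
      Complex.exp (-(Complex.I / 2) *
        quadC ((toC W)ᵀ * diagonal (fun i => (d i : ℂ) + Complex.I) * toC W)⁻¹ y) := by
  set b : J → ℂ := fun i => -(Complex.I / 2) * ((d i : ℂ) + Complex.I) with hb
  set η : J → ℝ := (W⁻¹)ᵀ *ᵥ y with hη
  set c : J → ℂ := fun i => Complex.I * (η i : ℂ) with hc
  have hbre : ∀ i, 0 < (b i).re := fun i => by
    simp [hb]
  set G : (J → ℝ) → ℂ := fun u => Complex.exp (-∑ i, b i * (u i : ℂ) ^ 2 + ∑ i, c i * u i) with hG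
  have hηW : ∀ v, ∑ j, y j * v j = ∑ j, η j * (W *ᵥ v) j := by
    intro v
    change y ⬝ᵥ v = η ⬝ᵥ (W *ᵥ v)
    rw [hη, Matrix.mulVec_transpose, ← Matrix.dotProduct_mulVec, Matrix.mulVec_mulVec,
      Matrix.nonsing_inv_mul _ hW, Matrix.one_mulVec]
  have hint : (fun v : J → ℝ => Complex.exp (Complex.I * ((∑ j, y j * v j : ℝ) : ℂ) +
      Complex.I / 2 * quadC ((toC W)ᵀ * diagonal (fun i => (d i : ℂ) + Complex.I) * toC W) v)) =
      G ∘ Matrix.toLin' W := by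
    funext v
    simp only [hG, Function.comp_apply, Matrix.toLin'_apply]
    rw [quadC_congruence, hηW, Finset.mul_sum]
    congr 1
    rw [add_comm, ← Finset.sum_neg_distrib]
    congr 1
    · exact Finset.sum_congr rfl fun i _ => by simp only [hb]; ring
    · push_cast
      rw [Finset.mul_sum]
      exact Finset.sum_congr rfl fun i _ => by simp only [hc]; ring
  have hGc : Continuous G := by
    simp only [hG]
    fun_prop
  have hmeas : Continuous (Matrix.toLin' W) := LinearMap.continuous_of_finiteDimensional _
  have hmap := Real.map_matrix_volume_pi_eq_smul_volume_pi hW.ne_zero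
  have hGi : Integrable G := GaussianFourier.integrable_cexp_neg_sum_mul_add hbre c
  rw [hint]
  constructor
  · have h1 : Integrable G (Measure.map (Matrix.toLin' W) volume) := by
      rw [hmap]
      exact hGi.smul_measure ENNReal.ofReal_ne_top
    exact h1.comp_measurable hmeas.measurable
  · have h2 : ∫ v, (G ∘ Matrix.toLin' W) v = ∫ u, G u ∂(Measure.map (Matrix.toLin' W) volume) :=
      (integral_map hmeas.aemeasurable hGc.aestronglyMeasurable).symm
    rw [h2, hmap, integral_smul_measure, GaussianFourier.integral_cexp_neg_sum_mul_add hbre c,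
      ENNReal.toReal_ofReal (abs_nonneg _), Finset.prod_mul_distrib, ← Complex.exp_sum,
      inv_congruence_diagonal d hW, Complex.real_smul, ← mul_assoc, abs_inv]
    have hfac : ∀ i, (Real.pi : ℂ) / b i =
        2 * Real.pi * Complex.I / ((d i : ℂ) + Complex.I) := by
      intro i
      have h0 := ofReal_add_I_ne_zero (d i)
      simp only [hb]
      have hI := Complex.I_ne_zero
      field_simp
      rw [Complex.I_sq]
    simp_rw [hfac]
    congr 2
    have hq := quadC_congruence (W⁻¹)ᵀ (fun i => ((d i : ℂ) + Complex.I)⁻¹) y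
    rw [toC_transpose, transpose_transpose] at hq
    rw [hq, Finset.mul_sum]
    refine Finset.sum_congr rfl fun i _ => ?_
    simp only [hc, hb]
    have h0 := ofReal_add_I_ne_zero (d i)
    have hI := Complex.I_ne_zero
    rw [← hη]
    field_simp
    ring

/-- Gaussian integrals over vectors: the constant is determined up to sign by its square. -/
theorem gaussian_integral {B : Matrix J J ℂ} (hB : B.IsSymm) (hY : (B.map Complex.im).PosDef) :
    ∃ c : ℂ, c ^ 2 * B.det = (2 * Real.pi * Complex.I) ^ Fintype.card J ∧ ∀ y : J → ℝ,
      Integrable (fun v : J → ℝ => Complex.exp (Complex.I * ((∑ j, y j * v j : ℝ) : ℂ) +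
        Complex.I / 2 * quadC B v)) ∧
      ∫ v : J → ℝ, Complex.exp (Complex.I * ((∑ j, y j * v j : ℝ) : ℂ) +
        Complex.I / 2 * quadC B v) = c * Complex.exp (-(Complex.I / 2) * quadC B⁻¹ y) := by
  obtain ⟨W, d, hW, rfl⟩ := exists_congruence_diagonal hB hY
  refine ⟨_, ?_, gaussian_congruence hW d⟩
  have hW' : (W.det : ℂ) ≠ 0 := Complex.ofReal_ne_zero.2 hW.ne_zero
  have h1 : (((|W.det|⁻¹ : ℝ) : ℂ)) ^ 2 = ((W.det : ℂ) ^ 2)⁻¹ := by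
    rw [← Complex.ofReal_pow, inv_pow, sq_abs]
    push_cast
    rfl
  rw [det_mul, det_mul, det_transpose, det_toC, det_diagonal, mul_pow, h1, ← Finset.prod_pow]
  have h2 : ∀ i, ((2 * Real.pi * Complex.I / ((d i : ℂ) + Complex.I)) ^ (1 / 2 : ℂ)) ^ 2 =
      2 * Real.pi * Complex.I / ((d i : ℂ) + Complex.I) := fun i => by
    rw [← Complex.cpow_nat_mul]
    norm_num
  simp_rw [h2]
  rw [Finset.prod_div_distrib, Finset.prod_const, Finset.card_univ]
  have h3 : ∏ i, ((d i : ℂ) + Complex.I) ≠ 0 :=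
    Finset.prod_ne_zero_iff.2 fun i _ => ofReal_add_I_ne_zero _
  field_simp

/-- Gaussian integrals over matrices with an even number of columns. -/
theorem gaussian_integral_even {κ : Type*} [Fintype κ] [DecidableEq κ] {n : ℕ}
    (hκ : Fintype.card κ = 2 * n) {B : Matrix J J ℂ} (hB : B.IsSymm)
    (hY : (B.map Complex.im).PosDef) (y : J × κ → ℝ) :
    Integrable (fun v : J × κ → ℝ => Complex.exp (Complex.I * ((∑ x, y x * v x : ℝ) : ℂ) +
      Complex.I / 2 * ∑ l, quadC B (fun j => v (j, l)))) ∧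
    ∫ v : J × κ → ℝ, Complex.exp (Complex.I * ((∑ x, y x * v x : ℝ) : ℂ) +
        Complex.I / 2 * ∑ l, quadC B (fun j => v (j, l))) =
      (2 * Real.pi * Complex.I) ^ (Fintype.card J * n) / B.det ^ n *
        Complex.exp (-(Complex.I / 2) * ∑ l, quadC B⁻¹ (fun j => y (j, l))) := by
  obtain ⟨W, d, hW, rfl⟩ := exists_congruence_diagonal hB hY
  -- The Kronecker product with the identity applies W to each column separately.
  set W' : Matrix (J × κ) (J × κ) ℝ := Matrix.kroneckerMap (· * ·) W (1 : Matrix κ κ ℝ) with hW'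
  have hdet : W'.det = W.det ^ (2 * n) := by
    rw [hW', Matrix.det_kronecker, det_one, one_pow, mul_one, hκ]
  have hU : IsUnit W'.det := by
    rw [hdet]
    exact hW.pow _
  have hquad : ∀ (V : Matrix J J ℝ) (e : J → ℂ) (v : J × κ → ℝ),
      quadC ((toC (Matrix.kroneckerMap (· * ·) V (1 : Matrix κ κ ℝ)))ᵀ *
        diagonal (fun x : J × κ => e x.1) *
        toC (Matrix.kroneckerMap (· * ·) V (1 : Matrix κ κ ℝ))) v =
      ∑ l, quadC ((toC V)ᵀ * diagonal e * toC V) (fun j => v (j, l)) := by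
    intro V e v
    simp_rw [quadC_congruence]
    rw [Fintype.sum_prod_type, Finset.sum_comm]
    refine Finset.sum_congr rfl fun l _ => Finset.sum_congr rfl fun i _ => ?_
    congr 3
    simp [Matrix.mulVec, dotProduct, Fintype.sum_prod_type, Matrix.one_apply]
  have hg := gaussian_congruence hU (fun x : J × κ => d x.1) y
  have hWi : W'⁻¹ = Matrix.kroneckerMap (· * ·) W⁻¹ (1 : Matrix κ κ ℝ) := by
    rw [hW', Matrix.inv_kronecker, inv_one]
  have hq2 : quadC ((toC W')ᵀ * diagonal (fun x : J × κ => (d x.1 : ℂ) + Complex.I) * toC W')⁻¹ y =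
      ∑ l, quadC ((toC W)ᵀ * diagonal (fun x => (d x : ℂ) + Complex.I) * toC W)⁻¹
        (fun j => y (j, l)) := by
    rw [inv_congruence_diagonal _ hU, inv_congruence_diagonal _ hW, hWi]
    have := hquad (W⁻¹)ᵀ (fun i => ((d i : ℂ) + Complex.I)⁻¹) y
    rw [toC_transpose W⁻¹, transpose_transpose] at this
    rw [← this]
    congr 2
    · congr 1
      ext i j
      simp [Matrix.one_apply, eq_comm]
    · ext i j
      simp [Matrix.one_apply, eq_comm]
  have hq1 := fun v => hquad W (fun i => (d i : ℂ) + Complex.I) v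
  rw [hq2] at hg
  simp_rw [hW', hq1] at hg
  refine ⟨hg.1, hg.2.trans ?_⟩
  congr 1
  rw [← hW', hdet, Fintype.prod_prod_type]
  simp_rw [Finset.prod_const, Finset.card_univ, hκ]
  -- Each square root occurs once per column, hence 2n times, and the choice of branch drops out.
  have h2 : ∀ i, ((2 * Real.pi * Complex.I / ((d i : ℂ) + Complex.I)) ^ (1 / 2 : ℂ)) ^ (2 * n) =
      (2 * Real.pi * Complex.I / ((d i : ℂ) + Complex.I)) ^ n := fun i => by
    rw [pow_mul, ← Complex.cpow_nat_mul]
    norm_num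
  simp_rw [h2]
  rw [Finset.prod_pow, Finset.prod_div_distrib, Finset.prod_const, Finset.card_univ, det_mul,
    det_mul, det_transpose, det_toC, det_diagonal, abs_pow, pow_mul, sq_abs]
  have hW0 : (W.det : ℂ) ≠ 0 := Complex.ofReal_ne_zero.2 hW.ne_zero
  have h3 : ∏ i, ((d i : ℂ) + Complex.I) ≠ 0 :=
    Finset.prod_ne_zero_iff.2 fun i _ => ofReal_add_I_ne_zero _
  push_cast
  rw [div_pow, ← pow_mul, ← pow_mul, mul_pow, mul_pow]
  field_simp
  rw [mul_pow, ← pow_mul]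

end Gaussian

/-! ### Multiplication operators on `L²` -/

section MulL2

variable {k : ℕ}

theorem memLp_bdd_mul {h : EuclideanSpace ℝ (Fin k) → ℂ} (hm : AEStronglyMeasurable h volume)
    {C : ℝ} (hC : ∀ x, ‖h x‖ ≤ C) (f : L2 k) : MemLp (fun x => h x * f x) 2 volume := by
  refine (Lp.memLp f).of_le_mul (c := C) (hm.mul (Lp.aestronglyMeasurable f))
    (Filter.Eventually.of_forall fun x => ?_)
  rw [norm_mul]
  exact mul_le_mul_of_nonneg_right (hC x) (norm_nonneg _)

theorem mulL2_ae_eq {h : EuclideanSpace ℝ (Fin k) → ℂ} (hm : AEStronglyMeasurable h volume)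
    {C : ℝ} (hC : ∀ x, ‖h x‖ ≤ C) (f : L2 k) : mulL2 h f =ᵐ[volume] fun x => h x * f x := by
  rw [mulL2, dif_pos (memLp_bdd_mul hm hC f)]
  exact MemLp.coeFn_toLp _

theorem norm_sq_L2 (f : L2 k) : ‖f‖ ^ 2 = ∫ x, ‖f x‖ ^ 2 := by
  have h := L2.inner_def (𝕜 := ℂ) f f
  rw [inner_self_eq_norm_sq_to_K] at h
  have h2 : ∀ x, inner ℂ (f x) (f x) = (((‖f x‖ ^ 2 : ℝ)) : ℂ) := fun x => by
    rw [inner_self_eq_norm_sq_to_K]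
    push_cast
    rfl
  simp_rw [h2] at h
  have h3 := integral_ofReal (𝕜 := ℂ) (μ := (volume : Measure (EuclideanSpace ℝ (Fin k))))
    (f := fun x => ‖f x‖ ^ 2)
  have h4 := h.trans h3
  exact Complex.ofReal_injective (by push_cast; exact h4)

/-- Dominated convergence with the majorant (2C)²|f|². This strong convergence serves twice: for the
limit of regularized phases, and for the continuity in x of the L² vectors that represent a kernel.
-/
theorem tendsto_mulL2 {h : ℕ → EuclideanSpace ℝ (Fin k) → ℂ} {g : EuclideanSpace ℝ (Fin k) → ℂ}
    (hm : ∀ n, Continuous (h n)) (gm : Continuous g) {C : ℝ} (hC : ∀ n x, ‖h n x‖ ≤ C)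
    (gC : ∀ x, ‖g x‖ ≤ C)
    (hlim : ∀ x, Filter.Tendsto (fun n => h n x) Filter.atTop (nhds (g x))) (f : L2 k) :
    Filter.Tendsto (fun n => mulL2 (h n) f) Filter.atTop (nhds (mulL2 g f)) := by
  rw [tendsto_iff_norm_sub_tendsto_zero]
  have hsq : Filter.Tendsto (fun n => ‖mulL2 (h n) f - mulL2 g f‖ ^ 2) Filter.atTop (nhds 0) := by
    have heq : ∀ n, ‖mulL2 (h n) f - mulL2 g f‖ ^ 2 = ∫ x, ‖(h n x - g x) * f x‖ ^ 2 := by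
      intro n
      rw [norm_sq_L2]
      refine integral_congr_ae ?_
      filter_upwards [Lp.coeFn_sub (mulL2 (h n) f) (mulL2 g f),
        mulL2_ae_eq (hm n).aestronglyMeasurable (hC n) f,
        mulL2_ae_eq gm.aestronglyMeasurable gC f] with x h1 h2 h3
      simp only [h1, Pi.sub_apply, h2, h3, sub_mul]
    simp_rw [heq]
    have h0 : (0 : ℝ) = ∫ _ : EuclideanSpace ℝ (Fin k), (0 : ℝ) := by simp
    rw [h0]
    have hf2 : Integrable (fun x => ‖f x‖ ^ 2) volume := (Lp.memLp f).integrable_norm_pow (by simp)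
    refine tendsto_integral_of_dominated_convergence (fun x => (2 * C) ^ 2 * ‖f x‖ ^ 2)
      (fun n => ?_) (hf2.const_mul _) (fun n => Filter.Eventually.of_forall fun x => ?_)
      (Filter.Eventually.of_forall fun x => ?_)
    · exact ((((hm n).sub gm).aestronglyMeasurable.mul (Lp.aestronglyMeasurable f)).norm.pow 2)
    · rw [Real.norm_of_nonneg (by positivity), norm_mul, mul_pow]
      refine mul_le_mul_of_nonneg_right (pow_le_pow_left₀ (norm_nonneg _) ?_ 2) (by positivity)
      calc _ ≤ ‖h n x‖ + ‖g x‖ := norm_sub_le _ _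
        _ ≤ 2 * C := by linarith [hC n x, gC x]
    · have h1 := (((hlim x).sub_const (g x)).mul_const (f x)).norm.pow 2
      simpa using h1
  have := hsq.sqrt
  simpa [Real.sqrt_sq (norm_nonneg _)] using this

/-! ### Unimodular quadratic phases -/

theorem phase_eq (D : SymMat k) (x : EuclideanSpace ℝ (Fin k)) :
    phase D x = Complex.exp (Complex.I / 2 * quadC (toC D.1) x) := by
  rw [phase, quadC]
  push_cast
  rfl

theorem continuous_phase (D : SymMat k) : Continuous (phase D) := by
  unfold phase
  fun_prop

theorem norm_phase (D : SymMat k) (x : EuclideanSpace ℝ (Fin k)) : ‖phase D x‖ = 1 := by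
  rw [phase]
  have : Complex.I / 2 * ((∑ i, ∑ j, x i * D.1 i j * x j : ℝ) : ℂ) =
      ((∑ i, ∑ j, x i * D.1 i j * x j) / 2 : ℝ) * Complex.I := by
    push_cast
    ring
  rw [this, Complex.norm_exp_ofReal_mul_I]

theorem phase_add (D E : SymMat k) (x : EuclideanSpace ℝ (Fin k)) :
    phase (D + E) x = phase D x * phase E x := by
  rw [phase, phase, phase, ← Complex.exp_add, ← mul_add, ← Complex.ofReal_add,
    ← Finset.sum_add_distrib]
  congr 3
  refine Finset.sum_congr rfl fun i _ => ?_
  rw [← Finset.sum_add_distrib]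
  refine Finset.sum_congr rfl fun j _ => ?_
  change x i * (D.1 i j + E.1 i j) * x j = _
  ring

theorem phase_zero (x : EuclideanSpace ℝ (Fin k)) : phase 0 x = 1 := by
  simp [phase]

theorem phase_mulL2_ae_eq (D : SymMat k) (f : L2 k) :
    mulL2 (phase D) f =ᵐ[volume] fun x => phase D x * f x :=
  mulL2_ae_eq (continuous_phase D).aestronglyMeasurable (fun x => (norm_phase D x).le) f

theorem norm_exp_I_mul_ofReal (t : ℝ) : ‖Complex.exp (Complex.I * (t : ℂ))‖ = 1 := by
  rw [mul_comm, Complex.norm_exp_ofReal_mul_I]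

end MulL2

/-! ### Fresnel integrals -/

section Fresnel

open Matrix

variable {k : ℕ}

theorem gaussian_integral_euclidean {B : Matrix (Fin k) (Fin k) ℂ} (hB : B.IsSymm)
    (hY : (B.map Complex.im).PosDef) :
    ∃ c : ℂ, c ^ 2 * B.det = (2 * Real.pi * Complex.I) ^ k ∧ ∀ y : EuclideanSpace ℝ (Fin k),
      Integrable (fun z : EuclideanSpace ℝ (Fin k) =>
        Complex.exp (Complex.I * (inner ℝ y z : ℝ)) * Complex.exp (Complex.I / 2 * quadC B z)) ∧
      ∫ z : EuclideanSpace ℝ (Fin k), Complex.exp (Complex.I * (inner ℝ y z : ℝ)) *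
        Complex.exp (Complex.I / 2 * quadC B z) =
        c * Complex.exp (Complex.I / 2 * quadC (-B⁻¹) y) := by
  obtain ⟨c, hc, h⟩ := gaussian_integral hB hY
  rw [Fintype.card_fin] at hc
  refine ⟨c, hc, fun y => ?_⟩
  have he : (fun z : EuclideanSpace ℝ (Fin k) => Complex.exp (Complex.I * (inner ℝ y z : ℝ)) *
      Complex.exp (Complex.I / 2 * quadC B z)) = (fun v : Fin k → ℝ =>
        Complex.exp (Complex.I * ((∑ j, y j * v j : ℝ) : ℂ) + Complex.I / 2 * quadC B v)) ∘
        (MeasurableEquiv.toLp 2 (Fin k → ℝ)).symm := by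
    funext z
    simp only [Function.comp_apply]
    rw [Complex.exp_add]
    congr 4
    simp [PiLp.inner_apply, mul_comm]
  have hp := PiLp.volume_preserving_ofLp (Fin k)
  rw [he]
  constructor
  · exact (hp.integrable_comp_emb (MeasurableEquiv.toLp 2 (Fin k → ℝ)).symm.measurableEmbedding).2
      (h y).1
  · refine (hp.integral_comp (MeasurableEquiv.toLp 2 (Fin k → ℝ)).symm.measurableEmbedding
      (fun v : Fin k → ℝ => Complex.exp (Complex.I * ((∑ j, y j * v j : ℝ) : ℂ) +
        Complex.I / 2 * quadC B v))).trans ?_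
    rw [(h y).2]
    congr 2
    have : quadC (-B⁻¹) y = -quadC B⁻¹ y := by
      simp [quadC]
    rw [this]
    ring

/-- The inverse of a real symmetric matrix. -/
noncomputable def symInv (E : SymMat k) : SymMat k := ⟨E.1⁻¹, by
  have h : E.1.IsSymm := E.2
  change Matrix.IsSymm _
  rw [Matrix.IsSymm, transpose_nonsing_inv, h.eq]⟩

/-- The regularization `E + iε` of a real symmetric matrix. -/
noncomputable def regularize (E : SymMat k) (ε : ℝ) : Matrix (Fin k) (Fin k) ℂ :=
  toC E.1 + (Complex.I * ε) • (1 : Matrix (Fin k) (Fin k) ℂ)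

theorem regularize_isSymm (E : SymMat k) (ε : ℝ) : (regularize E ε).IsSymm := by
  have h : E.1.IsSymm := E.2
  exact IsSymm.add (h.map _) (Matrix.isSymm_one.smul _)

theorem regularize_im_posDef (E : SymMat k) {ε : ℝ} (hε : 0 < ε) :
    ((regularize E ε).map Complex.im).PosDef := by
  have : (regularize E ε).map Complex.im = diagonal fun _ => ε := by
    ext i j
    by_cases h : i = j
    · subst h
      simp [regularize]
    · simp [regularize, h]
  rw [this]
  exact Matrix.posDef_diagonal_iff.2 fun _ => hε

theorem continuous_regularize (E : SymMat k) : Continuous (regularize E) := by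
  unfold regularize
  fun_prop

theorem regularize_zero (E : SymMat k) : regularize E 0 = toC E.1 := by
  simp [regularize]

theorem continuous_quadC (x : Fin k → ℝ) :
    Continuous (fun A : Matrix (Fin k) (Fin k) ℂ => quadC A x) := by
  unfold quadC
  refine continuous_finsetSum _ fun i _ => continuous_finsetSum _ fun j _ => ?_
  exact (continuous_const.mul (continuous_id.matrix_elem i j)).mul continuous_const

theorem quadC_neg_toC_inv (E : SymMat k) (hE : IsUnit E.1.det) (x : EuclideanSpace ℝ (Fin k)) :
    Complex.exp (Complex.I / 2 * quadC (-(toC E.1)⁻¹) x) = phase (-symInv E) x := by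
  have : (toC E.1)⁻¹ = toC (E.1⁻¹) := by
    apply inv_eq_right_inv
    rw [← toC_mul, mul_nonsing_inv _ hE, toC_one]
  rw [phase_eq, this]
  congr 2
  have h2 : toC (-symInv E : SymMat k).1 = -toC (E.1⁻¹) := by
    ext i j
    change (((-(E.1⁻¹) i j : ℝ)) : ℂ) = -(((E.1⁻¹) i j : ℝ) : ℂ)
    push_cast
    rfl
  rw [h2]

theorem continuous_quadC_right (A : Matrix (Fin k) (Fin k) ℂ) :
    Continuous (fun x : EuclideanSpace ℝ (Fin k) => quadC A x) := by
  unfold quadC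
  fun_prop

/-- The Fourier transform of a regularized Gaussian phase times the Fourier transform of an
integrable function. -/
theorem fourier_gaussian_mul {B : Matrix (Fin k) (Fin k) ℂ} {c : ℂ}
    (hc : ∀ y : EuclideanSpace ℝ (Fin k),
      Integrable (fun z : EuclideanSpace ℝ (Fin k) =>
        Complex.exp (Complex.I * (inner ℝ y z : ℝ)) * Complex.exp (Complex.I / 2 * quadC B z)) ∧
      ∫ z : EuclideanSpace ℝ (Fin k), Complex.exp (Complex.I * (inner ℝ y z : ℝ)) *
        Complex.exp (Complex.I / 2 * quadC B z) =
        c * Complex.exp (Complex.I / 2 * quadC (-B⁻¹) y))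
    {v : EuclideanSpace ℝ (Fin k) → ℂ} (hv : Integrable v)
    {ρ : EuclideanSpace ℝ (Fin k) → EuclideanSpace ℝ (Fin k)} (hρ : Continuous ρ) :
    Integrable (fun z : EuclideanSpace ℝ (Fin k) => Complex.exp (Complex.I / 2 * quadC B z) *
      ∫ y, Complex.exp (Complex.I * (inner ℝ z (ρ y) : ℝ)) * v y) ∧
    ∀ x : EuclideanSpace ℝ (Fin k), ∫ z, Complex.exp (Complex.I * (inner ℝ x z : ℝ)) *
      (Complex.exp (Complex.I / 2 * quadC B z) *
        ∫ y, Complex.exp (Complex.I * (inner ℝ z (ρ y) : ℝ)) * v y) =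
      c * ∫ y, Complex.exp (Complex.I / 2 * quadC (-B⁻¹) (x + ρ y)) * v y := by
  -- The Gaussian factor makes the double integral absolutely convergent. For a unimodular phase it
  -- would not be, which is why the Fresnel formula is reached through regularization.
  have key : ∀ x : EuclideanSpace ℝ (Fin k), Integrable (fun p : EuclideanSpace ℝ (Fin k) × EuclideanSpace ℝ (Fin k) =>
      Complex.exp (Complex.I * (inner ℝ x p.1 : ℝ)) *
      (Complex.exp (Complex.I / 2 * quadC B p.1) *
        (Complex.exp (Complex.I * (inner ℝ p.1 (ρ p.2) : ℝ)) * v p.2)))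
      (volume.prod volume) := by
    intro x
    have h1 := ((hc x).1).mul_prod hv
    refine h1.mono ?_ (Filter.Eventually.of_forall fun p => ?_)
    · refine AEStronglyMeasurable.mul ?_ (AEStronglyMeasurable.mul ?_
        (AEStronglyMeasurable.mul ?_ hv.1.comp_snd))
      · exact (by fun_prop : Continuous fun p : EuclideanSpace ℝ (Fin k) ×
          EuclideanSpace ℝ (Fin k) =>
          Complex.exp (Complex.I * (inner ℝ x p.1 : ℝ))).aestronglyMeasurable
      · exact (Complex.continuous_exp.comp (continuous_const.mul
          ((continuous_quadC_right B).comp continuous_fst))).aestronglyMeasurable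
      · exact (by fun_prop : Continuous fun p : EuclideanSpace ℝ (Fin k) ×
          EuclideanSpace ℝ (Fin k) =>
          Complex.exp (Complex.I * (inner ℝ p.1 (ρ p.2) : ℝ))).aestronglyMeasurable
    · simp only [norm_mul, norm_exp_I_mul_ofReal, one_mul]
      exact le_rfl
  constructor
  · have h := (key 0).integral_prod_left
    simp only [inner_zero_left, Complex.ofReal_zero, mul_zero, Complex.exp_zero, one_mul] at h
    simpa only [integral_const_mul] using h
  · intro x
    have h := integral_integral_swap (f := fun z y : EuclideanSpace ℝ (Fin k) =>
      Complex.exp (Complex.I * (inner ℝ x z : ℝ)) * (Complex.exp (Complex.I / 2 * quadC B z) *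
        (Complex.exp (Complex.I * (inner ℝ z (ρ y) : ℝ)) * v y))) (key x)
    simp only [integral_const_mul] at h
    rw [h, ← integral_const_mul]
    refine integral_congr_ae (Filter.Eventually.of_forall fun y => ?_)
    simp only
    have h2 := (hc (x + ρ y)).2
    calc ∫ z, Complex.exp (Complex.I * (inner ℝ x z : ℝ)) *
          (Complex.exp (Complex.I / 2 * quadC B z) *
            (Complex.exp (Complex.I * (inner ℝ z (ρ y) : ℝ)) * v y)) =
        ∫ z, (Complex.exp (Complex.I * (inner ℝ (x + ρ y) z : ℝ)) *
          Complex.exp (Complex.I / 2 * quadC B z)) * v y := by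
          refine integral_congr_ae (Filter.Eventually.of_forall fun z => ?_)
          simp only
          rw [inner_add_left, Complex.ofReal_add, mul_add, Complex.exp_add,
            real_inner_comm (ρ y) z]
          ring
      _ = _ := by
          rw [integral_mul_const, h2, mul_assoc]
          rfl

/-- The Fourier transform of a nondegenerate Gaussian phase times the Fourier transform of an
integrable function. -/
theorem fourierL2_phase_mul (E : SymMat k) (hE : IsUnit E.1.det) :
    ∃ c : ℂ, ∀ (w : L2 k) (v : EuclideanSpace ℝ (Fin k) → ℂ)
      (ρ : EuclideanSpace ℝ (Fin k) → EuclideanSpace ℝ (Fin k)), Integrable v → Continuous ρ →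
      w =ᵐ[volume] (fun z => ∫ y, Complex.exp (Complex.I * (inner ℝ z (ρ y) : ℝ)) * v y) →
      fourierL2 (mulL2 (phase E) w) =ᵐ[volume]
        fun x => c * ∫ y, phase (-symInv E) (x + ρ y) * v y := by
  set ε : ℕ → ℝ := fun n => 1 / ((n : ℝ) + 1) with hε
  have hε0 : ∀ n, 0 < ε n := fun n => by simp only [hε]; positivity
  have hεt : Filter.Tendsto ε Filter.atTop (nhds 0) := tendsto_one_div_add_atTop_nhds_zero_nat
  set B : ℕ → Matrix (Fin k) (Fin k) ℂ := fun n => regularize E (ε n) with hB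
  have hBt : Filter.Tendsto B Filter.atTop (nhds (toC E.1)) := by
    rw [← regularize_zero]
    exact ((continuous_regularize E).tendsto 0).comp hεt
  have hBpd : ∀ n, ((B n).map Complex.im).PosDef := fun n => regularize_im_posDef E (hε0 n)
  have hBs : ∀ n, (B n).IsSymm := fun n => regularize_isSymm E _
  choose c hc1 hc2 using fun n => gaussian_integral_euclidean (hBs n) (hBpd n)
  have hdet0 : (toC E.1).det ≠ 0 := by
    rw [det_toC]
    exact Complex.ofReal_ne_zero.2 hE.ne_zero
  have hdet : ∀ n, (B n).det ≠ 0 := fun n => (det_ne_zero_of_im_posDef (hBs n) (hBpd n)).ne_zero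
  have hsq : Filter.Tendsto (fun n => c n ^ 2) Filter.atTop
      (nhds ((2 * Real.pi * Complex.I) ^ k / (toC E.1).det)) := by
    have h1 : ∀ n, c n ^ 2 = (2 * Real.pi * Complex.I) ^ k / (B n).det := fun n => by
      rw [eq_div_iff (hdet n), hc1]
    simp_rw [h1]
    exact tendsto_const_nhds.div (((Continuous.matrix_det continuous_id).tendsto _).comp hBt) hdet0
  -- The constants are known only up to sign, and only their squares are seen to converge. They are
  -- bounded, so a subsequence converges, which is enough since the limit constant merely has to
  -- exist.
  obtain ⟨M, hM⟩ := (Metric.isBounded_range_of_tendsto _ hsq).exists_norm_le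
  have hcb : ∀ n, c n ∈ Metric.closedBall (0 : ℂ) (max 1 M) := fun n => by
    rw [mem_closedBall_zero_iff]
    have h1 := hM _ ⟨n, rfl⟩
    rw [norm_pow] at h1
    by_contra! h2
    have h3 := le_max_left 1 M
    have h4 := le_max_right 1 M
    nlinarith
  obtain ⟨c0, -, s, hs, hcs⟩ := (isCompact_closedBall (0 : ℂ) (max 1 M)).tendsto_subseq hcb
  set a : ℂ := (((2 * Real.pi) ^ (-(k : ℝ) / 2) : ℝ) : ℂ) with ha
  refine ⟨a * c0, fun w v ρ hv hρ hw => ?_⟩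
  set h : ℕ → EuclideanSpace ℝ (Fin k) → ℂ :=
    fun n x => Complex.exp (Complex.I / 2 * quadC (B (s n)) x) with hh
  have hhc : ∀ n, Continuous (h n) := fun n =>
    Complex.continuous_exp.comp (continuous_const.mul (continuous_quadC_right _))
  have hh1 : ∀ n x, ‖h n x‖ ≤ 1 := fun n x => norm_exp_quadC_le_one (hBpd _) _
  have hst := hs.tendsto_atTop
  have hlim : Filter.Tendsto (fun n => mulL2 (h n) w) Filter.atTop
      (nhds (mulL2 (phase E) w)) := by
    refine tendsto_mulL2 hhc (continuous_phase E) hh1 (fun x => (norm_phase E x).le)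
      (fun x => ?_) w
    rw [phase_eq]
    exact ((Complex.continuous_exp.comp (continuous_const.mul (continuous_quadC x))).tendsto
      _).comp (hBt.comp hst)
  have hF : Filter.Tendsto (fun n => fourierL2 (mulL2 (h n) w)) Filter.atTop
      (nhds (fourierL2 (mulL2 (phase E) w))) := (continuous_fourierL2.tendsto _).comp hlim
  -- Convergence in L² gives almost everywhere convergence along a further subsequence, so the limit
  -- may be identified pointwise from the explicit integrals.
  obtain ⟨t, ht, hae⟩ := (tendstoInMeasure_of_tendsto_Lp hF).exists_seq_tendsto_ae
  have hval : ∀ n, fourierL2 (mulL2 (h n) w) =ᵐ[volume] fun x =>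
      a * (c (s n) * ∫ y, Complex.exp (Complex.I / 2 * quadC (-(B (s n))⁻¹) (x + ρ y)) * v y) := by
    intro n
    obtain ⟨hi, hx⟩ := fourier_gaussian_mul (hc2 (s n)) hv hρ
    have hwn : mulL2 (h n) w =ᵐ[volume] fun z => Complex.exp (Complex.I / 2 * quadC (B (s n)) z) *
      ∫ y, Complex.exp (Complex.I * (inner ℝ z (ρ y) : ℝ)) * v y := by
      filter_upwards [mulL2_ae_eq (hhc n).aestronglyMeasurable (hh1 n) w, hw] with z h1 h2
      rw [h1, h2]
    refine (fourierL2_ae_eq _ (hi.congr hwn.symm)).trans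
      (Filter.Eventually.of_forall fun x => ?_)
    simp only
    rw [← hx x]
    congr 1
    refine integral_congr_ae ?_
    filter_upwards [hwn] with z hz
    rw [hz]
  filter_upwards [hae, ae_all_iff.2 hval] with x hx1 hx2
  refine tendsto_nhds_unique hx1 ?_
  simp_rw [hx2]
  rw [mul_assoc]
  have hBst : Filter.Tendsto (fun n => B (s (t n))) Filter.atTop (nhds (toC E.1)) :=
    hBt.comp (hst.comp ht.tendsto_atTop)
  have hinv : Filter.Tendsto (fun n => -(B (s (t n)))⁻¹) Filter.atTop (nhds (-(toC E.1)⁻¹)) := by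
    refine Filter.Tendsto.neg ?_
    refine (continuousAt_matrix_inv _ ?_).tendsto.comp hBst
    rw [Ring.inverse_eq_inv']
    exact continuousAt_inv₀ hdet0
  refine tendsto_const_nhds.mul ((hcs.comp ht.tendsto_atTop).mul ?_)
  -- The regularized phases of -B⁻¹ are bounded by 1 because this matrix has positive definite
  -- imaginary part, so |v| is a majorant.
  refine tendsto_integral_of_dominated_convergence (fun y => ‖v y‖) (fun n => ?_) hv.norm
    (fun n => Filter.Eventually.of_forall fun y => ?_) (Filter.Eventually.of_forall fun y => ?_)
  · exact (Complex.continuous_exp.comp (continuous_const.mul ((continuous_quadC_right _).comp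
      (continuous_const.add hρ)))).aestronglyMeasurable.mul hv.1
  · rw [norm_mul]
    exact mul_le_of_le_one_left (norm_nonneg _)
      (norm_exp_quadC_le_one (im_neg_inv_posDef (hBs _) (hBpd _)) _)
  · rw [← quadC_neg_toC_inv E hE]
    exact (((Complex.continuous_exp.comp (continuous_const.mul
      (continuous_quadC _))).tendsto _).comp hinv).mul_const _

end Fresnel

/-! ### Block tridiagonal matrices -/

section Tridiagonal

open Matrix

variable {k : ℕ}

theorem sum_fin_ite_val_eq {N : ℕ} (y : ℕ → ℝ) (i : ℕ) :
    ∑ j : Fin N, (if j.val = i then y j else 0) = if i < N then y i else 0 := by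
  split_ifs with h
  · rw [Finset.sum_eq_single (⟨i, h⟩ : Fin N)]
    · simp
    · intro b _ hb
      rw [if_neg]
      exact fun hbi => hb (Fin.ext hbi)
    · simp
  · refine Finset.sum_eq_zero fun j _ => if_neg ?_
    have := j.2
    omega

/-- Block vectors are written as sequences on ℕ. The conditionals impose the boundary values 0 at
both ends, and the guard `0 < i` is needed because `i - 1` is truncated. -/
theorem blockTridiag_mulVec (D : SymMat k) {N : ℕ} (y : ℕ → Fin k → ℝ) (i : Fin N) (a : Fin k) :
    (blockTridiag D N *ᵥ fun x => y x.1 x.2) (i, a) =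
      -(D.1 *ᵥ y i) a + (if i.val + 1 < N then y (i + 1) a else 0) +
        if 0 < i.val then y (i - 1) a else 0 := by
  have hinner : ∀ j : Fin N, ∑ b, blockTridiag D N (i, a) (j, b) * y j b =
      (if j.val = i.val then -(D.1 *ᵥ y j) a else 0) +
        (if j.val = i.val + 1 then y j a else 0) +
        (if 0 < i.val then (if j.val = i.val - 1 then y j a else 0) else 0) := by
    intro j
    simp only [blockTridiag, Matrix.of_apply]
    have hone : ∑ b, (1 : Matrix (Fin k) (Fin k) ℝ) a b * y j b = y j a := by
      simp [Matrix.one_apply]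
    rcases eq_or_ne i j with h | h
    · subst h
      simp only [if_true, left_eq_add, one_ne_zero, if_false, add_zero]
      have : ¬ (0 < i.val ∧ i.val = i.val - 1) := by omega
      have h2 : (if 0 < i.val then (if i.val = i.val - 1 then y i a else 0) else 0) = 0 := by
        split_ifs with h3 h4
        · omega
        · rfl
        · rfl
      rw [h2, add_zero]
      simp [Matrix.mulVec, dotProduct]
    · have hv : i.val ≠ j.val := fun h' => h (Fin.ext h')
      simp only [h, if_false, hv.symm, zero_add]
      by_cases h1 : i.val + 1 = j.val
      · have h2 : j.val = i.val + 1 := h1.symm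
        have h3 : ¬ (0 < i.val ∧ j.val = i.val - 1) := by omega
        have h4 : (if 0 < i.val then (if j.val = i.val - 1 then y j a else 0) else 0) = 0 := by
          split_ifs with h5 h6
          · omega
          · rfl
          · rfl
        rw [h4, if_pos h2, add_zero]
        simp only [h1, true_or, if_true]
        exact hone
      · by_cases h2 : j.val + 1 = i.val
        · have h3 : 0 < i.val := by omega
          have h4 : j.val = i.val - 1 := by omega
          have h5 : ¬ j.val = i.val + 1 := by omega
          rw [if_neg h5, if_pos h3, if_pos h4, zero_add]
          simp only [h2, or_true, if_true]
          exact hone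
        · have h5 : ¬ j.val = i.val + 1 := by omega
          have h4 : (if 0 < i.val then (if j.val = i.val - 1 then y j a else 0) else 0) = 0 := by
            split_ifs with h5 h6
            · omega
            · rfl
            · rfl
          rw [if_neg h5, h4]
          simp [h1, h2]
  rw [Matrix.mulVec, dotProduct, Fintype.sum_prod_type]
  simp only [hinner]
  rw [Finset.sum_add_distrib, Finset.sum_add_distrib,
    sum_fin_ite_val_eq (fun j => -(D.1 *ᵥ y j) a), sum_fin_ite_val_eq (fun j => y j a),
    if_pos i.2]
  congr 1
  by_cases h : 0 < i.val
  · simp only [h, if_true]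
    rw [sum_fin_ite_val_eq (fun j => y j a), if_pos (by have := i.2; omega)]
  · simp only [h, if_false, Finset.sum_const_zero]

/-- The block tridiagonal matrix is invertible iff the corresponding recursion has only the zero
solution. -/
theorem isUnit_blockTridiag_iff (D : SymMat k) (N : ℕ) : IsUnit (blockTridiag D N) ↔
    ∀ y : ℕ → Fin k → ℝ, (∀ i, i < N → D.1 *ᵥ y i =
      (if i + 1 < N then y (i + 1) else 0) + if 0 < i then y (i - 1) else 0) →
      ∀ i < N, y i = 0 := by
  rw [← Matrix.mulVec_injective_iff_isUnit]
  have hkey : ∀ y : ℕ → Fin k → ℝ, blockTridiag D N *ᵥ (fun x => y x.1 x.2) = 0 ↔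
      ∀ i, i < N → D.1 *ᵥ y i =
        (if i + 1 < N then y (i + 1) else 0) + if 0 < i then y (i - 1) else 0 := by
    intro y
    have happ : ∀ (p : Prop) [Decidable p] (z : Fin k → ℝ) (a : Fin k),
        (if p then z else 0) a = if p then z a else 0 := by
      intro p _ z a
      split_ifs <;> rfl
    constructor
    · intro h i hi
      funext a
      have := congrFun h (⟨i, hi⟩, a)
      rw [blockTridiag_mulVec, Pi.zero_apply] at this
      rw [Pi.add_apply, happ, happ]
      simp only at this
      linarith
    · intro h
      funext ⟨i, a⟩
      have := congrFun (h i i.2) a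
      rw [Pi.add_apply, happ, happ] at this
      rw [blockTridiag_mulVec, Pi.zero_apply]
      linarith
  constructor
  · intro hinj y hy i hi
    have h0 := hinj (((hkey y).2 hy).trans (Matrix.mulVec_zero _).symm)
    funext a
    exact congrFun h0 (⟨i, hi⟩, a)
  · intro h
    refine (injective_iff_map_eq_zero (Matrix.mulVecLin (blockTridiag D N))).2 fun x hx => ?_
    set y : ℕ → Fin k → ℝ := fun i a => if hi : i < N then x (⟨i, hi⟩, a) else 0 with hy
    have hxy : (fun z : Fin N × Fin k => y z.1 z.2) = x := by
      funext z
      simp [hy]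
    have hz := h y ((hkey y).1 (by rw [hxy]; exact hx))
    rw [← hxy]
    funext z
    rw [hz z.1 z.1.2]
    rfl

/-- The matrices `P_0 = 0`, `P_{n+1} = -(D + P_n)⁻¹` of the continued fraction expansion. -/
noncomputable def contFrac (D : SymMat k) : ℕ → SymMat k
  | 0 => 0
  | n + 1 => -symInv (D + contFrac D n)

/-- Block elimination: -(D + P_n) is the last pivot of 𝒟_{n+1}. A vector x in its kernel is
continued downwards from y_n = x by y_i = (D + P_i)⁻¹ y_{i+1}. Then P_{i+1} y_{i+1} = -y_i, hence D
y_i = y_{i+1} + y_{i-1} for i < n, while for i = n the term y_{n+1} is absent because (D + P_n)x =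
0. So the sequence lies in the kernel of 𝒟_{n+1}, and x = 0. -/
theorem isUnit_add_contFrac {D : SymMat k} {L : ℕ} (hD : D ∈ nondegSet k L) (n : ℕ) (hn : n < L) :
    IsUnit (D + contFrac D n).1.det := by
  induction n using Nat.strong_induction_on with
  | _ n ih =>
  -- Back substitution from the prescribed value at l; it uses only the pivots of index below n,
  -- which are invertible by induction.
  have hex : ∀ l ≤ n, ∀ x : Fin k → ℝ, ∃ y : ℕ → Fin k → ℝ, y l = x ∧
      ∀ i < l, (D + contFrac D i).1 *ᵥ y i = y (i + 1) := by
    intro l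
    induction l with
    | zero => exact fun _ x => ⟨fun _ => x, rfl, by simp⟩
    | succ l ihl =>
      intro hl x
      obtain ⟨y, hy1, hy2⟩ := ihl (by omega) ((D + contFrac D l).1⁻¹ *ᵥ x)
      refine ⟨Function.update y (l + 1) x, by simp, fun i hi => ?_⟩
      rw [Function.update_of_ne (by omega)]
      rcases eq_or_ne i l with rfl | h
      · rw [hy1, Matrix.mulVec_mulVec, Matrix.mul_nonsing_inv _ (ih i (by omega) (by omega)),
          Matrix.one_mulVec, Function.update_self]
      · rw [Function.update_of_ne (by omega), hy2 i (by omega)]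
  rw [← Matrix.isUnit_iff_isUnit_det, ← Matrix.mulVec_injective_iff_isUnit]
  refine (injective_iff_map_eq_zero (Matrix.mulVecLin (D + contFrac D n).1)).2 fun x hx => ?_
  obtain ⟨y, hyn, hy⟩ := hex n le_rfl x
  have hunit := (isUnit_blockTridiag_iff D (n + 1)).1 (hD (n + 1) (by omega) (by omega))
  rw [← hyn]
  refine hunit y (fun i hi => ?_) n (by omega)
  have hsplit : D.1 *ᵥ y i = (D + contFrac D i).1 *ᵥ y i - (contFrac D i).1 *ᵥ y i := by
    rw [← Matrix.sub_mulVec]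
    congr 1
    change D.1 = D.1 + (contFrac D i).1 - (contFrac D i).1
    rw [add_sub_cancel_right]
  have h1 : (D + contFrac D i).1 *ᵥ y i = if i + 1 < n + 1 then y (i + 1) else 0 := by
    split_ifs with h
    · exact hy i (by omega)
    · have : i = n := by omega
      subst this
      rw [hyn]
      exact hx
  have h2 : (contFrac D i).1 *ᵥ y i = -(if 0 < i then y (i - 1) else 0) := by
    rcases i with _ | i
    · simp only [lt_irrefl, if_false, neg_zero]
      exact Matrix.zero_mulVec _
    · simp only [Nat.succ_pos, if_true, Nat.add_sub_cancel]
      rw [← hy i (by omega)]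
      change (-(D + contFrac D i).1⁻¹) *ᵥ _ = _
      rw [Matrix.neg_mulVec, Matrix.mulVec_mulVec,
        Matrix.nonsing_inv_mul _ (ih i (by omega) (by omega)), Matrix.one_mulVec]
  rw [hsplit, h1, h2, sub_neg_eq_add]

end Tridiagonal

/-! ### The integral kernels of the iterated operators -/

section Kernel

open Matrix

variable {k : ℕ}

/-- `A` is, on `L¹ ∩ L²`, the integral operator with kernel `e^{(i/2) x·Px} e^{i x·ρ(y)} χ(y)`. -/
def HasOscKernel (A : L2 k → L2 k) (P : SymMat k) : Prop :=
  ∃ (ρ : EuclideanSpace ℝ (Fin k) → EuclideanSpace ℝ (Fin k)) (χ : EuclideanSpace ℝ (Fin k) → ℂ)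
    (C : ℝ), Continuous ρ ∧ Continuous χ ∧ (∀ y, ‖χ y‖ ≤ C) ∧ ∀ f : L2 k, Integrable f →
      A f =ᵐ[volume] fun x => phase P x *
        ∫ y, Complex.exp (Complex.I * (inner ℝ x (ρ y) : ℝ)) * (χ y * f y)

theorem hasOscKernel_fourierL2 : HasOscKernel (fourierL2 (k := k)) 0 := by
  refine ⟨id, fun _ => (((2 * Real.pi) ^ (-(k : ℝ) / 2) : ℝ) : ℂ), _, continuous_id,
    continuous_const, fun _ => le_rfl, fun f hf => ?_⟩
  refine (fourierL2_ae_eq f hf).trans (Filter.Eventually.of_forall fun x => ?_)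
  simp only [phase_zero, one_mul, id, ← integral_const_mul]
  congr 1
  funext y
  ring

/-- A phase on the right is absorbed in χ. It does not affect P, so it costs no inversion. -/
theorem HasOscKernel.comp_mul_phase {A : L2 k → L2 k} {P : SymMat k} (hA : HasOscKernel A P)
    (D : SymMat k) : HasOscKernel (fun f => A (mulL2 (phase D) f)) P := by
  obtain ⟨ρ, χ, C, hρ, hχ, hC, h⟩ := hA
  refine ⟨ρ, fun y => χ y * phase D y, C, hρ, hχ.mul (continuous_phase D), fun y => ?_,
    fun f hf => ?_⟩
  · rw [norm_mul, norm_phase, mul_one]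
    exact hC y
  · have he := phase_mulL2_ae_eq D f
    have hi : Integrable (mulL2 (phase D) f) := by
      refine (hf.bdd_mul (c := 1) (continuous_phase D).aestronglyMeasurable
        (Filter.Eventually.of_forall fun x => (norm_phase D x).le)).congr he.symm
    refine (h _ hi).trans (Filter.Eventually.of_forall fun x => ?_)
    simp only
    congr 1
    refine integral_congr_ae ?_
    filter_upwards [he] with y hy
    rw [hy, mul_assoc (χ y)]

/-- Polarization. The mixed term is linear in x and becomes the oscillation e^{i x·ρ(y)} of the new
kernel. -/
theorem phase_add_vec (D : SymMat k) (x y : EuclideanSpace ℝ (Fin k)) :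
    phase D (x + y) = phase D x * phase D y *
      Complex.exp (Complex.I * (inner ℝ x (WithLp.toLp 2 (D.1 *ᵥ y)) : ℝ)) := by
  have hs : D.1.IsSymm := D.2
  have h1 : ∑ i, ∑ j, (x + y) i * D.1 i j * (x + y) j = ∑ i, ∑ j, x i * D.1 i j * x j +
      ∑ i, ∑ j, y i * D.1 i j * y j + 2 * (inner ℝ x (WithLp.toLp 2 (D.1 *ᵥ y)) : ℝ) := by
    have h2 : (inner ℝ x (WithLp.toLp 2 (D.1 *ᵥ y)) : ℝ) = ∑ i, ∑ j, x i * D.1 i j * y j := by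
      simp only [PiLp.inner_apply, Matrix.mulVec, dotProduct, Finset.sum_mul, RCLike.inner_apply,
        conj_trivial]
      refine Finset.sum_congr rfl fun i _ => Finset.sum_congr rfl fun j _ => ?_
      ring
    have h3 : ∑ i, ∑ j, y i * D.1 i j * x j = ∑ i, ∑ j, x i * D.1 i j * y j := by
      rw [Finset.sum_comm]
      refine Finset.sum_congr rfl fun i _ => Finset.sum_congr rfl fun j _ => ?_
      rw [hs.apply j i]
      ring
    have h4 : ∑ i, ∑ j, (x + y) i * D.1 i j * (x + y) j = ∑ i, ∑ j, x i * D.1 i j * x j +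
        ∑ i, ∑ j, y i * D.1 i j * y j + (∑ i, ∑ j, x i * D.1 i j * y j +
        ∑ i, ∑ j, y i * D.1 i j * x j) := by
      simp only [← Finset.sum_add_distrib, PiLp.add_apply]
      refine Finset.sum_congr rfl fun i _ => Finset.sum_congr rfl fun j _ => ?_
      ring
    rw [h4, h3, h2]
    ring
  rw [phase, phase, phase, h1, ← Complex.exp_add, ← Complex.exp_add]
  congr 1
  push_cast
  ring

/-- The phases of D and P multiply to that of D + P, and the Fresnel formula replaces it by the
phase of Q = -(D + P)⁻¹ at x + ρ(y). Polarization splits this into a phase in x, the oscillation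
with Qρ(y), and a unimodular factor in y that joins χ. -/
theorem HasOscKernel.fourier_phase {A : L2 k → L2 k} {P : SymMat k} (hA : HasOscKernel A P)
    (D : SymMat k) (hE : IsUnit (D + P).1.det) :
    HasOscKernel (fun f => fourierL2 (mulL2 (phase D) (A f))) (-symInv (D + P)) := by
  obtain ⟨ρ, χ, C, hρ, hχ, hC, h⟩ := hA
  obtain ⟨c, hc⟩ := fourierL2_phase_mul (D + P) hE
  set Q : SymMat k := -symInv (D + P) with hQ
  have hcont : Continuous fun y : EuclideanSpace ℝ (Fin k) =>
      (WithLp.toLp 2 (Q.1 *ᵥ y) : EuclideanSpace ℝ (Fin k)) :=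
    (PiLp.continuous_toLp 2 _).comp (continuous_const.matrix_mulVec (PiLp.continuous_ofLp 2 _))
  refine ⟨fun y => WithLp.toLp 2 (Q.1 *ᵥ ρ y), fun y => c * phase Q (ρ y) * χ y, ‖c‖ * C,
    hcont.comp hρ, (continuous_const.mul ((continuous_phase Q).comp hρ)).mul hχ, fun y => ?_,
    fun f hf => ?_⟩
  · rw [norm_mul, norm_mul, norm_phase, mul_one]
    exact mul_le_mul_of_nonneg_left (hC y) (norm_nonneg c)
  · have hv : Integrable (fun y => χ y * f y) :=
      hf.bdd_mul hχ.aestronglyMeasurable (Filter.Eventually.of_forall hC)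
    -- Removing the outer phase of P from A f leaves the pure Fourier integral to which the Fresnel
    -- formula applies.
    set w : L2 k := mulL2 (phase (-P)) (A f) with hw
    have hPP : ∀ x, phase (-P) x * phase P x = 1 := fun x => by
      rw [← phase_add, neg_add_cancel, phase_zero]
    have hwe : w =ᵐ[volume]
        fun z => ∫ y, Complex.exp (Complex.I * (inner ℝ z (ρ y) : ℝ)) * (χ y * f y) := by
      filter_upwards [phase_mulL2_ae_eq (-P) (A f), h f hf] with z h1 h2
      rw [h1, h2, ← mul_assoc, hPP, one_mul]
    have heq : mulL2 (phase D) (A f) = mulL2 (phase (D + P)) w := by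
      apply Lp.ext
      filter_upwards [phase_mulL2_ae_eq D (A f), phase_mulL2_ae_eq (D + P) w,
        phase_mulL2_ae_eq (-P) (A f)] with z h1 h2 h3
      rw [h1, h2, h3, phase_add, ← mul_assoc, mul_assoc (phase D z), mul_comm (phase P z), hPP,
        mul_one]
    change fourierL2 (mulL2 (phase D) (A f)) =ᵐ[volume] _
    rw [heq]
    refine (hc w _ ρ hv hρ hwe).trans (Filter.Eventually.of_forall fun x => ?_)
    simp only [← integral_const_mul, phase_add_vec]
    congr 1
    funext y
    ring

/-- The innermost phase needs no inversion, so n + 1 factors use only the n denominators D + P_0, …,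
D + P_{n-1}. This is why the power L + 1 goes with 𝒮(k, L). -/
theorem hasOscKernel_iterate {D : SymMat k} {L : ℕ} (hD : D ∈ nondegSet k L) (n : ℕ)
    (hn : n ≤ L) :
    HasOscKernel (fun f => fourierL2 (mulL2 (phase D) f))^[n + 1] (contFrac D n) := by
  induction n with
  | zero => exact hasOscKernel_fourierL2.comp_mul_phase D
  | succ n ih =>
    have := (ih (by omega)).fourier_phase D (isUnit_add_contFrac hD n (by omega))
    rw [Function.iterate_succ']
    exact this

end Kernel

/-! ### Compact operators from continuous families of functionals -/

section CompactFamilies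

variable {H : Type*} [NormedAddCommGroup H] [NormedSpace ℂ H]

/-- Evaluation of functionals on a compact set of functionals is a compact operator. -/
theorem exists_compact_eval (K : Set (H →L[ℂ] ℂ)) (hK : IsCompact K) :
    ∃ Ψ : H →L[ℂ] BoundedContinuousFunction K ℂ, IsCompactOperator Ψ ∧ ∀ f v, Ψ f v = v.1 f := by
  have : CompactSpace K := isCompact_iff_compactSpace.1 hK
  obtain ⟨R, hR⟩ := hK.isBounded.exists_norm_le
  have hcont : ∀ f : H, Continuous (fun v : K => v.1 f) := fun f =>
    ((ContinuousLinearMap.apply ℂ ℂ f).continuous).comp continuous_subtype_val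
  let Ψ₀ : H →ₗ[ℂ] BoundedContinuousFunction K ℂ :=
    { toFun := fun f => BoundedContinuousFunction.mkOfCompact ⟨fun v : K => v.1 f, hcont f⟩
      map_add' := fun f g => by
        ext v
        exact map_add v.1 f g
      map_smul' := fun c f => by
        ext v
        exact map_smul v.1 c f }
  have happ : ∀ f v, Ψ₀ f v = v.1 f := fun _ _ => rfl
  have hbound : ∀ f (v : K), ‖v.1 f‖ ≤ max R 0 * ‖f‖ := fun f v =>
    (v.1.le_opNorm f).trans (mul_le_mul_of_nonneg_right ((hR _ v.2).trans (le_max_left _ _))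
      (norm_nonneg _))
  let Ψ : H →L[ℂ] BoundedContinuousFunction K ℂ := Ψ₀.mkContinuous (max R 0) fun f =>
    (BoundedContinuousFunction.norm_le (by positivity)).2 (hbound f)
  refine ⟨Ψ, ?_, happ⟩
  refine (isCompactOperator_iff_isCompact_closure_image_closedBall
    (Ψ : H →ₗ[ℂ] BoundedContinuousFunction K ℂ) one_pos).2 ?_
  -- On functionals, evaluation at a vector of the unit ball is 1-Lipschitz for the operator norm,
  -- and on K it is bounded by the size of K. Hence the image of the ball is equicontinuous and
  -- pointwise bounded.
  refine BoundedContinuousFunction.arzela_ascoli (Metric.closedBall 0 (max R 0))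
    (isCompact_closedBall _ _) _ ?_ ?_
  · rintro _ v ⟨f, hf, rfl⟩
    rw [mem_closedBall_zero_iff] at hf ⊢
    exact (hbound f v).trans (mul_le_of_le_one_right (by positivity) hf)
  · refine LipschitzWith.uniformEquicontinuous (K := 1) _ ?_ |>.equicontinuous
    rintro ⟨_, f, hf, rfl⟩
    refine LipschitzWith.of_dist_le_mul fun v w => ?_
    rw [mem_closedBall_zero_iff] at hf
    change dist (v.1 f) (w.1 f) ≤ _
    rw [dist_eq_norm, NNReal.coe_one, one_mul, Subtype.dist_eq, dist_eq_norm,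
      ← sub_apply]
    exact ((v.1 - w.1).le_opNorm f).trans (mul_le_of_le_one_right (norm_nonneg _) hf)

variable {X : Type*} [NormedAddCommGroup X]

theorem RapidDecay.mul_one_add_norm {h : X → ℂ} (hh : RapidDecay h) :
    RapidDecay (fun x => h x * ((1 + ‖x‖ : ℝ) : ℂ)) where
  cont := hh.cont.mul (Complex.continuous_ofReal.comp (continuous_const.add continuous_norm))
  decay N := by
    obtain ⟨C, hC⟩ := hh.decay (N + 1)
    refine ⟨C, fun x => ?_⟩
    rw [norm_mul, Complex.norm_real, Real.norm_of_nonneg (by positivity)]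
    calc _ = ‖h x‖ * (1 + ‖x‖) ^ (N + 1) := by ring
      _ ≤ C := hC x

variable [NormedSpace ℝ X] [FiniteDimensional ℝ X] [MeasurableSpace X] [BorelSpace X]

/-- A rapidly decaying function times a bounded continuous family of functionals defines a compact
operator to `Lᵖ`. -/
theorem exists_compact_of_family (μ : Measure X) [μ.IsAddHaarMeasure] (κ : X → H →L[ℂ] ℂ)
    (hκ : Continuous κ) {R : ℝ} (hR : ∀ x, ‖κ x‖ ≤ R) {h : X → ℂ} (hh : RapidDecay h) (p : ℝ≥0∞)
    [hp : Fact (1 ≤ p)] :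
    ∃ S : H →L[ℂ] Lp ℂ p μ, IsCompactOperator S ∧ ∀ f, S f =ᵐ[μ] fun x => h x * κ x f := by
  -- Damped by (1 + |x|)⁻¹ the family tends to 0 at infinity, so its range together with 0 is
  -- compact. The damping is undone by replacing h with h (1 + |x|), which still decays rapidly.
  set g : X → H →L[ℂ] ℂ := fun x => (((1 + ‖x‖)⁻¹ : ℝ) : ℂ) • κ x with hg
  have hpos : ∀ x : X, (0 : ℝ) < 1 + ‖x‖ := fun x => by positivity
  have hgc : Continuous g := by
    refine (Complex.continuous_ofReal.comp ?_).smul hκ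
    exact (continuous_const.add continuous_norm).inv₀ fun x => (hpos x).ne'
  have hg0 : Filter.Tendsto g (Filter.cocompact X) (nhds 0) := by
    have h1 : Filter.Tendsto (fun x : X => (1 + ‖x‖)⁻¹ * R) (Filter.cocompact X) (nhds 0) := by
      have := (tendsto_inv_atTop_zero.comp (Filter.tendsto_atTop_add_const_left _ (1 : ℝ)
        (tendsto_norm_cocompact_atTop (E := X)))).mul_const R
      simpa using this
    refine squeeze_zero_norm (fun x => ?_) h1
    rw [hg, norm_smul, Complex.norm_real, Real.norm_of_nonneg (inv_nonneg.2 (hpos x).le)]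
    exact mul_le_mul_of_nonneg_left (hR x) (inv_nonneg.2 (hpos x).le)
  have hK := hg0.isCompact_insert_range_of_cocompact hgc
  set K := insert 0 (Set.range g) with hKdef
  have hgK : ∀ x, g x ∈ K := fun x => Set.mem_insert_of_mem _ ⟨x, rfl⟩
  obtain ⟨Ψ, hΨ, hΨf⟩ := exists_compact_eval K hK
  set h' : X → ℂ := fun x => h x * ((1 + ‖x‖ : ℝ) : ℂ) with hh'
  have hLp : MemLp h' p μ := hh.mul_one_add_norm.memLp μ hp.out
  have hmem : ∀ φ : BoundedContinuousFunction K ℂ, MemLp (fun x => h' x * φ ⟨g x, hgK x⟩) p μ := by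
    intro φ
    refine hLp.of_le_mul (c := ‖φ‖) (hLp.1.mul ?_) (Filter.Eventually.of_forall fun x => ?_)
    · exact (φ.continuous.comp (hgc.subtype_mk hgK)).aestronglyMeasurable
    · rw [norm_mul, mul_comm]
      exact mul_le_mul_of_nonneg_right (φ.norm_coe_le_norm _) (norm_nonneg _)
  let J₀ : BoundedContinuousFunction K ℂ →ₗ[ℂ] Lp ℂ p μ :=
    { toFun := fun φ => (hmem φ).toLp
      map_add' := fun φ ψ => by
        rw [← MemLp.toLp_add]
        congr 1
        funext x
        simp [mul_add]
      map_smul' := fun c φ => by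
        rw [RingHom.id_apply, ← MemLp.toLp_const_smul]
        congr 1
        funext x
        simp only [BoundedContinuousFunction.coe_smul, Pi.smul_apply, smul_eq_mul]
        ring }
  let J : BoundedContinuousFunction K ℂ →L[ℂ] Lp ℂ p μ :=
    J₀.mkContinuous (‖hLp.toLp‖) fun φ => by
      rw [mul_comm]
      refine Lp.norm_le_mul_norm_of_ae_le_mul ?_
      filter_upwards [(hmem φ).coeFn_toLp, hLp.coeFn_toLp] with x h1 h2
      change ‖((hmem φ).toLp (fun x => h' x * φ ⟨g x, hgK x⟩) : X → ℂ) x‖ ≤ _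
      rw [h1, h2, norm_mul, mul_comm]
      exact mul_le_mul_of_nonneg_right (φ.norm_coe_le_norm _) (norm_nonneg _)
  refine ⟨J.comp Ψ, hΨ.clm_comp J, fun f => ?_⟩
  refine ((hmem (Ψ f)).coeFn_toLp).trans (Filter.Eventually.of_forall fun x => ?_)
  simp only [hΨf, hh', hg]
  rw [smul_apply, smul_eq_mul, mul_assoc, ← mul_assoc _ _ (κ x f), ← Complex.ofReal_mul,
    mul_inv_cancel₀ (hpos x).ne', Complex.ofReal_one, one_mul]

end CompactFamilies

/-! ### Compactness of sandwiched oscillatory integral operators -/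

section Sandwich

variable {k : ℕ}

theorem RapidDecay.bounded {X : Type*} [NormedAddCommGroup X] {h : X → ℂ} (hh : RapidDecay h) :
    ∃ C, ∀ x, ‖h x‖ ≤ C := by
  obtain ⟨C, hC⟩ := hh.decay 0
  exact ⟨C, fun x => by simpa using hC x⟩

/-- For fixed x the integral against the kernel is the inner product with the L² function y ↦ e^{-i
x·ρ(y)} times the conjugate of χ h₂. Its norm does not grow with x, and it varies continuously with
x by dominated convergence. Continuity of ρ is all that this requires. -/
theorem HasOscKernel.isCompactSandwich {A : L2 k → L2 k} {P : SymMat k} (hA : HasOscKernel A P)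
    {h₁ h₂ : EuclideanSpace ℝ (Fin k) → ℂ} (hh₁ : RapidDecay h₁) (hh₂ : RapidDecay h₂)
    (p : ℝ≥0∞) [Fact (1 ≤ p)] : IsCompactSandwich h₁ A h₂ p := by
  obtain ⟨ρ, χ, C, hρ, hχ, hC, h⟩ := hA
  have hmem2 : MemLp h₂ 2 volume := hh₂.memLp volume one_le_two
  have hmem : MemLp (fun y => (starRingEnd ℂ) (χ y * h₂ y)) 2 volume := by
    refine hmem2.of_le_mul (c := C) ?_ (Filter.Eventually.of_forall fun x => ?_)
    · exact (Complex.continuous_conj.comp (hχ.mul hh₂.cont)).aestronglyMeasurable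
    · rw [RCLike.norm_conj, norm_mul]
      exact mul_le_mul_of_nonneg_right (hC x) (norm_nonneg _)
  let e : EuclideanSpace ℝ (Fin k) → EuclideanSpace ℝ (Fin k) → ℂ := fun x y =>
    Complex.exp (-(Complex.I * (inner ℝ x (ρ y) : ℝ)))
  have hec : ∀ x, Continuous (e x) := fun x => by
    simp only [e]
    fun_prop
  have hen : ∀ x y, ‖e x y‖ = 1 := fun x y => by
    simp only [e]
    rw [← mul_neg, ← Complex.ofReal_neg, norm_exp_I_mul_ofReal]
  have heconj : ∀ x y, (starRingEnd ℂ) (e x y) =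
      Complex.exp (Complex.I * (inner ℝ x (ρ y) : ℝ)) := fun x y => by
    simp only [e]
    rw [← Complex.exp_conj]
    simp
  set u : EuclideanSpace ℝ (Fin k) → L2 k := fun x => mulL2 (e x) hmem.toLp with hu
  have huae : ∀ x, u x =ᵐ[volume] fun y => e x y * (starRingEnd ℂ) (χ y * h₂ y) := fun x => by
    filter_upwards [mulL2_ae_eq (hec x).aestronglyMeasurable (fun y => (hen x y).le) hmem.toLp,
      hmem.coeFn_toLp] with y h1 h2
    rw [hu]
    simp only
    rw [h1, h2]
  have huc : Continuous u := by
    refine continuous_iff_seqContinuous.2 fun s x hs => ?_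
    refine tendsto_mulL2 (fun n => hec _) (hec x) (fun n y => (hen _ y).le)
      (fun y => (hen x y).le) (fun y => ?_) _
    have hcy : Continuous fun x => e x y := by
      simp only [e]
      fun_prop
    exact (hcy.tendsto x).comp hs
  have hun : ∀ x, ‖u x‖ ≤ ‖hmem.toLp‖ := fun x => by
    refine Lp.norm_le_norm_of_ae_le ?_
    filter_upwards [mulL2_ae_eq (hec x).aestronglyMeasurable (fun y => (hen x y).le)
      hmem.toLp] with y h1
    rw [hu]
    simp only
    rw [h1, norm_mul, hen, one_mul]
  set κ : EuclideanSpace ℝ (Fin k) → L2 k →L[ℂ] ℂ := fun x => phase P x • innerSL ℂ (u x) with hκ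
  have hκc : Continuous κ := (continuous_phase P).smul ((innerSL ℂ).continuous.comp huc)
  have hκn : ∀ x, ‖κ x‖ ≤ ‖hmem.toLp‖ := fun x => by
    rw [hκ, norm_smul, norm_phase, one_mul, innerSL_apply_norm]
    exact hun x
  obtain ⟨S, hS, hSf⟩ := exists_compact_of_family volume κ hκc hκn hh₁ p
  refine ⟨S, hS, fun f => (hSf f).trans ?_⟩
  obtain ⟨C₂, hC₂⟩ := hh₂.bounded
  have hm2 := mulL2_ae_eq hh₂.cont.aestronglyMeasurable hC₂ f
  -- A product of two L² functions is integrable, so the kernel formula, stated for integrable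
  -- functions only, covers h₂ f for every f in L².
  have hint : Integrable (mulL2 h₂ f) := (hmem2.integrable_mul (Lp.memLp f)).congr hm2.symm
  filter_upwards [h _ hint] with x hx
  rw [hx, hκ]
  simp only
  rw [smul_apply, innerSL_apply_apply, L2.inner_def, smul_eq_mul]
  congr 2
  refine integral_congr_ae ?_
  filter_upwards [huae x, hm2] with y h1 h2
  rw [RCLike.inner_apply, h1, h2, map_mul, heconj, RingHomCompTriple.comp_apply,
    RingHom.id_apply]
  ring

theorem ExpDecay.rapidDecay {h : EuclideanSpace ℝ (Fin k) → ℂ} (hh : ExpDecay h)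
    (hc : Continuous h) : RapidDecay h where
  cont := hc
  decay N := by
    obtain ⟨C, c, hc0, hC⟩ := hh
    have hC0 : 0 ≤ C := by
      have := (norm_nonneg _).trans (hC 0)
      simpa using this
    -- The constant comes from t^N / N! ≤ e^t at t = c(1 + |x|); the exponentials cancel up to e^c.
    refine ⟨C * (N.factorial * Real.exp c / c ^ N), fun x => ?_⟩
    have h1 : (1 + ‖x‖) ^ N ≤ N.factorial * Real.exp (c * (1 + ‖x‖)) / c ^ N := by
      have := Real.pow_div_factorial_le_exp (c * (1 + ‖x‖)) (by positivity) N
      rw [div_le_iff₀ (by positivity), mul_pow] at this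
      rw [le_div_iff₀ (by positivity)]
      linarith
    calc ‖h x‖ * (1 + ‖x‖) ^ N ≤ (C * Real.exp (-c * ‖x‖)) *
          (N.factorial * Real.exp (c * (1 + ‖x‖)) / c ^ N) :=
          mul_le_mul (hC x) h1 (by positivity) (by positivity)
      _ = C * (N.factorial * (Real.exp (-c * ‖x‖) * Real.exp (c * (1 + ‖x‖))) / c ^ N) := by ring
      _ = _ := by
          rw [← Real.exp_add]
          ring_nf

theorem isCompactSandwich_fourierL2 {h₁ h₂ : EuclideanSpace ℝ (Fin k) → ℂ} (hh₁ : RapidDecay h₁)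
    (hh₂ : RapidDecay h₂) (p : ℝ≥0∞) [Fact (1 ≤ p)] : IsCompactSandwich h₁ fourierL2 h₂ p :=
  hasOscKernel_fourierL2.isCompactSandwich hh₁ hh₂ p

theorem isCompactSandwich_iterate {h₁ h₂ : EuclideanSpace ℝ (Fin k) → ℂ} (hh₁ : RapidDecay h₁)
    (hh₂ : RapidDecay h₂) {L : ℕ} {D : SymMat k} (hD : D ∈ nondegSet k L) (p : ℝ≥0∞)
    [Fact (1 ≤ p)] :
    IsCompactSandwich h₁ (fun f => fourierL2 (mulL2 (phase D) f))^[L + 1] h₂ p :=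
  (hasOscKernel_iterate hD L le_rfl).isCompactSandwich hh₁ hh₂ p

end Sandwich

/-! ### Minors -/

section Minors

open Matrix

/-- Laplace expansion along the columns in S, obtained by averaging. Composing τ with a permutation
that preserves S only reorders the sum, and the sum over all such permutations assembles the
products into two determinants. Keeping the number of these permutations as a factor avoids a choice
of coset representatives. -/
theorem sum_perm_mul_split {ι : Type*} [Fintype ι] [DecidableEq ι] (X Y : Matrix ι ι ℂ)
    (S : Finset ι) :
    ((Fintype.card (Equiv.Perm {a // a ∈ S}) * Fintype.card (Equiv.Perm {a // ¬a ∈ S}) : ℕ) : ℂ) *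
      ∑ τ : Equiv.Perm ι, ((Equiv.Perm.sign τ : ℤ) : ℂ) *
        ((∏ i : {a // a ∈ S}, X (τ i) i) * ∏ i : {a // ¬a ∈ S}, Y (τ i) i) =
    ∑ τ : Equiv.Perm ι, ((Equiv.Perm.sign τ : ℤ) : ℂ) *
      ((X.submatrix (fun i : {a // a ∈ S} => τ i) (fun i => i.1)).det *
        (Y.submatrix (fun i : {a // ¬a ∈ S} => τ i) (fun i => i.1)).det) := by
  have h1 : ∀ (π : Equiv.Perm {a // a ∈ S}) (ρ : Equiv.Perm {a // ¬a ∈ S}),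
      ∑ τ : Equiv.Perm ι, ((Equiv.Perm.sign τ : ℤ) : ℂ) *
        ((∏ i : {a // a ∈ S}, X (τ i) i) * ∏ i : {a // ¬a ∈ S}, Y (τ i) i) =
      ∑ τ : Equiv.Perm ι, ((Equiv.Perm.sign τ : ℤ) : ℂ) *
        (((Equiv.Perm.sign π : ℤ) : ℂ) * (∏ i : {a // a ∈ S}, X (τ (π i)) i) *
          (((Equiv.Perm.sign ρ : ℤ) : ℂ) * ∏ i : {a // ¬a ∈ S}, Y (τ (ρ i)) i)) := by
    intro π ρ
    have hs : Equiv.Perm.sign (Equiv.Perm.subtypeCongr π ρ) =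
        Equiv.Perm.sign π * Equiv.Perm.sign ρ := by
      convert Equiv.Perm.sign_subtypeCongr π ρ
    rw [← Equiv.sum_comp (Equiv.mulRight (Equiv.Perm.subtypeCongr π ρ))]
    refine Finset.sum_congr rfl fun τ _ => ?_
    simp only [Equiv.coe_mulRight, Equiv.Perm.sign_mul, hs,
      Equiv.Perm.mul_apply, Equiv.Perm.subtypeCongr.left_apply_subtype,
      Equiv.Perm.subtypeCongr.right_apply_subtype]
    push_cast
    ring
  have h2 := Finset.sum_congr (rfl : (Finset.univ : Finset (Equiv.Perm {a // a ∈ S})) = _)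
    fun π _ => Finset.sum_congr (rfl : (Finset.univ : Finset (Equiv.Perm {a // ¬a ∈ S})) = _)
      fun ρ _ => h1 π ρ
  simp only [Finset.sum_const, Finset.card_univ, nsmul_eq_mul] at h2
  rw [Nat.cast_mul, mul_assoc, h2]
  simp_rw [Finset.sum_comm (s := (Finset.univ : Finset (Equiv.Perm {a // ¬a ∈ S})))]
  rw [Finset.sum_comm]
  refine Finset.sum_congr rfl fun τ _ => ?_
  simp_rw [← Finset.mul_sum]
  congr 1
  rw [← Finset.sum_mul, Matrix.det_apply', Matrix.det_apply']
  rfl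

variable {m : ℕ}

/-- The minor of a matrix with the given rows and columns. -/
def minor (x : SetPair m) (A : Matrix (Fin m) (Fin m) ℂ) : ℂ :=
  (A.submatrix (x.1.1.orderEmbOfFin rfl) (x.1.2.orderEmbOfFin x.2.symm)).det

theorem exists_equiv_orderEmbOfFin {κ : Type*} [Fintype κ] {r : κ → Fin m}
    (hr : Function.Injective r) {c : ℕ} (hc : (Finset.univ.image r).card = c) :
    ∃ e : Fin c ≃ κ, ∀ i, r (e i) = (Finset.univ.image r).orderEmbOfFin hc i := by
  have hmem : ∀ i, ∃ a, r a = (Finset.univ.image r).orderEmbOfFin hc i := fun i => by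
    obtain ⟨a, -, ha⟩ := Finset.mem_image.1 (Finset.orderEmbOfFin_mem (Finset.univ.image r) hc i)
    exact ⟨a, ha⟩
  choose f hf using hmem
  have hinj : Function.Injective f := fun i j h => by
    have := congrArg r h
    rw [hf, hf] at this
    exact (RelEmbedding.injective _) this
  have hcard : Fintype.card (Fin c) = Fintype.card κ := by
    rw [Fintype.card_fin, ← hc, Finset.card_image_of_injective _ hr, Finset.card_univ]
  exact ⟨Equiv.ofBijective f ((Fintype.bijective_iff_injective_and_card f).2 ⟨hinj, hcard⟩), hf⟩

/-- Sorting the rows and columns costs a sign that depends on r and s but not on A, whence the order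
of the quantifiers. -/
theorem exists_det_submatrix_eq_minor {κ : Type*} [Fintype κ] [DecidableEq κ] {r s : κ → Fin m}
    (hr : Function.Injective r) (hs : Function.Injective s) :
    ∃ (y : SetPair m) (ε : ℂ), ∀ A : Matrix (Fin m) (Fin m) ℂ,
      (A.submatrix r s).det = ε * minor y A := by
  have hcard : (Finset.univ.image r).card = (Finset.univ.image s).card := by
    rw [Finset.card_image_of_injective _ hr, Finset.card_image_of_injective _ hs]
  obtain ⟨e₁, h₁⟩ := exists_equiv_orderEmbOfFin hr rfl
  obtain ⟨e₂, h₂⟩ := exists_equiv_orderEmbOfFin hs hcard.symm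
  refine ⟨⟨(Finset.univ.image r, Finset.univ.image s), hcard⟩,
    ((Equiv.Perm.sign (e₁.trans e₂.symm) : ℤ) : ℂ), fun A => ?_⟩
  rw [minor, ← Matrix.det_permute', ← Matrix.det_submatrix_equiv_self e₁]
  congr 1
  ext i j
  simp only [Matrix.submatrix_apply, id, ← h₁, ← h₂, Equiv.trans_apply, Equiv.apply_symm_apply]

/-- Multiplying out the Leibniz formula splits it according to the set S of columns that take their
entry from A, and Laplace expansion turns each part into products of complementary minors. Phrased
as membership in a span, the argument needs no record of signs, and the coefficients are the same
for all A and B. -/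
theorem exists_minor_add (x : SetPair m) :
    ∃ w : SetPair m × SetPair m → ℂ, ∀ A B : Matrix (Fin m) (Fin m) ℂ,
      minor x (A + B) = ∑ y, w y * (minor y.1 A * minor y.2 B) := by
  set r := x.1.1.orderEmbOfFin rfl with hr
  set s := x.1.2.orderEmbOfFin x.2.symm with hs
  let V : Submodule ℂ (Matrix (Fin m) (Fin m) ℂ × Matrix (Fin m) (Fin m) ℂ → ℂ) :=
    Submodule.span ℂ (Set.range fun (y : SetPair m × SetPair m) Z => minor y.1 Z.1 * minor y.2 Z.2)
  have hV : (fun Z : Matrix (Fin m) (Fin m) ℂ × Matrix (Fin m) (Fin m) ℂ =>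
      minor x (Z.1 + Z.2)) ∈ V := by
    have hexp : (fun Z : Matrix (Fin m) (Fin m) ℂ × Matrix (Fin m) (Fin m) ℂ =>
        minor x (Z.1 + Z.2)) = ∑ S : Finset (Fin x.1.1.card), fun Z =>
        ∑ τ : Equiv.Perm (Fin x.1.1.card), ((Equiv.Perm.sign τ : ℤ) : ℂ) *
          ((∏ i : {a // a ∈ S}, (Z.1.submatrix r s) (τ i) i) *
            ∏ i : {a // ¬a ∈ S}, (Z.2.submatrix r s) (τ i) i) := by
      funext Z
      rw [Finset.sum_apply, minor, Matrix.det_apply', Finset.sum_comm]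
      refine Finset.sum_congr rfl fun τ _ => ?_
      rw [← Finset.mul_sum]
      congr 1
      have hp := Finset.prod_add (fun i => (Z.1.submatrix r s) (τ i) i)
        (fun i => (Z.2.submatrix r s) (τ i) i) Finset.univ
      rw [Finset.powerset_univ] at hp
      refine hp.trans (Finset.sum_congr rfl fun S _ => ?_)
      congr 1
      · rw [Finset.prod_subtype S (fun _ => Iff.rfl)]
      · rw [Finset.prod_subtype (p := fun a => ¬a ∈ S) (Finset.univ \ S) (fun _ => by simp)]
    rw [hexp]
    refine V.sum_mem fun S _ => ?_
    have hne : ((Fintype.card (Equiv.Perm {a // a ∈ S}) *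
        Fintype.card (Equiv.Perm {a // ¬a ∈ S}) : ℕ) : ℂ) ≠ 0 := by
      exact_mod_cast (mul_pos Fintype.card_pos Fintype.card_pos).ne'
    rw [← V.smul_mem_iff hne]
    have hsum : (((Fintype.card (Equiv.Perm {a // a ∈ S}) *
        Fintype.card (Equiv.Perm {a // ¬a ∈ S}) : ℕ) : ℂ) •
        fun Z : Matrix (Fin m) (Fin m) ℂ × Matrix (Fin m) (Fin m) ℂ =>
        ∑ τ : Equiv.Perm (Fin x.1.1.card), ((Equiv.Perm.sign τ : ℤ) : ℂ) *
          ((∏ i : {a // a ∈ S}, (Z.1.submatrix r s) (τ i) i) *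
            ∏ i : {a // ¬a ∈ S}, (Z.2.submatrix r s) (τ i) i)) =
        ∑ τ : Equiv.Perm (Fin x.1.1.card), ((Equiv.Perm.sign τ : ℤ) : ℂ) • fun Z =>
          (Z.1.submatrix (fun i : {a // a ∈ S} => r (τ i)) (fun i => s i.1)).det *
          (Z.2.submatrix (fun i : {a // ¬a ∈ S} => r (τ i)) (fun i => s i.1)).det := by
      funext Z
      rw [Pi.smul_apply, smul_eq_mul, Finset.sum_apply]
      exact sum_perm_mul_split (Z.1.submatrix r s) (Z.2.submatrix r s) S
    rw [hsum]
    refine V.sum_mem fun τ _ => V.smul_mem _ ?_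
    obtain ⟨y, ε, hy⟩ := exists_det_submatrix_eq_minor
      (r := fun i : {a // a ∈ S} => r (τ i)) (s := fun i : {a // a ∈ S} => s i.1)
      (fun i j h => Subtype.ext (τ.injective (r.injective h)))
      (fun i j h => Subtype.ext (s.injective h))
    obtain ⟨z, δ, hz⟩ := exists_det_submatrix_eq_minor
      (r := fun i : {a // ¬a ∈ S} => r (τ i)) (s := fun i : {a // ¬a ∈ S} => s i.1)
      (fun i j h => Subtype.ext (τ.injective (r.injective h)))
      (fun i j h => Subtype.ext (s.injective h))
    have he : (fun Z : Matrix (Fin m) (Fin m) ℂ × Matrix (Fin m) (Fin m) ℂ =>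
        (Z.1.submatrix (fun i : {a // a ∈ S} => r (τ i)) (fun i => s i.1)).det *
        (Z.2.submatrix (fun i : {a // ¬a ∈ S} => r (τ i)) (fun i => s i.1)).det) =
        (ε * δ) • fun Z => minor y Z.1 * minor z Z.2 := by
      funext Z
      rw [hy, hz, Pi.smul_apply, smul_eq_mul]
      ring
    rw [he]
    exact V.smul_mem _ (Submodule.subset_span ⟨(y, z), rfl⟩)
  obtain ⟨w, hw⟩ := (Submodule.mem_span_range_iff_exists_fun ℂ).1 hV
  refine ⟨w, fun A B => ?_⟩
  have := congrFun hw (A, B)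
  simp only [Finset.sum_apply, Pi.smul_apply, smul_eq_mul] at this
  exact this.symm

/-- Multiply N by the matrix whose first block column is that of N' and whose second is that of the
identity, then compare determinants. No block has to be invertible. -/
theorem det_toBlocks_inv_mul {α β : Type*} [Fintype α] [Fintype β] [DecidableEq α] [DecidableEq β]
    {N N' : Matrix (α ⊕ β) (α ⊕ β) ℂ} (h : N * N' = 1) :
    N'.toBlocks₁₁.det * N.det = N.toBlocks₂₂.det := by
  have h1 : N * fromBlocks N'.toBlocks₁₁ 0 N'.toBlocks₂₁ 1 =
      fromBlocks 1 N.toBlocks₁₂ 0 N.toBlocks₂₂ := by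
    have h2 := h
    rw [← fromBlocks_toBlocks N, ← fromBlocks_toBlocks N', fromBlocks_multiply,
      ← fromBlocks_one, fromBlocks_inj] at h2
    conv_lhs => rw [← fromBlocks_toBlocks N]
    rw [fromBlocks_multiply, h2.1, h2.2.2.1]
    simp
  have h3 := congrArg Matrix.det h1
  rw [det_mul, det_fromBlocks_zero₁₂, det_fromBlocks_zero₂₁, det_one, det_one, mul_one,
    one_mul] at h3
  rw [mul_comm, h3]

/-- Jacobi's theorem on complementary minors of the inverse. -/
theorem exists_minor_inv (x : SetPair m) :
    ∃ (y : SetPair m) (ε : ℂ), ∀ B : Matrix (Fin m) (Fin m) ℂ, IsUnit B.det →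
      minor x B⁻¹ * B.det = ε * minor y B := by
  have hc1 : x.1.1ᶜ.card = m - x.1.1.card := by rw [Finset.card_compl, Fintype.card_fin]
  have hc2 : x.1.2ᶜ.card = m - x.1.1.card := by
    rw [Finset.card_compl, Fintype.card_fin, ← x.2]
  set e₁ := finSumEquivOfFinset (s := x.1.1) rfl hc1 with he₁
  set e₂ := finSumEquivOfFinset (s := x.1.2) x.2.symm hc2 with he₂
  -- Passing to the inverse exchanges the roles of rows and columns: the rows of y are the
  -- complement of the columns of x, and conversely.
  obtain ⟨y, ε, hy⟩ := exists_det_submatrix_eq_minor (x.1.2ᶜ.orderEmbOfFin hc2).injective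
    (x.1.1ᶜ.orderEmbOfFin hc1).injective
  set θ : ℂ := ((Equiv.Perm.sign (e₁.symm.trans e₂) : ℤ) : ℂ) with hθ
  have hθ2 : θ * θ = 1 := by
    rw [hθ, ← Int.cast_mul, ← Units.val_mul, Int.units_mul_self]
    simp
  refine ⟨y, θ * ε, fun B hB => ?_⟩
  have hN : B.submatrix e₂ e₁ * B⁻¹.submatrix e₁ e₂ = 1 := by
    rw [Matrix.submatrix_mul_equiv, Matrix.mul_nonsing_inv _ hB, Matrix.submatrix_one_equiv]
  have h := det_toBlocks_inv_mul hN
  have h1 : (B⁻¹.submatrix e₁ e₂).toBlocks₁₁.det = minor x B⁻¹ := by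
    rw [minor]
    congr 1
  have h2 : (B.submatrix e₂ e₁).toBlocks₂₂.det = ε * minor y B := by
    rw [← hy]
    congr 1
  have h3 : (B.submatrix e₂ e₁).det = θ * B.det := by
    rw [hθ, ← Matrix.det_permute, ← Matrix.det_submatrix_equiv_self e₁]
    congr 1
    ext i j
    simp
  rw [h1, h2, h3] at h
  calc minor x B⁻¹ * B.det = (θ * θ) * (minor x B⁻¹ * B.det) := by rw [hθ2, one_mul]
    _ = θ * (minor x B⁻¹ * (θ * B.det)) := by ring
    _ = θ * ε * minor y B := by rw [h]; ring

theorem minor_smul (x : SetPair m) (c : ℂ) (A : Matrix (Fin m) (Fin m) ℂ) :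
    minor x (c • A) = c ^ x.1.2.card * minor x A := by
  have h : ∀ (f g : Fin x.1.1.card → Fin m), (c • A).submatrix f g = c • A.submatrix f g :=
    fun _ _ => rfl
  rw [minor, h, Matrix.det_smul, Fintype.card_fin, ← minor, x.2]

theorem minor_univ (A : Matrix (Fin m) (Fin m) ℂ) :
    minor ⟨(Finset.univ, Finset.univ), rfl⟩ A = A.det := by
  have hb : Function.Bijective ((Finset.univ : Finset (Fin m)).orderEmbOfFin rfl) :=
    (Fintype.bijective_iff_injective_and_card _).2
      ⟨(RelEmbedding.injective _), by rw [Fintype.card_fin, Finset.card_univ]⟩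
  rw [minor]
  exact Matrix.det_submatrix_equiv_self (Equiv.ofBijective _ hb) A

/-- A product of minors. -/
def multiMinor (a : MultiPair m) (A : Matrix (Fin m) (Fin m) ℂ) : ℂ := ∏ l, minor (a l) A

theorem exists_multiMinor_add (a : MultiPair m) :
    ∃ w : MultiPair m × MultiPair m → ℂ, ∀ A B : Matrix (Fin m) (Fin m) ℂ,
      multiMinor a (A + B) = ∑ y, w y * (multiMinor y.1 A * multiMinor y.2 B) := by
  choose w hw using fun l => exists_minor_add (a l)
  refine ⟨fun y => ∏ l, w l (y.1 l, y.2 l), fun A B => ?_⟩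
  simp only [multiMinor, hw]
  rw [Finset.prod_univ_sum, Fintype.piFinset_univ,
    ← Equiv.sum_comp (Equiv.arrowProdEquivProdArrow (Fin (halfDim m)) (fun _ => SetPair m)
      (fun _ => SetPair m)).symm]
  refine Finset.sum_congr rfl fun y _ => ?_
  rw [Finset.prod_mul_distrib, Finset.prod_mul_distrib]
  rfl

/-- The product over n pairs collects exactly the power of det B that stands in the denominator of
the Gaussian integral over 2n columns. This matching makes T act on jets without any remaining
dependence on B. -/
theorem exists_multiMinor_inv (a : MultiPair m) :
    ∃ (b : MultiPair m) (ε : ℂ), ∀ B : Matrix (Fin m) (Fin m) ℂ, IsUnit B.det →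
      multiMinor a B⁻¹ * B.det ^ halfDim m = ε * multiMinor b B := by
  choose y ε h using fun l => exists_minor_inv (a l)
  refine ⟨y, ∏ l, ε l, fun B hB => ?_⟩
  have : B.det ^ halfDim m = ∏ _l : Fin (halfDim m), B.det := by simp
  rw [multiMinor, multiMinor, this, ← Finset.prod_mul_distrib, ← Finset.prod_mul_distrib]
  exact Finset.prod_congr rfl fun l _ => h l B hB

theorem multiMinor_smul (a : MultiPair m) (c : ℂ) (A : Matrix (Fin m) (Fin m) ℂ) :
    multiMinor a (c • A) = c ^ a.size * multiMinor a A := by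
  simp only [multiMinor, minor_smul, MultiPair.size, Finset.prod_mul_distrib,
    Finset.prod_pow_eq_pow_sum]

theorem multiMinor_full (A : Matrix (Fin m) (Fin m) ℂ) :
    multiMinor (MultiPair.full m) A = A.det ^ halfDim m := by
  simp only [multiMinor, MultiPair.full, minor_univ]
  simp

end Minors

/-! ### Polynomial families of exponentials -/

section Families

open Matrix MvPolynomial

variable {m : ℕ}

/-- If the velocity of a curve is polynomial in its position, differentiating a polynomial along it
amounts to applying a derivation of the polynomial ring. -/
theorem hasDerivAt_eval_curve {τ : Type*} (z : ℝ → τ → ℂ) (δ : τ → MvPolynomial τ ℂ) (t₀ : ℝ)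
    (hz : ∀ i, HasDerivAt (fun t => z t i) (eval (z t₀) (δ i)) t₀) (q : MvPolynomial τ ℂ) :
    HasDerivAt (fun t => eval (z t) q) (eval (z t₀) (mkDerivation ℂ δ q)) t₀ := by
  induction q using MvPolynomial.induction_on with
  | C a => simpa using hasDerivAt_const t₀ a
  | add p q hp hq =>
    simp only [map_add]
    exact hp.add hq
  | mul_X p i hp =>
    simp only [map_mul, eval_X, Derivation.leibniz, mkDerivation_X, smul_eq_mul, map_add]
    refine (hp.mul (hz i)).congr_deriv ?_
    ring

/-- Variables for the entries of `M` and for those of the matrix in the exponent. -/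
abbrev EntryIndex (m : ℕ) : Type := (Fin m × Fin m) ⊕ (Fin m × Fin m)

/-- The entries of `M` and `A`. -/
def entries (A : Matrix (Fin m) (Fin m) ℂ) (M : SymMat m) : EntryIndex m → ℂ :=
  Sum.elim (fun x => ((M.1 x.1 x.2 : ℝ) : ℂ)) (fun x => A x.1 x.2)

/-- The function `q(M, A) ζ_A(M)`. -/
noncomputable def polyExp (q : MvPolynomial (EntryIndex m) ℂ) (A : Matrix (Fin m) (Fin m) ℂ)
    (M : SymMat m) : ℂ := eval (entries A M) q * zeta A M

/-- The derivative of the exponent in the direction `v` of `M`. -/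
noncomputable def expDerivM (v : SymMat m) : MvPolynomial (EntryIndex m) ℂ :=
  C (Complex.I / 2) * ∑ i, ∑ j, X (Sum.inr (i, j)) * C ((v.1 j i : ℝ) : ℂ)

/-- The action on polynomials of the derivative in the direction `v` of `M`. -/
noncomputable def opM (v : SymMat m) : Module.End ℂ (MvPolynomial (EntryIndex m) ℂ) :=
  (mkDerivation ℂ (Sum.elim (fun x => C ((v.1 x.1 x.2 : ℝ) : ℂ)) fun _ => 0)).toLinearMap +
    LinearMap.mulLeft ℂ (expDerivM v)

/-- The derivative of the exponent if the entries of `A` have the derivatives `P`. -/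
noncomputable def expDerivA (P : Fin m × Fin m → MvPolynomial (Fin m × Fin m) ℂ) :
    MvPolynomial (EntryIndex m) ℂ :=
  C (Complex.I / 2) * ∑ i, ∑ j, rename Sum.inr (P (i, j)) * X (Sum.inl (j, i))

/-- The action on polynomials of a derivative under which the entries of `A` have the derivatives
`P`. -/
noncomputable def opA (P : Fin m × Fin m → MvPolynomial (Fin m × Fin m) ℂ) :
    Module.End ℂ (MvPolynomial (EntryIndex m) ℂ) :=
  (mkDerivation ℂ (Sum.elim (fun _ => 0) fun x => rename Sum.inr (P x))).toLinearMap +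
    LinearMap.mulLeft ℂ (expDerivA P)

theorem mkDerivation_inl_rename_inr (d : Fin m × Fin m → MvPolynomial (EntryIndex m) ℂ)
    (p : MvPolynomial (Fin m × Fin m) ℂ) :
    mkDerivation ℂ (Sum.elim d fun _ => 0) (rename Sum.inr p) = 0 := by
  induction p using MvPolynomial.induction_on with
  | C a => simp
  | add p q hp hq => rw [map_add, map_add, hp, hq, add_zero]
  | mul_X p i hp => simp [Derivation.leibniz, hp]

theorem mkDerivation_inr_rename_inl (d : Fin m × Fin m → MvPolynomial (EntryIndex m) ℂ)
    (p : MvPolynomial (Fin m × Fin m) ℂ) :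
    mkDerivation ℂ (Sum.elim (fun _ => 0) d : EntryIndex m → MvPolynomial (EntryIndex m) ℂ)
      (rename Sum.inl p : MvPolynomial (EntryIndex m) ℂ) = 0 := by
  induction p using MvPolynomial.induction_on with
  | C a => simp
  | add p q hp hq => rw [map_add, map_add, hp, hq, add_zero]
  | mul_X p i hp => rw [map_mul, Derivation.leibniz, hp, rename_X, mkDerivation_X]; simp

/-- A zero curvature condition: the commutator of D + a and E + b is [D, E] plus multiplication by
Db - Ea. -/
theorem commute_derivation_add_mulLeft {R : Type*} [CommRing R] [Algebra ℂ R]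
    (D E : Derivation ℂ R R) {a b : R} (hDE : ∀ q, D (E q) = E (D q)) (hab : D b = E a) :
    Commute (D.toLinearMap + LinearMap.mulLeft ℂ a) (E.toLinearMap + LinearMap.mulLeft ℂ b) := by
  refine LinearMap.ext fun q => ?_
  change D (E q + b * q) + a * (E q + b * q) = E (D q + a * q) + b * (D q + a * q)
  rw [map_add, map_add, Derivation.leibniz, Derivation.leibniz, hDE, hab]
  simp only [smul_eq_mul]
  ring

/-- Both sides are the mixed second derivative of the exponent (i/2) Tr(AM), once in M along v and
once in A along P. -/
theorem derivation_expDerivA {D E : Derivation ℂ (MvPolynomial (EntryIndex m) ℂ)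
    (MvPolynomial (EntryIndex m) ℂ)} {v : SymMat m}
    {P : Fin m × Fin m → MvPolynomial (Fin m × Fin m) ℂ}
    (hD : ∀ p : MvPolynomial (Fin m × Fin m) ℂ, D (rename Sum.inr p) = 0)
    (hDX : ∀ x : Fin m × Fin m, D (X (Sum.inl x)) = C ((v.1 x.1 x.2 : ℝ) : ℂ))
    (hEX : ∀ x : Fin m × Fin m, E (X (Sum.inr x)) = rename Sum.inr (P x)) :
    D (expDerivA P) = E (expDerivM v) := by
  rw [expDerivA, expDerivM, Derivation.leibniz, Derivation.leibniz, derivation_C, derivation_C,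
    map_sum, map_sum, smul_zero, smul_zero, add_zero, add_zero]
  congr 1
  refine Finset.sum_congr rfl fun i _ => ?_
  rw [map_sum, map_sum]
  refine Finset.sum_congr rfl fun j _ => ?_
  rw [Derivation.leibniz, Derivation.leibniz, derivation_C, hDX, hEX, hD, smul_zero, smul_zero,
    add_zero, zero_add, smul_eq_mul, smul_eq_mul, mul_comm]

/-- Mixed derivatives in M and in the parameter A commute, here as operators on polynomial
coefficients. This replaces any interchange of limits when D_{𝐚̄,𝐚} meets a derivative in B. -/
theorem commute_opM_opA (v : SymMat m) (P : Fin m × Fin m → MvPolynomial (Fin m × Fin m) ℂ) :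
    Commute (opM v) (opA P) := by
  have hcomm : ⁅mkDerivation ℂ (Sum.elim (fun x : Fin m × Fin m => (C ((v.1 x.1 x.2 : ℝ) : ℂ) :
      MvPolynomial (EntryIndex m) ℂ)) fun _ : Fin m × Fin m => 0),
      mkDerivation ℂ (Sum.elim (fun _ : Fin m × Fin m => (0 : MvPolynomial (EntryIndex m) ℂ))
        fun x => rename Sum.inr (P x))⁆ = 0 := by
    refine MvPolynomial.derivation_ext fun i => ?_
    rw [Derivation.commutator_apply, mkDerivation_X, mkDerivation_X]
    rcases i with x | x
    · simp
    · simp only [Sum.elim_inr, map_zero, sub_zero, Derivation.coe_zero, Pi.zero_apply]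
      exact mkDerivation_inl_rename_inr _ _
  refine commute_derivation_add_mulLeft _ _ (fun q => ?_)
    (derivation_expDerivA (mkDerivation_inl_rename_inr _) (fun x => mkDerivation_X _ _ _)
      fun x => mkDerivation_X _ _ _)
  have := congrArg (fun F : Derivation ℂ _ _ => F q) hcomm
  rw [Derivation.commutator_apply] at this
  exact sub_eq_zero.1 this

theorem hasDerivAt_zeta_curve {A : ℝ → Matrix (Fin m) (Fin m) ℂ} {M : ℝ → SymMat m} {t₀ : ℝ}
    {A' M' : Matrix (Fin m) (Fin m) ℂ} (hA : ∀ i j, HasDerivAt (fun t => A t i j) (A' i j) t₀)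
    (hM : ∀ i j, HasDerivAt (fun t => (((M t).1 i j : ℝ) : ℂ)) (M' i j) t₀) :
    HasDerivAt (fun t => zeta (A t) (M t))
      ((Complex.I / 2 * ∑ i, ∑ j, (A' i j * (((M t₀).1 j i : ℝ) : ℂ) + A t₀ i j * M' j i)) *
        zeta (A t₀) (M t₀)) t₀ := by
  have h1 : HasDerivAt (fun t => ∑ i, ∑ j, A t i j * (((M t).1 j i : ℝ) : ℂ))
      (∑ i, ∑ j, (A' i j * (((M t₀).1 j i : ℝ) : ℂ) + A t₀ i j * M' j i)) t₀ :=
    HasDerivAt.fun_sum fun i _ => HasDerivAt.fun_sum fun j _ => (hA i j).mul (hM j i)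
  have h2 := (h1.const_mul (Complex.I / 2)).cexp
  have h3 : ∀ t, zeta (A t) (M t) =
      Complex.exp (Complex.I / 2 * ∑ i, ∑ j, A t i j * (((M t).1 j i : ℝ) : ℂ)) := fun t => by
    simp [zeta, Matrix.trace, Matrix.mul_apply]
  simp_rw [h3]
  refine h2.congr_deriv ?_
  ring

theorem hasLineDerivAt_polyExp (q : MvPolynomial (EntryIndex m) ℂ) (A : Matrix (Fin m) (Fin m) ℂ)
    (M v : SymMat m) : HasLineDerivAt ℝ (polyExp q A) (polyExp (opM v q) A M) M v := by
  have hM : ∀ i j, HasDerivAt (fun t : ℝ => (((M + t • v : SymMat m).1 i j : ℝ) : ℂ))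
      ((v.1 i j : ℝ) : ℂ) 0 := fun i j => by
    apply HasDerivAt.ofReal_comp
    simpa using ((hasDerivAt_id (0 : ℝ)).mul_const (v.1 i j)).const_add (M.1 i j)
  have h1 := hasDerivAt_eval_curve (fun t : ℝ => entries A (M + t • v))
    (Sum.elim (fun x => C ((v.1 x.1 x.2 : ℝ) : ℂ)) fun _ => 0) 0 (fun i => by
      rcases i with x | x
      · simpa [entries] using hM x.1 x.2
      · simpa [entries] using hasDerivAt_const (0 : ℝ) (A x.1 x.2)) q
  have h2 := hasDerivAt_zeta_curve (A := fun _ => A) (M := fun t : ℝ => M + t • v) (t₀ := 0)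
    (A' := 0) (M' := toC v.1) (fun i j => hasDerivAt_const _ _) hM
  refine (h1.mul h2).congr_deriv ?_
  simp only [zero_smul, add_zero]
  simp only [polyExp, opM, LinearMap.add_apply, LinearMap.mulLeft_apply, map_add, map_mul,
    expDerivM, map_sum, eval_C, eval_X, Derivation.coeFn_coe, Matrix.zero_apply, zero_mul,
    zero_add, toC_apply]
  simp only [entries, Sum.elim_inr]
  ring

/-- A family of matrices whose entries satisfy a polynomial differential equation. -/
structure IsPolyFamily (Y : SymMat m → Matrix (Fin m) (Fin m) ℂ)
    (P : SymMat m → Fin m × Fin m → MvPolynomial (Fin m × Fin m) ℂ) : Prop where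
  hasDerivAt : ∀ (w : SymMat m) (x : Fin m × Fin m) (t : ℝ),
    HasDerivAt (fun s : ℝ => Y (s • w) x.1 x.2)
      (eval (fun z : Fin m × Fin m => Y (t • w) z.1 z.2) (P w x)) t

theorem IsPolyFamily.hasDerivAt_polyExp {Y : SymMat m → Matrix (Fin m) (Fin m) ℂ}
    {P : SymMat m → Fin m × Fin m → MvPolynomial (Fin m × Fin m) ℂ} (hY : IsPolyFamily Y P)
    (q : MvPolynomial (EntryIndex m) ℂ) (M w : SymMat m) (t : ℝ) :
    HasDerivAt (fun s : ℝ => polyExp q (Y (s • w)) M) (polyExp (opA (P w) q) (Y (t • w)) M) t := by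
  have hcomp : (entries (Y (t • w)) M) ∘ Sum.inr = fun z : Fin m × Fin m => Y (t • w) z.1 z.2 :=
    rfl
  have h1 := hasDerivAt_eval_curve (fun s : ℝ => entries (Y (s • w)) M)
    (Sum.elim (fun _ => 0) fun x => rename Sum.inr (P w x)) t (fun i => by
      rcases i with x | x
      · simpa [entries] using hasDerivAt_const t ((M.1 x.1 x.2 : ℝ) : ℂ)
      · simp only [Sum.elim_inr, eval_rename, hcomp]
        exact hY.hasDerivAt w x t) q
  have h2 := hasDerivAt_zeta_curve (A := fun s : ℝ => Y (s • w)) (M := fun _ => M) (t₀ := t)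
    (A' := Matrix.of fun i j => eval (fun z : Fin m × Fin m => Y (t • w) z.1 z.2) (P w (i, j)))
    (M' := 0) (fun i j => hY.hasDerivAt w (i, j) t) (fun i j => hasDerivAt_const _ _)
  refine (h1.mul h2).congr_deriv ?_
  simp only [polyExp, opA, LinearMap.add_apply, LinearMap.mulLeft_apply, map_add, map_mul,
    expDerivA, map_sum, eval_C, eval_X, eval_rename, hcomp, Derivation.coeFn_coe,
    Matrix.zero_apply, mul_zero, add_zero, Matrix.of_apply]
  simp only [entries, Sum.elim_inl]
  ring

theorem isPolyFamily_add (B : Matrix (Fin m) (Fin m) ℂ) :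
    IsPolyFamily (fun W => B + complexify W) (fun w x => C ((w.1 x.1 x.2 : ℝ) : ℂ)) where
  hasDerivAt w x t := by
    simp only [eval_C]
    have h : (fun s : ℝ => (B + complexify (s • w)) x.1 x.2) =
        fun s : ℝ => B x.1 x.2 + ((s * w.1 x.1 x.2 : ℝ) : ℂ) := by
      funext s
      rfl
    rw [h]
    refine HasDerivAt.const_add _ (HasDerivAt.ofReal_comp ?_)
    simpa using (hasDerivAt_id t).mul_const (w.1 x.1 x.2)

theorem isSymm_complexify (W : SymMat m) : (complexify W).IsSymm := by
  have h : W.1.IsSymm := W.2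
  exact h.map _

theorem im_add_complexify (B : Matrix (Fin m) (Fin m) ℂ) (W : SymMat m) :
    (B + complexify W).map Complex.im = B.map Complex.im := by
  ext i j
  simp [complexify]

/-- The Riccati equation: Y = -A⁻¹ satisfies dY = Y (dA) Y, which is quadratic in the entries of Y.
-/
theorem isPolyFamily_neg_inv {B : Matrix (Fin m) (Fin m) ℂ} (hB : B.IsSymm)
    (hY : (B.map Complex.im).PosDef) :
    IsPolyFamily (fun W => -(B + complexify W)⁻¹)
      (fun w x => ∑ a, ∑ b, X (x.1, a) * C ((w.1 a b : ℝ) : ℂ) * X (b, x.2)) where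
  hasDerivAt w x t := by
    set A : ℝ → Matrix (Fin m) (Fin m) ℂ := fun s => B + complexify (s • w) with hA
    have hdet : ∀ s, IsUnit (A s).det := fun s =>
      det_ne_zero_of_im_posDef (hB.add (isSymm_complexify _)) (by rwa [im_add_complexify])
    have hAc : Continuous A := by
      refine continuous_const.add (continuous_matrix fun i j => ?_)
      exact Complex.continuous_ofReal.comp (continuous_id.mul continuous_const)
    have hdiff : ∀ s, A s - A t = ((s - t : ℝ) : ℂ) • complexify w := fun s => by
      ext i j
      simp only [hA, Matrix.sub_apply, Matrix.add_apply, Matrix.smul_apply, smul_eq_mul]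
      change B i j + ((s * w.1 i j : ℝ) : ℂ) - (B i j + ((t * w.1 i j : ℝ) : ℂ)) =
        ((s - t : ℝ) : ℂ) * ((w.1 i j : ℝ) : ℂ)
      push_cast
      ring
    -- The resolvent identity gives the difference quotient in closed form, so that only continuity
    -- of the inverse is needed for the limit.
    have hres : ∀ s, -(A s)⁻¹ - -(A t)⁻¹ =
        ((s - t : ℝ) : ℂ) • ((A s)⁻¹ * complexify w * (A t)⁻¹) := fun s => by
      rw [← Matrix.smul_mul, ← Matrix.mul_smul, ← hdiff, Matrix.mul_sub, Matrix.sub_mul,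
        Matrix.nonsing_inv_mul _ (hdet s), Matrix.one_mul, Matrix.mul_assoc,
        Matrix.mul_nonsing_inv _ (hdet t), Matrix.mul_one]
      abel
    have hcinv : ContinuousAt (fun s => (A s)⁻¹) t := by
      refine ContinuousAt.comp (f := A) (continuousAt_matrix_inv _ ?_) hAc.continuousAt
      rw [Ring.inverse_eq_inv']
      exact continuousAt_inv₀ (hdet t).ne_zero
    have hlim : Filter.Tendsto (fun s => ((A s)⁻¹ * complexify w * (A t)⁻¹) x.1 x.2) (nhds t)
        (nhds (((A t)⁻¹ * complexify w * (A t)⁻¹) x.1 x.2)) := by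
      have h1 : Continuous fun Z : Matrix (Fin m) (Fin m) ℂ =>
          (Z * complexify w * (A t)⁻¹) x.1 x.2 :=
        ((continuous_id.matrix_mul continuous_const).matrix_mul continuous_const).matrix_elem _ _
      exact (h1.tendsto _).comp hcinv
    have hval : eval (fun z : Fin m × Fin m => (-(A t)⁻¹) z.1 z.2)
        (∑ a, ∑ b, X (x.1, a) * C ((w.1 a b : ℝ) : ℂ) * X (b, x.2)) =
        ((A t)⁻¹ * complexify w * (A t)⁻¹) x.1 x.2 := by
      simp only [map_sum, map_mul, eval_X, eval_C, Matrix.neg_apply, Matrix.mul_apply,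
        Finset.sum_mul, complexify, Matrix.map_apply]
      rw [Finset.sum_comm]
      refine Finset.sum_congr rfl fun i _ => Finset.sum_congr rfl fun j _ => ?_
      ring
    rw [hval, hasDerivAt_iff_tendsto_slope]
    refine (hlim.mono_left nhdsWithin_le_nhds).congr' ?_
    filter_upwards [self_mem_nhdsWithin] with s hs
    have hs' : ((s - t : ℝ) : ℂ) ≠ 0 := Complex.ofReal_ne_zero.2 (sub_ne_zero.2 hs)
    have := congrFun (congrFun (hres s) x.1) x.2
    rw [Matrix.sub_apply, Matrix.smul_apply, smul_eq_mul] at this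
    rw [slope_def_module, this, Complex.real_smul, ← mul_assoc, ← Complex.ofReal_mul,
      inv_mul_cancel₀ (sub_ne_zero.2 hs), Complex.ofReal_one, one_mul]

/-! ### The differential operators on families -/

/-- Operators on functions are carried over to endomorphisms of the coefficient ring. The A i need
to correspond to the T i only on the range of F. -/
theorem compAll_eq_prod {X R : Type*} [AddCommGroup R] [Module ℂ R] {c : ℕ} (F : R → X)
    {A : Fin c → X → X} {T : Fin c → Module.End ℂ R} (h : ∀ i q, A i (F q) = F (T i q)) (q : R) :
    compAll A (F q) = F ((List.ofFn T).prod q) := by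
  induction c with
  | zero => simp [compAll]
  | succ c ih =>
    have := ih (A := fun i => A i.succ) (T := fun i => T i.succ) (fun i q => h i.succ q)
    rw [compAll, List.ofFn_succ, List.foldr_cons, List.ofFn_succ, List.prod_cons,
      Module.End.mul_apply, ← h]
    exact congrArg (A 0) this

theorem symDeriv_polyExp (j k : Fin m) (q : MvPolynomial (EntryIndex m) ℂ)
    (A : Matrix (Fin m) (Fin m) ℂ) :
    symDeriv j k (polyExp q A) = polyExp (opM (symUnit j k) q) A :=
  funext fun M => (hasLineDerivAt_polyExp q A M _).lineDeriv

/-- The action of `D_{ā,a}` on polynomials. -/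
noncomputable def minorOp (x : SetPair m) : Module.End ℂ (MvPolynomial (EntryIndex m) ℂ) :=
  ∑ σ : Equiv.Perm (Fin x.1.1.card), ((Equiv.Perm.sign σ : ℤ) : ℂ) •
    (List.ofFn fun i => opM (symUnit (x.1.1.orderEmbOfFin rfl i)
      (x.1.2.orderEmbOfFin x.2.symm (σ i)))).prod

theorem polyExp_linear (A : Matrix (Fin m) (Fin m) ℂ) :
    ∃ F : MvPolynomial (EntryIndex m) ℂ →ₗ[ℂ] (SymMat m → ℂ), ∀ q, F q = polyExp q A :=
  ⟨{ toFun := fun q => polyExp q A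
     map_add' := fun p q => by
      funext M
      simp [polyExp, add_mul]
     map_smul' := fun c q => by
      funext M
      simp [polyExp, smul_eval, mul_assoc] }, fun _ => rfl⟩

theorem minorDeriv_polyExp (x : SetPair m) (q : MvPolynomial (EntryIndex m) ℂ)
    (A : Matrix (Fin m) (Fin m) ℂ) :
    minorDeriv x (polyExp q A) = polyExp (minorOp x q) A := by
  obtain ⟨F, hF⟩ := polyExp_linear A
  rw [minorDeriv, ← hF (minorOp x q), minorOp, LinearMap.sum_apply, map_sum]
  refine Finset.sum_congr rfl fun σ _ => ?_
  rw [LinearMap.smul_apply, map_smul, hF]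
  congr 1
  exact compAll_eq_prod (fun q => polyExp q A) (fun _ q => symDeriv_polyExp _ _ q A) q

/-- The action of `D_{𝐚̄,𝐚}` on polynomials. -/
noncomputable def multiOp (a : MultiPair m) : Module.End ℂ (MvPolynomial (EntryIndex m) ℂ) :=
  (List.ofFn fun l => minorOp (a l)).prod

theorem multiDeriv_polyExp (a : MultiPair m) (q : MvPolynomial (EntryIndex m) ℂ)
    (A : Matrix (Fin m) (Fin m) ℂ) :
    multiDeriv a (polyExp q A) = polyExp (multiOp a q) A :=
  compAll_eq_prod (fun q => polyExp q A) (fun _ q => minorDeriv_polyExp _ q A) q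

theorem commute_multiOp_opA (a : MultiPair m)
    (P : Fin m × Fin m → MvPolynomial (Fin m × Fin m) ℂ) : Commute (multiOp a) (opA P) := by
  refine Commute.list_prod_left _ _ fun T hT => ?_
  obtain ⟨l, rfl⟩ := (List.mem_ofFn' _ _).1 hT
  refine Commute.sum_left _ _ _ fun σ _ => Commute.smul_left ?_ _
  refine Commute.list_prod_left _ _ fun T hT => ?_
  obtain ⟨i, rfl⟩ := (List.mem_ofFn' _ _).1 hT
  exact commute_opM_opA _ _

/-! ### The differential operators on exponentials -/

/-- The factor 1/2 in the off-diagonal derivatives is what makes the trace of B against `symUnit j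
k` equal to B_{jk}, so ζ_B is an eigenfunction with eigenvalue (i/2) B_{jk}. -/
theorem symDeriv_smul_zeta {B : Matrix (Fin m) (Fin m) ℂ} (hB : B.IsSymm) (j k : Fin m) (c : ℂ) :
    symDeriv j k (c • zeta B) = (((Complex.I / 2) • B) j k * c) • zeta B := by
  funext M
  have h := (hasDerivAt_zeta (symUnit j k) B M).const_mul c
  have h2 : HasLineDerivAt ℝ (c • zeta B) _ M (symUnit j k) := h
  have htr : (B * (symUnit j k).1.map (fun t : ℝ => (t : ℂ))).trace = B j k := by
    have h1 : (symUnit j k).1.map (fun t : ℝ => (t : ℂ)) =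
        (2⁻¹ : ℂ) • (Matrix.single j k 1 + Matrix.single k j 1) := by
      ext a b
      simp only [symUnit, Matrix.map_apply, Matrix.smul_apply, Matrix.add_apply,
        Matrix.single_apply, smul_eq_mul]
      push_cast
      split_ifs <;> simp
    rw [h1, Matrix.mul_smul, Matrix.trace_smul, Matrix.mul_add, Matrix.trace_add,
      Matrix.trace_mul_single, Matrix.trace_mul_single]
    simp only [MulOpposite.op_one, one_smul, smul_eq_mul]
    rw [hB.apply j k]
    ring
  rw [symDeriv, h2.lineDeriv, htr]
  simp only [Pi.smul_apply, smul_eq_mul, Matrix.smul_apply]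
  ring

theorem compAll_smul_eq {X : Type*} [AddCommGroup X] [Module ℂ X] {c : ℕ} (z : X)
    {A : Fin c → X → X} {b : Fin c → ℂ} (h : ∀ i (s : ℂ), A i (s • z) = (b i * s) • z) (s : ℂ) :
    compAll A (s • z) = ((∏ i, b i) * s) • z := by
  induction c with
  | zero => simp [compAll]
  | succ c ih =>
    have := ih (A := fun i => A i.succ) (b := fun i => b i.succ) (fun i q => h i.succ q)
    rw [compAll, List.ofFn_succ, List.foldr_cons]
    refine (congrArg (A 0) this).trans ?_
    rw [h, Fin.prod_univ_succ, mul_assoc]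

theorem minorDeriv_smul_zeta {B : Matrix (Fin m) (Fin m) ℂ} (hB : B.IsSymm) (x : SetPair m)
    (c : ℂ) : minorDeriv x (c • zeta B) = (minor x ((Complex.I / 2) • B) * c) • zeta B := by
  -- The permutation acts on the column index in `minorDeriv` but on the row index in
  -- `Matrix.det_apply'`, hence the transposition.
  rw [minorDeriv, minor, ← Matrix.det_transpose, Matrix.det_apply', Finset.sum_mul,
    Finset.sum_smul]
  refine Finset.sum_congr rfl fun σ _ => ?_
  rw [compAll_smul_eq (zeta B) (fun i s => symDeriv_smul_zeta hB _ _ s), smul_smul, ← mul_assoc]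
  rfl

theorem multiDeriv_zeta {B : Matrix (Fin m) (Fin m) ℂ} (hB : B.IsSymm) (a : MultiPair m) :
    multiDeriv a (zeta B) = multiMinor a ((Complex.I / 2) • B) • zeta B := by
  have h := compAll_smul_eq (zeta B) (A := fun l => minorDeriv (a l))
    (fun l s => minorDeriv_smul_zeta hB (a l) s) 1
  rw [one_smul, mul_one] at h
  exact h

end Families

/-! ### Functionals determined by their values on exponentials -/

section Functionals

open Matrix MvPolynomial

variable {m : ℕ}

/-- The linear polynomial `(i/2) Tr(w M)`. -/
noncomputable def traceForm (w : SymMat m) : MvPolynomial (Fin m × Fin m) ℂ :=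
  C (Complex.I / 2) * ∑ i, ∑ j, C ((w.1 i j : ℝ) : ℂ) * X (j, i)

theorem polyZeta_mem_PE (p : MvPolynomial (Fin m × Fin m) ℂ) {B : Matrix (Fin m) (Fin m) ℂ}
    (hB : B.IsSymm) (hY : (B.map Complex.im).PosDef) : polyZeta p B ∈ PE m :=
  Submodule.subset_span ⟨p, B, hB, hY, rfl⟩

theorem polyZeta_C (a : ℂ) (B : Matrix (Fin m) (Fin m) ℂ) :
    polyZeta (C a) B = a • zeta B := by
  funext M
  simp [polyZeta]

theorem zeta_eq_polyZeta (B : Matrix (Fin m) (Fin m) ℂ) : zeta B = polyZeta 1 B := by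
  rw [← C_1, polyZeta_C, one_smul]

theorem zeta_mem_PE {B : Matrix (Fin m) (Fin m) ℂ} (hB : B.IsSymm)
    (hY : (B.map Complex.im).PosDef) : zeta B ∈ PE m := by
  rw [zeta_eq_polyZeta]
  exact polyZeta_mem_PE 1 hB hY

theorem polyZeta_add (p q : MvPolynomial (Fin m × Fin m) ℂ) (B : Matrix (Fin m) (Fin m) ℂ) :
    polyZeta (p + q) B = polyZeta p B + polyZeta q B := by
  funext M
  simp [polyZeta, add_mul]

/-- Differentiating ζ_B in the direction `symUnit j k` of B brings down (i/2) M_{jk}. In this way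
derivatives in B generate all polynomial prefactors. -/
theorem polyZeta_traceForm_symUnit (p : MvPolynomial (Fin m × Fin m) ℂ)
    (B : Matrix (Fin m) (Fin m) ℂ) (x : Fin m × Fin m) :
    polyZeta (traceForm (symUnit x.1 x.2) * p) B = (Complex.I / 2) • polyZeta (p * X x) B := by
  funext M
  have hM : M.1.IsSymm := M.2
  have h1 : ∑ i, ∑ j, (((symUnit x.1 x.2).1 i j : ℝ) : ℂ) * ((M.1 j i : ℝ) : ℂ) =
      ((M.1 x.1 x.2 : ℝ) : ℂ) := by
    have h2 : ∑ i, ∑ j, (symUnit x.1 x.2).1 i j * M.1 j i = M.1 x.1 x.2 := by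
      have h3 : ∑ i, ∑ j, (symUnit x.1 x.2).1 i j * M.1 j i =
          ((symUnit x.1 x.2).1 * M.1).trace := by
        simp [Matrix.trace, Matrix.mul_apply]
      rw [h3, Matrix.trace_mul_comm, symUnit, Matrix.mul_smul, Matrix.trace_smul, Matrix.mul_add,
        Matrix.trace_add, Matrix.trace_mul_single, Matrix.trace_mul_single]
      simp only [MulOpposite.op_one, one_smul, smul_eq_mul]
      rw [hM.apply x.1 x.2]
      ring
    exact_mod_cast h2
  simp only [polyZeta, traceForm, map_mul, map_sum, eval_C, eval_X, h1, Pi.smul_apply, smul_eq_mul]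
  ring

theorem polyZeta_eq_polyExp (p : MvPolynomial (Fin m × Fin m) ℂ)
    (B : Matrix (Fin m) (Fin m) ℂ) : polyZeta p B = polyExp (rename Sum.inl p) B := by
  funext M
  rw [polyZeta, polyExp, eval_rename]
  rfl

theorem polyExp_eq_polyZeta (q : MvPolynomial (EntryIndex m) ℂ) (A : Matrix (Fin m) (Fin m) ℂ) :
    ∃ p, polyExp q A = polyZeta p A := by
  refine ⟨bind₁ (Sum.elim X fun x => C (A x.1 x.2)) q, ?_⟩
  funext M
  have h := eval₂Hom_bind₁ (RingHom.id ℂ) (fun x : Fin m × Fin m => ((M.1 x.1 x.2 : ℝ) : ℂ))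
    (Sum.elim X fun x => C (A x.1 x.2)) q
  have he : (fun i => eval (fun x : Fin m × Fin m => ((M.1 x.1 x.2 : ℝ) : ℂ))
      ((Sum.elim X fun x => C (A x.1 x.2) : EntryIndex m → _) i)) = entries A M := by
    funext i
    rcases i with i | i <;> simp [entries]
  rw [polyZeta, polyExp, ← he]
  exact congrArg (· * zeta A M) h.symm

theorem polyExp_mem_PE (q : MvPolynomial (EntryIndex m) ℂ) {B : Matrix (Fin m) (Fin m) ℂ}
    (hB : B.IsSymm) (hY : (B.map Complex.im).PosDef) : polyExp q B ∈ PE m := by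
  obtain ⟨p, hp⟩ := polyExp_eq_polyZeta q B
  rw [hp]
  exact polyZeta_mem_PE p hB hY

/-- On coefficients that depend on M alone, a derivative in B acts only through the exponent. -/
theorem opA_rename_inl (p : MvPolynomial (Fin m × Fin m) ℂ) (w : SymMat m) :
    opA (fun x => C ((w.1 x.1 x.2 : ℝ) : ℂ)) (rename Sum.inl p) =
      rename Sum.inl (traceForm w * p) := by
  rw [opA, LinearMap.add_apply, LinearMap.mulLeft_apply, map_mul]
  have h := mkDerivation_inr_rename_inl
    (fun x : Fin m × Fin m => rename Sum.inr (C ((w.1 x.1 x.2 : ℝ) : ℂ))) p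
  rw [Derivation.coeFn_coe, h, zero_add]
  congr 1
  simp [expDerivA, traceForm, map_mul, map_sum]

theorem complexify_zero_smul (w : SymMat m) (B : Matrix (Fin m) (Fin m) ℂ) :
    B + complexify ((0 : ℝ) • w) = B := by
  ext i j
  simp [complexify]

/-- Linear functionals on `PE(m)` which may be differentiated with respect to the matrix in the
exponent. -/
structure IsExpDiff (Λ : (SymMat m → ℂ) → ℂ) : Prop where
  add : ∀ f ∈ PE m, ∀ g ∈ PE m, Λ (f + g) = Λ f + Λ g
  smul : ∀ (c : ℂ), ∀ f ∈ PE m, Λ (c • f) = c * Λ f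
  hasDerivAt : ∀ (p : MvPolynomial (Fin m × Fin m) ℂ) (B : Matrix (Fin m) (Fin m) ℂ) (w : SymMat m),
    B.IsSymm → (B.map Complex.im).PosDef →
    HasDerivAt (fun t : ℝ => Λ (polyZeta p (B + complexify (t • w))))
      (Λ (polyZeta (traceForm w * p) B)) 0

/-- Induction on the polynomial: an extra factor M_{jk} is, up to i/2, a derivative in B along
`symUnit j k`. Real directions leave Im B unchanged, so the whole line stays in the domain where
agreement is already known, and equal functions of t have equal derivatives. -/
theorem IsExpDiff.eq_of_zeta {Λ₁ Λ₂ : (SymMat m → ℂ) → ℂ} (h₁ : IsExpDiff Λ₁) (h₂ : IsExpDiff Λ₂)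
    (h : ∀ B : Matrix (Fin m) (Fin m) ℂ, B.IsSymm → (B.map Complex.im).PosDef →
      Λ₁ (zeta B) = Λ₂ (zeta B)) {f : SymMat m → ℂ} (hf : f ∈ PE m) : Λ₁ f = Λ₂ f := by
  have key : ∀ (p : MvPolynomial (Fin m × Fin m) ℂ) (B : Matrix (Fin m) (Fin m) ℂ),
      B.IsSymm → (B.map Complex.im).PosDef → Λ₁ (polyZeta p B) = Λ₂ (polyZeta p B) := by
    intro p
    induction p using MvPolynomial.induction_on with
    | C a =>
      intro B hB hY
      rw [polyZeta_C, h₁.smul a _ (zeta_mem_PE hB hY), h₂.smul a _ (zeta_mem_PE hB hY), h B hB hY]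
    | add p q hp hq =>
      intro B hB hY
      have hp' := polyZeta_mem_PE p hB hY
      have hq' := polyZeta_mem_PE q hB hY
      rw [polyZeta_add, h₁.add _ hp' _ hq', h₂.add _ hp' _ hq', hp B hB hY, hq B hB hY]
    | mul_X p x hp =>
      intro B hB hY
      have hd := h₁.hasDerivAt p B (symUnit x.1 x.2) hB hY
      have he : (fun t : ℝ => Λ₁ (polyZeta p (B + complexify (t • symUnit x.1 x.2)))) =
          fun t : ℝ => Λ₂ (polyZeta p (B + complexify (t • symUnit x.1 x.2))) := by
        funext t
        exact hp _ (hB.add (isSymm_complexify _)) (by rwa [im_add_complexify])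
      rw [he] at hd
      have := hd.unique (h₂.hasDerivAt p B (symUnit x.1 x.2) hB hY)
      have hm := polyZeta_mem_PE (p * X x) hB hY
      rw [polyZeta_traceForm_symUnit, h₁.smul _ _ hm, h₂.smul _ _ hm] at this
      exact mul_left_cancel₀ (div_ne_zero Complex.I_ne_zero two_ne_zero) this
  induction hf using Submodule.span_induction with
  | mem f hf =>
    obtain ⟨p, B, hB, hY, rfl⟩ := hf
    exact key p B hB hY
  | zero =>
    have h0 := h₁.smul 0 0 (PE m).zero_mem
    have h0' := h₂.smul 0 0 (PE m).zero_mem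
    rw [zero_smul, zero_mul] at h0 h0'
    rw [h0, h0']
  | add f g hf hg hf' hg' => rw [h₁.add f hf g hg, h₂.add f hf g hg, hf', hg']
  | smul c f hf hf' => rw [h₁.smul c f hf, h₂.smul c f hf, hf']

theorem IsExpDiff.sum_mul {ι : Type*} [Fintype ι] (c : ι → ℂ) {Λ : ι → (SymMat m → ℂ) → ℂ}
    (h : ∀ i, IsExpDiff (Λ i)) : IsExpDiff (fun f => ∑ i, c i * Λ i f) where
  add f hf g hg := by
    rw [← Finset.sum_add_distrib]
    exact Finset.sum_congr rfl fun i _ => by rw [(h i).add f hf g hg, mul_add]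
  smul a f hf := by
    rw [Finset.mul_sum]
    exact Finset.sum_congr rfl fun i _ => by rw [(h i).smul a f hf, mul_left_comm]
  hasDerivAt p B w hB hY :=
    HasDerivAt.fun_sum fun i _ => ((h i).hasDerivAt p B w hB hY).const_mul (c i)

theorem IsExpDiff.const_mul (c : ℂ) {Λ : (SymMat m → ℂ) → ℂ} (h : IsExpDiff Λ) :
    IsExpDiff (fun f => c * Λ f) where
  add f hf g hg := by rw [h.add f hf g hg, mul_add]
  smul a f hf := by rw [h.smul a f hf, mul_left_comm]
  hasDerivAt p B w hB hY := (h.hasDerivAt p B w hB hY).const_mul c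

theorem im_add_posDef {A B : Matrix (Fin m) (Fin m) ℂ} (hA : (A.map Complex.im).PosDef)
    (hB : (B.map Complex.im).PosDef) : ((A + B).map Complex.im).PosDef := by
  have : (A + B).map Complex.im = A.map Complex.im + B.map Complex.im := by
    ext i j
    simp
  rw [this]
  exact hA.add hB

/-- Multiplication by q ζ_A only shifts B to A + B and multiplies the polynomial, both of which are
compatible with differentiation in B. -/
theorem IsExpDiff.comp_mul {Λ : (SymMat m → ℂ) → ℂ} (h : IsExpDiff Λ) {f : SymMat m → ℂ}
    (hf : f ∈ PE m) : IsExpDiff (fun g => Λ (fun M => f M * g M)) where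
  add g hg g' hg' := by
    rw [← h.add _ (PE_mul_mem hf hg) _ (PE_mul_mem hf hg')]
    congr 1
    funext M
    exact mul_add _ _ _
  smul c g hg := by
    rw [← h.smul c _ (PE_mul_mem hf hg)]
    congr 1
    funext M
    exact mul_left_comm _ _ _
  hasDerivAt p B w hB hY := by
    have hm : ∀ (q : MvPolynomial (Fin m × Fin m) ℂ) (t : ℝ),
        polyZeta q (B + complexify (t • w)) ∈ PE m := fun q t =>
      polyZeta_mem_PE q (hB.add (isSymm_complexify _)) (by rwa [im_add_complexify])
    induction hf using Submodule.span_induction with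
    | mem f hf =>
      obtain ⟨q, A, hA, hAY, rfl⟩ := hf
      have he : ∀ (r : MvPolynomial (Fin m × Fin m) ℂ) (W : Matrix (Fin m) (Fin m) ℂ),
          (fun M => polyZeta q A M * polyZeta r (B + W) M) = polyZeta (q * r) (A + B + W) :=
        fun r W => by
        funext M
        simp only [polyZeta, map_mul, add_assoc, ← zeta_mul]
        ring
      have := h.hasDerivAt (q * p) (A + B) w (hA.add hB) (im_add_posDef hAY hY)
      simp_rw [← he] at this
      refine this.congr_deriv ?_
      have h0 := he (traceForm w * p) 0
      rw [add_zero, add_zero] at h0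
      rw [h0, mul_left_comm]
    | zero =>
      have h0 := h.smul 0 0 (PE m).zero_mem
      rw [zero_smul, zero_mul] at h0
      have : ∀ g : SymMat m → ℂ, Λ (fun M => (0 : SymMat m → ℂ) M * g M) = 0 := fun g => by
        have hz : (fun M => (0 : SymMat m → ℂ) M * g M) = 0 := by
          funext M
          simp
        rw [hz, h0]
      simp_rw [this]
      exact hasDerivAt_const _ _
    | add f f' hf hf' hd hd' =>
      have : ∀ g ∈ PE m, Λ (fun M => (f + f') M * g M) =
          Λ (fun M => f M * g M) + Λ (fun M => f' M * g M) := fun g hg => by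
        rw [← h.add _ (PE_mul_mem hf hg) _ (PE_mul_mem hf' hg)]
        congr 1
        funext M
        exact add_mul _ _ _
      rw [this _ (polyZeta_mem_PE _ hB hY)]
      simp_rw [this _ (hm p _)]
      exact hd.add hd'
    | smul c f hf hd =>
      have : ∀ g ∈ PE m, Λ (fun M => (c • f) M * g M) = c * Λ (fun M => f M * g M) :=
        fun g hg => by
        rw [← h.smul c _ (PE_mul_mem hf hg)]
        congr 1
        funext M
        exact mul_assoc _ _ _
      rw [this _ (polyZeta_mem_PE _ hB hY)]
      simp_rw [this _ (hm p _)]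
      exact hd.const_mul c

theorem zeta_mul_polyZeta (A B : Matrix (Fin m) (Fin m) ℂ)
    (p : MvPolynomial (Fin m × Fin m) ℂ) :
    (fun M => zeta A M * polyZeta p B M) = polyZeta p (A + B) := by
  funext M
  simp only [polyZeta, ← zeta_mul]
  ring

theorem IsExpDiff.comp_zeta_mul {Λ : (SymMat m → ℂ) → ℂ} (h : IsExpDiff Λ) (B : SymMat m) :
    IsExpDiff (fun g => Λ (fun M => zeta (complexify B) M * g M)) where
  add g hg g' hg' := by
    rw [← h.add _ (PE_zeta_mul_mem B hg) _ (PE_zeta_mul_mem B hg')]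
    congr 1
    funext M
    exact mul_add _ _ _
  smul c g hg := by
    rw [← h.smul c _ (PE_zeta_mul_mem B hg)]
    congr 1
    funext M
    exact mul_left_comm _ _ _
  hasDerivAt p A w hA hY := by
    simp_rw [zeta_mul_polyZeta, ← add_assoc]
    refine h.hasDerivAt p _ w ((isSymm_complexify B).add hA) ?_
    rwa [add_comm, im_add_complexify]

theorem isExpDiff_multiDeriv (a : MultiPair m) (M : SymMat m) :
    IsExpDiff (fun f => multiDeriv a f M) where
  add f hf g hg := congrFun ((linearOnSub_multiDeriv a).add f hf g hg) M
  smul c f hf := congrFun ((linearOnSub_multiDeriv a).smul c f hf) M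
  hasDerivAt p B w hB hY := by
    have := (isPolyFamily_add B).hasDerivAt_polyExp (multiOp a (rename Sum.inl p)) M w 0
    simp only [polyZeta_eq_polyExp, multiDeriv_polyExp]
    refine this.congr_deriv ?_
    have hc := congrArg (fun T : Module.End ℂ (MvPolynomial (EntryIndex m) ℂ) =>
      T (rename Sum.inl p)) (commute_multiOp_opA a
        (fun x : Fin m × Fin m => C ((w.1 x.1 x.2 : ℝ) : ℂ))).eq
    simp only [Module.End.mul_apply, opA_rename_inl] at hc
    rw [← hc, complexify_zero_smul]

/-! ### The Leibniz rule -/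

theorem multiDeriv_zeta_mul {a : MultiPair m} {w : MultiPair m × MultiPair m → ℂ}
    (hw : ∀ A B : Matrix (Fin m) (Fin m) ℂ,
      multiMinor a (A + B) = ∑ y, w y * (multiMinor y.1 A * multiMinor y.2 B))
    {A B : Matrix (Fin m) (Fin m) ℂ} (hA : A.IsSymm) (hB : B.IsSymm) (M : SymMat m) :
    multiDeriv a (fun M => zeta A M * zeta B M) M =
      ∑ y, w y * (multiDeriv y.1 (zeta A) M * multiDeriv y.2 (zeta B) M) := by
  have he : (fun M => zeta A M * zeta B M) = zeta (A + B) := funext fun M => zeta_mul A B M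
  rw [he, multiDeriv_zeta (hA.add hB), Pi.smul_apply, smul_add, hw, smul_eq_mul, Finset.sum_mul]
  refine Finset.sum_congr rfl fun y _ => ?_
  rw [multiDeriv_zeta hA, multiDeriv_zeta hB, Pi.smul_apply, Pi.smul_apply, smul_eq_mul,
    smul_eq_mul, ← zeta_mul]
  ring

/-- On two exponentials the rule is the expansion of minors of A + B. Both sides are linear and
differentiable in each argument, so it extends to PE(m) first in f and then in g. -/
theorem exists_multiDeriv_mul (a : MultiPair m) : ∃ w : MultiPair m × MultiPair m → ℂ,
    ∀ f ∈ PE m, ∀ g ∈ PE m, ∀ M, multiDeriv a (fun M => f M * g M) M =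
      ∑ y, w y * (multiDeriv y.1 f M * multiDeriv y.2 g M) := by
  obtain ⟨w, hw⟩ := exists_multiMinor_add a
  refine ⟨w, fun f hf g hg M => ?_⟩
  have h1 : ∀ A : Matrix (Fin m) (Fin m) ℂ, A.IsSymm → (A.map Complex.im).PosDef →
      multiDeriv a (fun M => f M * zeta A M) M =
        ∑ y, w y * (multiDeriv y.1 f M * multiDeriv y.2 (zeta A) M) := by
    intro A hA hY
    have hl := (isExpDiff_multiDeriv a M).comp_mul (zeta_mem_PE hA hY)
    have hr := IsExpDiff.sum_mul (fun y : MultiPair m × MultiPair m =>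
      w y * multiDeriv y.2 (zeta A) M) (fun y => isExpDiff_multiDeriv y.1 M)
    have := hl.eq_of_zeta hr (fun B hB hY => ?_) hf
    · simp_rw [mul_comm (f _)]
      rw [this]
      exact Finset.sum_congr rfl fun y _ => by ring
    · simp_rw [mul_comm (zeta A _)]
      rw [multiDeriv_zeta_mul hw hB hA]
      exact Finset.sum_congr rfl fun y _ => by ring
  have hl := (isExpDiff_multiDeriv a M).comp_mul hf
  have hr := IsExpDiff.sum_mul (fun y : MultiPair m × MultiPair m => w y * multiDeriv y.1 f M)
    (fun y => isExpDiff_multiDeriv y.2 M)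
  rw [hl.eq_of_zeta hr (fun A hA hY => ?_) hg]
  · exact Finset.sum_congr rfl fun y _ => by ring
  · rw [h1 A hA hY]
    exact Finset.sum_congr rfl fun y _ => by ring

/-- The function ζ_B with real B need not belong to PE(m), so the previous rule does not apply. As
every derivative of ζ_B is a constant multiple of ζ_B, the coefficients are constants. -/
theorem exists_multiDeriv_zeta_mul (a : MultiPair m) (B : SymMat m) :
    ∃ c : MultiPair m → ℂ, ∀ f ∈ PE m, ∀ M,
      multiDeriv a (fun M => zeta (complexify B) M * f M) M =
        ∑ b, c b * (zeta (complexify B) M * multiDeriv b f M) := by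
  obtain ⟨w, hw⟩ := exists_multiMinor_add a
  refine ⟨fun b => ∑ y, w (y, b) * multiMinor y ((Complex.I / 2) • complexify B),
    fun f hf M => ?_⟩
  have hr := IsExpDiff.sum_mul (fun b => (∑ y, w (y, b) *
    multiMinor y ((Complex.I / 2) • complexify B)) * zeta (complexify B) M)
    (fun b => isExpDiff_multiDeriv b M)
  rw [((isExpDiff_multiDeriv a M).comp_zeta_mul B).eq_of_zeta hr (fun A hA hY => ?_) hf]
  · exact Finset.sum_congr rfl fun y _ => by ring
  · rw [multiDeriv_zeta_mul hw (isSymm_complexify B) hA, Fintype.sum_prod_type_right]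
    refine Finset.sum_congr rfl fun b _ => ?_
    rw [Finset.sum_mul, Finset.sum_mul]
    refine Finset.sum_congr rfl fun y _ => ?_
    rw [multiDeriv_zeta (isSymm_complexify B), Pi.smul_apply, smul_eq_mul]
    ring

end Functionals

/-! ### The Gaussian integral over `ℝ^{m × 2n}` -/

section GaussianPhi

open MvPolynomial

variable {m : ℕ}

theorem zeta_gram (B : Matrix (Fin m) (Fin m) ℂ) (φ : PhiSpace m) :
    zeta B (gram φ) = Complex.exp (Complex.I / 2 * ∑ l, quadC B (fun i => φ (i, l))) := by
  rw [zeta]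
  congr 2
  simp only [quadC, Matrix.trace, Matrix.diag_apply, Matrix.mul_apply, Matrix.map_apply, gram,
    Matrix.of_apply, Complex.ofReal_sum, Complex.ofReal_mul, Finset.mul_sum]
  symm
  rw [Finset.sum_comm]
  refine Finset.sum_congr rfl fun i _ => ?_
  rw [Finset.sum_comm]
  refine Finset.sum_congr rfl fun j _ => Finset.sum_congr rfl fun l _ => ?_
  ring

theorem integral_zeta_gram {B : Matrix (Fin m) (Fin m) ℂ} (hB : B.IsSymm)
    (hY : (B.map Complex.im).PosDef) (φ' : PhiSpace m) :
    ∫ φ : PhiSpace m, Complex.exp (Complex.I * (pairing φ' φ : ℂ)) * zeta B (gram φ) =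
      (2 * Real.pi * Complex.I) ^ (m * halfDim m) / B.det ^ halfDim m * zeta (-B⁻¹) (gram φ') := by
  have h := (gaussian_integral_even (κ := Fin (2 * halfDim m)) (n := halfDim m)
    (Fintype.card_fin _) hB hY (fun x => φ' x)).2
  have he : (fun φ : PhiSpace m => Complex.exp (Complex.I * (pairing φ' φ : ℂ)) *
      zeta B (gram φ)) = (fun v : Fin m × Fin (2 * halfDim m) → ℝ =>
        Complex.exp (Complex.I * ((∑ x, φ' x * v x : ℝ) : ℂ) +
          Complex.I / 2 * ∑ l, quadC B (fun j => v (j, l)))) ∘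
        (MeasurableEquiv.toLp 2 (Fin m × Fin (2 * halfDim m) → ℝ)).symm := by
    funext φ
    simp only [Function.comp_apply]
    rw [Complex.exp_add, zeta_gram]
    rfl
  have hp := PiLp.volume_preserving_ofLp (Fin m × Fin (2 * halfDim m))
  rw [he]
  refine (hp.integral_comp (MeasurableEquiv.toLp 2
    (Fin m × Fin (2 * halfDim m) → ℝ)).symm.measurableEmbedding
    (fun v : Fin m × Fin (2 * halfDim m) → ℝ =>
      Complex.exp (Complex.I * ((∑ x, φ' x * v x : ℝ) : ℂ) +
        Complex.I / 2 * ∑ l, quadC B (fun j => v (j, l))))).trans ?_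
  rw [h, Fintype.card_fin, zeta_gram]
  congr 2
  have : ∀ y : Fin m → ℝ, quadC (-B⁻¹) y = -quadC B⁻¹ y := fun y => by
    simp [quadC]
  simp_rw [this, Finset.sum_neg_distrib]
  ring

/-! ### Majorants and differentiation under the integral -/

theorem RapidDecay.mul_one_add_norm_pow {X : Type*} [NormedAddCommGroup X] {h : X → ℂ}
    (hh : RapidDecay h) (N : ℕ) : RapidDecay (fun x => h x * ((1 + ‖x‖ : ℝ) : ℂ) ^ N) := by
  induction N with
  | zero => simpa using hh
  | succ N ih => simpa only [pow_succ, mul_assoc] using ih.mul_one_add_norm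

theorem norm_eval_le_pow {S τ : Type*} (ρ : S → ℝ) (hρ : ∀ s, 1 ≤ ρ s) (z : S → τ → ℂ)
    (h : ∀ i, ∃ (C : ℝ) (N : ℕ), 0 ≤ C ∧ ∀ s, ‖z s i‖ ≤ C * ρ s ^ N) (q : MvPolynomial τ ℂ) :
    ∃ (C : ℝ) (N : ℕ), 0 ≤ C ∧ ∀ s, ‖eval (z s) q‖ ≤ C * ρ s ^ N := by
  have hρ0 : ∀ s, 0 ≤ ρ s := fun s => zero_le_one.trans (hρ s)
  induction q using MvPolynomial.induction_on with
  | C a => exact ⟨‖a‖, 0, norm_nonneg a, fun s => by simp⟩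
  | add p q hp hq =>
    obtain ⟨C, N, hC, hp⟩ := hp
    obtain ⟨C', N', hC', hq⟩ := hq
    refine ⟨C + C', N + N', by positivity, fun s => ?_⟩
    rw [map_add]
    calc _ ≤ C * ρ s ^ N + C' * ρ s ^ N' := (norm_add_le _ _).trans (add_le_add (hp s) (hq s))
      _ ≤ C * ρ s ^ (N + N') + C' * ρ s ^ (N + N') := by
          gcongr <;> first | exact hρ s | omega
      _ = _ := by ring
  | mul_X p i hp =>
    obtain ⟨C, N, hC, hp⟩ := hp
    obtain ⟨C', N', hC', h⟩ := h i
    refine ⟨C * C', N + N', by positivity, fun s => ?_⟩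
    rw [map_mul, eval_X, norm_mul]
    calc _ ≤ (C * ρ s ^ N) * (C' * ρ s ^ N') :=
          mul_le_mul (hp s) (h s) (norm_nonneg _) (mul_nonneg hC (pow_nonneg (hρ0 s) _))
      _ = _ := by ring

theorem norm_zeta_complexify (W M : SymMat m) : ‖zeta (complexify W) M‖ = 1 := by
  have h : (complexify W * M.1.map (fun t : ℝ => (t : ℂ))).trace =
      (((W.1 * M.1).trace : ℝ) : ℂ) := by
    simp [complexify, Matrix.trace, Matrix.mul_apply]
  rw [zeta, h, Complex.norm_exp]
  simp

theorem norm_zeta_add_complexify (B : Matrix (Fin m) (Fin m) ℂ) (W M : SymMat m) :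
    ‖zeta (B + complexify W) M‖ = ‖zeta B M‖ := by
  rw [← zeta_mul, norm_mul, norm_zeta_complexify, mul_one]

/-- A real shift of B does not change |ζ_B|, so for |t| < 1 a single rapidly decaying majorant
dominates the whole family. It justifies differentiating the integral in t. -/
theorem norm_polyExp_gram_le (q : MvPolynomial (EntryIndex m) ℂ)
    (B : Matrix (Fin m) (Fin m) ℂ) (w : SymMat m) :
    ∃ (C : ℝ) (N : ℕ), ∀ (t : ℝ) (φ : PhiSpace m), |t| < 1 →
      ‖polyExp q (B + complexify (t • w)) (gram φ)‖ ≤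
        C * (‖zeta B (gram φ)‖ * (1 + ‖φ‖) ^ N) := by
  obtain ⟨C, N, -, h⟩ := norm_eval_le_pow
    (fun s : {t : ℝ // |t| < 1} × PhiSpace m => 1 + ‖s.2‖)
    (fun s => by linarith [norm_nonneg s.2])
    (fun s => entries (B + complexify (s.1.1 • w)) (gram s.2)) (fun i => by
      rcases i with x | x
      · obtain ⟨C, N, hC, h⟩ := norm_eval_gram_le (X x : MvPolynomial (Fin m × Fin m) ℂ)
        refine ⟨C, N, hC, fun s => ?_⟩
        have := h s.2
        rwa [eval_X] at this
      · refine ⟨‖B x.1 x.2‖ + |w.1 x.1 x.2|, 0, by positivity, fun s => ?_⟩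
        rw [pow_zero, mul_one]
        change ‖B x.1 x.2 + ((s.1.1 * w.1 x.1 x.2 : ℝ) : ℂ)‖ ≤ _
        refine (norm_add_le _ _).trans (add_le_add le_rfl ?_)
        rw [Complex.norm_real, Real.norm_eq_abs, abs_mul]
        exact mul_le_of_le_one_left (abs_nonneg _) s.1.2.le) q
  refine ⟨C, N, fun t φ ht => ?_⟩
  rw [polyExp, norm_mul, norm_zeta_add_complexify]
  calc _ ≤ (C * (1 + ‖φ‖) ^ N) * ‖zeta B (gram φ)‖ := by
        gcongr
        exact h (⟨t, ht⟩, φ)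
    _ = _ := by ring

theorem integrable_kernel_mul {K h : PhiSpace m → ℂ} (hK : Continuous K) (hK1 : ∀ φ, ‖K φ‖ ≤ 1)
    (hh : RapidDecay h) : Integrable (fun φ => K φ * h φ) := by
  have h1 : Integrable h := memLp_one_iff_integrable.1 (hh.memLp volume le_rfl)
  exact h1.bdd_mul hK.aestronglyMeasurable (Filter.Eventually.of_forall hK1)

theorem hasDerivAt_integral_polyExp {K : PhiSpace m → ℂ} (hK : Continuous K)
    (hK1 : ∀ φ, ‖K φ‖ ≤ 1) (q : MvPolynomial (EntryIndex m) ℂ) {B : Matrix (Fin m) (Fin m) ℂ}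
    (hB : B.IsSymm) (hY : (B.map Complex.im).PosDef) (w : SymMat m) :
    HasDerivAt (fun t : ℝ => ∫ φ, K φ * polyExp q (B + complexify (t • w)) (gram φ))
      (∫ φ, K φ * polyExp (opA (fun x => C ((w.1 x.1 x.2 : ℝ) : ℂ)) q) B (gram φ)) 0 := by
  set q' := opA (fun x => C ((w.1 x.1 x.2 : ℝ) : ℂ)) q with hq'
  obtain ⟨c, N, hbound⟩ := norm_polyExp_gram_le q' B w
  have hdec : ∀ (r : MvPolynomial (EntryIndex m) ℂ) (t : ℝ),
      RapidDecay (fun φ : PhiSpace m => polyExp r (B + complexify (t • w)) (gram φ)) := fun r t =>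
    rapidDecay_PE _ (polyExp_mem_PE r (hB.add (isSymm_complexify _)) (by rwa [im_add_complexify]))
  have hint := fun r t => integrable_kernel_mul hK hK1 (hdec r t)
  have hbi : Integrable (fun φ : PhiSpace m => c * (‖zeta B (gram φ)‖ * (1 + ‖φ‖) ^ N)) := by
    have h1 := (rapidDecay_PE _ (zeta_mem_PE hB hY)).mul_one_add_norm_pow N
    have h2 : Integrable (fun φ : PhiSpace m => zeta B (gram φ) * ((1 + ‖φ‖ : ℝ) : ℂ) ^ N) :=
      memLp_one_iff_integrable.1 (h1.memLp volume le_rfl)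
    refine (h2.norm.congr (Filter.Eventually.of_forall fun φ => ?_)).const_mul c
    have : (0 : ℝ) ≤ 1 + ‖φ‖ := by positivity
    simp only [norm_mul, norm_pow, Complex.norm_real, Real.norm_eq_abs, abs_of_nonneg this]
  have := (hasDerivAt_integral_of_dominated_loc_of_deriv_le (μ := volume)
    (F := fun (t : ℝ) φ => K φ * polyExp q (B + complexify (t • w)) (gram φ))
    (F' := fun (t : ℝ) φ => K φ * polyExp q' (B + complexify (t • w)) (gram φ))
    (x₀ := 0) (Metric.ball_mem_nhds (0 : ℝ) one_pos)
    (Filter.Eventually.of_forall fun t => (hint q t).1) (hint q 0) (hint q' 0).1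
    (Filter.Eventually.of_forall fun φ t ht => ?_) hbi
    (Filter.Eventually.of_forall fun φ t _ => ?_)).2
  · simp_rw [complexify_zero_smul] at this
    exact this
  · rw [norm_mul]
    refine (mul_le_of_le_one_left (norm_nonneg _) (hK1 φ)).trans (hbound t φ ?_)
    simpa using ht
  · exact ((isPolyFamily_add B).hasDerivAt_polyExp q (gram φ) w t).const_mul (K φ)

theorem isExpDiff_integral {K : PhiSpace m → ℂ} (hK : Continuous K) (hK1 : ∀ φ, ‖K φ‖ ≤ 1)
    (a : MultiPair m) : IsExpDiff (fun f => ∫ φ, K φ * multiDeriv a f (gram φ)) where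
  add f hf g hg := by
    have hi : ∀ f ∈ PE m, Integrable (fun φ => K φ * multiDeriv a f (gram φ)) := fun f hf =>
      integrable_kernel_mul hK hK1 (rapidDecay_PE _ ((linearOnSub_multiDeriv a).mem f hf))
    rw [← integral_add (hi f hf) (hi g hg)]
    refine integral_congr_ae (Filter.Eventually.of_forall fun φ => ?_)
    simp only [(linearOnSub_multiDeriv a).add f hf g hg, Pi.add_apply, mul_add]
  smul c f hf := by
    rw [← integral_const_mul]
    refine integral_congr_ae (Filter.Eventually.of_forall fun φ => ?_)
    simp only [(linearOnSub_multiDeriv a).smul c f hf, Pi.smul_apply, smul_eq_mul]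
    ring
  hasDerivAt p B w hB hY := by
    have := hasDerivAt_integral_polyExp hK hK1 (multiOp a (rename Sum.inl p)) hB hY w
    simp only [polyZeta_eq_polyExp, multiDeriv_polyExp]
    refine this.congr_deriv ?_
    have hc := congrArg (fun T : Module.End ℂ (MvPolynomial (EntryIndex m) ℂ) =>
      T (rename Sum.inl p)) (commute_multiOp_opA a
        (fun x : Fin m × Fin m => C ((w.1 x.1 x.2 : ℝ) : ℂ))).eq
    simp only [Module.End.mul_apply, opA_rename_inl] at hc
    rw [← hc]

/-- The kernel `e^{i Tr(φ' φᵀ)}`. -/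
noncomputable def pairingKernel (φ' φ : PhiSpace m) : ℂ :=
  Complex.exp (Complex.I * (pairing φ' φ : ℂ))

theorem continuous_pairingKernel (φ' : PhiSpace m) : Continuous (pairingKernel φ') := by
  unfold pairingKernel pairing
  fun_prop

theorem norm_pairingKernel (φ' φ : PhiSpace m) : ‖pairingKernel φ' φ‖ ≤ 1 :=
  (norm_exp_I_mul_ofReal _).le

theorem isExpDiff_susyIntegral (φ' : PhiSpace m) :
    IsExpDiff (fun f => susyIntegral f φ') :=
  (isExpDiff_integral (continuous_pairingKernel φ') (norm_pairingKernel φ') _).const_mul _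

/-- The operator D_{𝐈,𝐈} produces det((i/2)B)^n, which cancels the determinant of the Gaussian
integral. The remaining constant (i/2)^{mn} (2πi)^{mn} = (-π)^{mn} cancels the prefactor. -/
theorem susyIntegral_zeta {B : Matrix (Fin m) (Fin m) ℂ} (hB : B.IsSymm)
    (hY : (B.map Complex.im).PosDef) (φ' : PhiSpace m) :
    susyIntegral (zeta B) φ' = zeta (-B⁻¹) (gram φ') := by
  have hdet : B.det ≠ 0 := (det_ne_zero_of_im_posDef hB hY).ne_zero
  have hpi : (Real.pi : ℂ) ≠ 0 := Complex.ofReal_ne_zero.2 Real.pi_ne_zero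
  rw [susyIntegral, multiDeriv_zeta hB, multiMinor_full, Matrix.det_smul, Fintype.card_fin]
  simp only [Pi.smul_apply, smul_eq_mul]
  simp_rw [mul_left_comm _ ((((Complex.I / 2) ^ m * B.det) ^ halfDim m))]
  rw [integral_const_mul, integral_zeta_gram hB hY, mul_pow, ← pow_mul]
  have h2 : (Complex.I / 2) ^ (m * halfDim m) * (2 * Real.pi * Complex.I) ^ (m * halfDim m) =
      (-1) ^ (m * halfDim m) * (Real.pi : ℂ) ^ (m * halfDim m) := by
    rw [← mul_pow, ← mul_pow]
    congr 1
    linear_combination (Real.pi : ℂ) * Complex.I_mul_I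
  have h1 : ((-1 : ℂ)) ^ (m * halfDim m) * (-1) ^ (m * halfDim m) = 1 := by
    rw [← mul_pow]
    norm_num
  field_simp
  linear_combination ((-1 : ℂ)) ^ (m * halfDim m) * zeta (-B⁻¹) (gram φ') * h2 +
    (Real.pi : ℂ) ^ (m * halfDim m) * zeta (-B⁻¹) (gram φ') * h1

end GaussianPhi

/-! ### The supersymmetric Fourier transform on `PE(m)` -/

section SusyTransform

open MvPolynomial

variable {m : ℕ}

/-! ### Gram matrices and uniqueness on the positive semidefinite cone -/

open scoped MatrixOrder Matrix.Norms.L2Operator in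
theorem exists_eq_conjTranspose_mul {A : Matrix (Fin m) (Fin m) ℝ} (hA : A.PosSemidef) :
    ∃ B : Matrix (Fin m) (Fin m) ℝ, A = B.conjTranspose * B :=
  CStarAlgebra.nonneg_iff_eq_star_mul_self.mp hA.nonneg

/-- Since 2n ≥ m there are enough columns: the transpose of a factor A with M = AᵀA fills the first
m of them, and the others are zero. -/
theorem exists_gram_eq (M : SymMat m) (hM : M.1.PosSemidef) : ∃ φ : PhiSpace m, gram φ = M := by
  obtain ⟨A, hA⟩ := exists_eq_conjTranspose_mul hM
  have hle : m ≤ 2 * halfDim m := by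
    unfold halfDim
    omega
  refine ⟨WithLp.toLp 2 fun x => if h : x.2.val < m then A ⟨x.2.val, h⟩ x.1 else 0,
    Subtype.ext ?_⟩
  ext j k
  rw [hA, Matrix.mul_apply]
  change ∑ l : Fin (2 * halfDim m), (if h : l.val < m then A ⟨l.val, h⟩ j else 0) *
    (if h : l.val < m then A ⟨l.val, h⟩ k else 0) = _
  rw [← Finset.sum_subset (Finset.subset_univ (Finset.univ.map (Fin.castLEEmb hle)))]
  · simp
  · intro l _ hl
    have : ¬ l.val < m := fun h => hl (by
      rw [Finset.mem_map]
      exact ⟨⟨l.val, h⟩, Finset.mem_univ _, rfl⟩)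
    simp [this]

theorem eventually_posSemidef_one_add (N : Matrix (Fin m) (Fin m) ℝ) (hN : N.IsSymm) :
    ∀ᶠ t : ℝ in nhds 0, (1 + t • N).PosSemidef := by
  set K := ∑ i, ∑ j, |N i j| with hK
  have hK0 : 0 ≤ K := Finset.sum_nonneg fun i _ => Finset.sum_nonneg fun j _ => abs_nonneg _
  have hev : ∀ᶠ t : ℝ in nhds 0, |t| * K < 1 := by
    have : ContinuousAt (fun t : ℝ => |t| * K) 0 := by fun_prop
    exact this.eventually_lt continuousAt_const (by simp)
  filter_upwards [hev] with t ht
  refine Matrix.PosSemidef.of_dotProduct_mulVec_nonneg ?_ fun x => ?_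
  · rw [Matrix.IsHermitian, Matrix.conjTranspose_eq_transpose_of_trivial]
    exact Matrix.isSymm_one.add (hN.smul t)
  · have hs : ∀ i, |x i| ^ 2 ≤ ∑ i, x i ^ 2 := fun i => by
      rw [sq_abs]
      exact Finset.single_le_sum (f := fun i => x i ^ 2) (fun i _ => sq_nonneg _)
        (Finset.mem_univ i)
    have h1 : |∑ i, ∑ j, x i * (N i j * x j)| ≤ K * ∑ i, x i ^ 2 := by
      rw [hK, Finset.sum_mul]
      refine (Finset.abs_sum_le_sum_abs _ _).trans (Finset.sum_le_sum fun i _ => ?_)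
      rw [Finset.sum_mul]
      refine (Finset.abs_sum_le_sum_abs _ _).trans (Finset.sum_le_sum fun j _ => ?_)
      rw [abs_mul, abs_mul]
      nlinarith [hs i, hs j, two_mul_le_add_sq |x i| |x j|, abs_nonneg (N i j)]
    have h2 : star x ⬝ᵥ (1 + t • N).mulVec x =
        ∑ i, x i ^ 2 + t * ∑ i, ∑ j, x i * (N i j * x j) := by
      rw [Matrix.add_mulVec, Matrix.one_mulVec, Matrix.smul_mulVec, dotProduct_add, dotProduct_smul]
      simp [dotProduct, Matrix.mulVec, Finset.mul_sum, sq]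
    rw [h2]
    have h3 : |t * ∑ i, ∑ j, x i * (N i j * x j)| ≤ |t| * K * ∑ i, x i ^ 2 := by
      rw [abs_mul, mul_assoc]
      exact mul_le_mul_of_nonneg_left h1 (abs_nonneg t)
    have h4 : 0 ≤ ∑ i, x i ^ 2 := Finset.sum_nonneg fun i _ => sq_nonneg _
    have h5 := (abs_le.1 h3).1
    nlinarith

theorem analyticOnNhd_PE_line {f : SymMat m → ℂ} (hf : f ∈ PE m) (M N : SymMat m) :
    AnalyticOnNhd ℝ (fun t : ℝ => f (M + t • N)) Set.univ := by
  have hent : ∀ i j, AnalyticOnNhd ℝ (fun t : ℝ => (((M + t • N : SymMat m).1 i j : ℝ) : ℂ))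
      Set.univ := fun i j t _ => by
    have h : AnalyticAt ℝ (fun t : ℝ => M.1 i j + t * N.1 i j) t :=
      analyticAt_const.add (analyticAt_id.mul analyticAt_const)
    exact (Complex.ofRealCLM.analyticAt _).comp h
  induction hf using Submodule.span_induction with
  | mem f hf =>
    obtain ⟨p, B, -, -, rfl⟩ := hf
    refine AnalyticOnNhd.mul ?_ ?_
    · induction p using MvPolynomial.induction_on with
      | C a => simpa using analyticOnNhd_const
      | add p q hp hq =>
        simp only [map_add]
        exact hp.add hq
      | mul_X p i hp =>
        simp only [map_mul, eval_X]
        exact hp.mul (hent _ _)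
    · intro t ht
      simp only [zeta, Matrix.trace, Matrix.diag_apply, Matrix.mul_apply, Matrix.map_apply]
      have hexp : ∀ z : ℂ, AnalyticAt ℝ Complex.exp z := fun z =>
        (analyticAt_cexp (z := z)).restrictScalars
      refine AnalyticAt.comp (g := Complex.exp) (hexp _) ?_
      refine analyticAt_const.mul (Finset.analyticAt_fun_sum _ fun i _ =>
        Finset.analyticAt_fun_sum _ fun j _ => analyticAt_const.mul (hent _ _ t ht))
  | zero => exact analyticOnNhd_const
  | add f g _ _ hf hg => exact hf.add hg
  | smul c f _ hf => exact (analyticOnNhd_const (v := c)).mul hf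

/-- Matrices near the identity on the line from the identity through M are positive semidefinite,
hence Gram matrices. The restriction of f to this line is real analytic and vanishes near t = 0, so
it vanishes at t = 1. -/
theorem PE_eq_zero_of_gram {f : SymMat m → ℂ} (hf : f ∈ PE m)
    (h : ∀ φ : PhiSpace m, f (gram φ) = 0) : f = 0 := by
  funext M
  set E : SymMat m := ⟨1, Matrix.isSymm_one⟩ with hE
  have hev : (fun t : ℝ => f (E + t • (M - E))) =ᶠ[nhds 0] fun _ => 0 := by
    filter_upwards [eventually_posSemidef_one_add (M - E).1 (M - E).2] with t ht
    obtain ⟨φ, hφ⟩ := exists_gram_eq (E + t • (M - E)) ht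
    rw [← hφ, h]
  have := (analyticOnNhd_PE_line hf E (M - E)).eq_of_eventuallyEq analyticOnNhd_const hev
  have h1 := congrFun this 1
  simpa using h1

theorem PE_eq_of_gram {f g : SymMat m → ℂ} (hf : f ∈ PE m) (hg : g ∈ PE m)
    (h : ∀ φ : PhiSpace m, f (gram φ) = g (gram φ)) : f = g :=
  sub_eq_zero.1 (PE_eq_zero_of_gram ((PE m).sub_mem hf hg) fun φ => by
    rw [Pi.sub_apply, h, sub_self])

/-- The derivatives of the entries of `-(B + W)⁻¹` in the direction `w` of `W`. -/
noncomputable def negInvDeriv (w : SymMat m) (x : Fin m × Fin m) :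
    MvPolynomial (Fin m × Fin m) ℂ :=
  ∑ a, ∑ b, X (x.1, a) * C ((w.1 a b : ℝ) : ℂ) * X (b, x.2)

/-- The transform of `p ζ_B` is `q(M, -B⁻¹) ζ_{-B⁻¹}(M)` for all `B`. -/
def IsTransform (p : MvPolynomial (Fin m × Fin m) ℂ) (q : MvPolynomial (EntryIndex m) ℂ) : Prop :=
  ∀ B : Matrix (Fin m) (Fin m) ℂ, B.IsSymm → (B.map Complex.im).PosDef → ∀ φ' : PhiSpace m,
    susyIntegral (polyZeta p B) φ' = polyExp q (-B⁻¹) (gram φ')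

/-- Differentiate the identity for p in B. On the left this inserts the trace form; on the right the
exponent -B⁻¹ moves with polynomial velocity, so the shape q(M, -B⁻¹) ζ_{-B⁻¹} persists with a q
that is the same for all B. -/
theorem IsTransform.traceForm_mul {p : MvPolynomial (Fin m × Fin m) ℂ}
    {q : MvPolynomial (EntryIndex m) ℂ} (h : IsTransform p q) (w : SymMat m) :
    IsTransform (traceForm w * p) (opA (negInvDeriv w) q) := by
  intro B hB hY φ'
  have h1 := (isExpDiff_susyIntegral φ').hasDerivAt p B w hB hY
  have h2 := (isPolyFamily_neg_inv hB hY).hasDerivAt_polyExp q (gram φ') w 0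
  rw [complexify_zero_smul] at h2
  refine h1.unique (h2.congr_of_eventuallyEq (Filter.Eventually.of_forall fun t => ?_))
  exact h _ (hB.add (isSymm_complexify _)) (by rwa [im_add_complexify]) φ'

theorem exists_isTransform (p : MvPolynomial (Fin m × Fin m) ℂ) : ∃ q, IsTransform p q := by
  induction p using MvPolynomial.induction_on with
  | C a =>
    refine ⟨C a, fun B hB hY φ' => ?_⟩
    rw [polyZeta_C, (isExpDiff_susyIntegral φ').smul a _ (zeta_mem_PE hB hY),
      susyIntegral_zeta hB hY, polyExp, eval_C]
  | add p q hp hq =>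
    obtain ⟨p', hp⟩ := hp
    obtain ⟨q', hq⟩ := hq
    refine ⟨p' + q', fun B hB hY φ' => ?_⟩
    rw [polyZeta_add, (isExpDiff_susyIntegral φ').add _ (polyZeta_mem_PE p hB hY) _
      (polyZeta_mem_PE q hB hY), hp B hB hY, hq B hB hY]
    simp [polyExp, add_mul]
  | mul_X p x hp =>
    obtain ⟨q, hq⟩ := hp
    -- The derivative along `symUnit` yields the new variable with a factor i/2, which is divided
    -- out.
    refine ⟨C (Complex.I / 2)⁻¹ * opA (negInvDeriv (symUnit x.1 x.2)) q, fun B hB hY φ' => ?_⟩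
    have h := hq.traceForm_mul (symUnit x.1 x.2) B hB hY φ'
    rw [polyZeta_traceForm_symUnit, (isExpDiff_susyIntegral φ').smul _ _
      (polyZeta_mem_PE _ hB hY)] at h
    have h0 : Complex.I / 2 ≠ 0 := div_ne_zero Complex.I_ne_zero two_ne_zero
    have h1 : polyExp (C (Complex.I / 2)⁻¹ * opA (negInvDeriv (symUnit x.1 x.2)) q) (-B⁻¹)
        (gram φ') = (Complex.I / 2)⁻¹ *
          polyExp (opA (negInvDeriv (symUnit x.1 x.2)) q) (-B⁻¹) (gram φ') := by
      simp only [polyExp, map_mul, eval_C, mul_assoc]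
    rw [h1, ← h, inv_mul_cancel_left₀ h0]

theorem exists_susyT (f : SymMat m → ℂ) (hf : f ∈ PE m) :
    ∃ g ∈ PE m, ∀ φ', g (gram φ') = susyIntegral f φ' := by
  induction hf using Submodule.span_induction with
  | mem f hf =>
    obtain ⟨p, B, hB, hY, rfl⟩ := hf
    obtain ⟨q, hq⟩ := exists_isTransform p
    exact ⟨_, polyExp_mem_PE q (isSymm_neg_inv hB) (im_neg_inv_posDef hB hY),
      fun φ' => (hq B hB hY φ').symm⟩
  | zero =>
    refine ⟨0, (PE m).zero_mem, fun φ' => ?_⟩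
    have := (isExpDiff_susyIntegral φ').smul 0 0 (PE m).zero_mem
    rw [zero_smul, zero_mul] at this
    rw [this, Pi.zero_apply]
  | add f g hf hg hf' hg' =>
    obtain ⟨f', hf', h⟩ := hf'
    obtain ⟨g', hg', h'⟩ := hg'
    exact ⟨f' + g', (PE m).add_mem hf' hg', fun φ' => by
      rw [Pi.add_apply, h, h', (isExpDiff_susyIntegral φ').add f hf g hg]⟩
  | smul c f hf hf' =>
    obtain ⟨f', hf', h⟩ := hf'
    exact ⟨c • f', (PE m).smul_mem c hf', fun φ' => by
      rw [Pi.smul_apply, h, (isExpDiff_susyIntegral φ').smul c f hf, smul_eq_mul]⟩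

theorem susyT_gram (f : PE m) (φ' : PhiSpace m) :
    (susyT f).1 (gram φ') = susyIntegral f.1 φ' := by
  have h : ∃ g : PE m, ∀ φ', g.1 (gram φ') = susyIntegral f.1 φ' := by
    obtain ⟨g, hg, h⟩ := exists_susyT f.1 f.2
    exact ⟨⟨g, hg⟩, h⟩
  rw [susyT, dif_pos h]
  exact h.choose_spec φ'

theorem susyT_eq {f : PE m} {g : SymMat m → ℂ} (hg : g ∈ PE m)
    (h : ∀ φ', susyIntegral f.1 φ' = g (gram φ')) : (susyT f).1 = g :=
  PE_eq_of_gram (susyT f).2 hg fun φ' => by rw [susyT_gram, h]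

theorem susyT_add (f g : PE m) : susyT (f + g) = susyT f + susyT g :=
  Subtype.ext (susyT_eq (susyT f + susyT g).2 fun φ' => by
    rw [Submodule.coe_add, (isExpDiff_susyIntegral φ').add _ f.2 _ g.2, Submodule.coe_add,
      Pi.add_apply, susyT_gram, susyT_gram])

theorem susyT_smul (c : ℂ) (f : PE m) : susyT (c • f) = c • susyT f :=
  Subtype.ext (susyT_eq (c • susyT f).2 fun φ' => by
    rw [Submodule.coe_smul, (isExpDiff_susyIntegral φ').smul c _ f.2, Submodule.coe_smul,
      Pi.smul_apply, susyT_gram, smul_eq_mul])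

open Classical in
/-- The transform `T`, extended by zero to all functions. -/
noncomputable def susyTExt (f : SymMat m → ℂ) : SymMat m → ℂ :=
  if hf : f ∈ PE m then (susyT ⟨f, hf⟩).1 else 0

theorem susyTExt_of_mem {f : SymMat m → ℂ} (hf : f ∈ PE m) :
    susyTExt f = (susyT ⟨f, hf⟩).1 := dif_pos hf

theorem linearOnSub_susyTExt : LinearOnSub (PE m) susyTExt where
  mem f hf := by
    rw [susyTExt_of_mem hf]
    exact (susyT ⟨f, hf⟩).2
  add f hf g hg := by
    rw [susyTExt_of_mem hf, susyTExt_of_mem hg, susyTExt_of_mem ((PE m).add_mem hf hg)]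
    exact congrArg Subtype.val (susyT_add ⟨f, hf⟩ ⟨g, hg⟩)
  smul c f hf := by
    rw [susyTExt_of_mem hf, susyTExt_of_mem ((PE m).smul_mem c hf)]
    exact congrArg Subtype.val (susyT_smul c ⟨f, hf⟩)

theorem susyTExt_polyZeta {p : MvPolynomial (Fin m × Fin m) ℂ} {q : MvPolynomial (EntryIndex m) ℂ}
    (h : IsTransform p q) {B : Matrix (Fin m) (Fin m) ℂ} (hB : B.IsSymm)
    (hY : (B.map Complex.im).PosDef) : susyTExt (polyZeta p B) = polyExp q (-B⁻¹) := by
  rw [susyTExt_of_mem (polyZeta_mem_PE p hB hY)]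
  exact susyT_eq (polyExp_mem_PE q (isSymm_neg_inv hB) (im_neg_inv_posDef hB hY)) (h B hB hY)

/-- The transform of p ζ_B moves along the Riccati family -(B + tw)⁻¹, and D_{𝐚̄,𝐚} commutes with
that motion at the level of coefficients. -/
theorem isExpDiff_multiDeriv_susyTExt (a : MultiPair m) (M : SymMat m) :
    IsExpDiff (fun f => multiDeriv a (susyTExt f) M) where
  add f hf g hg := congrFun (((linearOnSub_multiDeriv a).comp linearOnSub_susyTExt).add f hf g hg) M
  smul c f hf := congrFun (((linearOnSub_multiDeriv a).comp linearOnSub_susyTExt).smul c f hf) M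
  hasDerivAt p B w hB hY := by
    obtain ⟨q, hq⟩ := exists_isTransform p
    have hd := (isPolyFamily_neg_inv hB hY).hasDerivAt_polyExp (multiOp a q) M w 0
    have h1 : ∀ t : ℝ, susyTExt (polyZeta p (B + complexify (t • w))) =
        polyExp q (-(B + complexify (t • w))⁻¹) := fun t =>
      susyTExt_polyZeta hq (hB.add (isSymm_complexify _)) (by rwa [im_add_complexify])
    simp_rw [h1, susyTExt_polyZeta (hq.traceForm_mul w) hB hY, multiDeriv_polyExp]
    refine hd.congr_deriv ?_
    rw [complexify_zero_smul]
    have hc := congrArg (fun T : Module.End ℂ (MvPolynomial (EntryIndex m) ℂ) => T q)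
      (commute_multiOp_opA a (negInvDeriv w)).eq
    simp only [Module.End.mul_apply] at hc
    rw [hc]
    rfl

/-- The central identity: each derivative of T f is a constant times the Fourier integral of one
derivative of f. For f = ζ_B, Jacobi's theorem turns minors of -B⁻¹ into complementary minors of B
divided by det B, and these are the eigenvalue and the Gaussian determinant on the right. -/
theorem exists_multiDeriv_susyT (a : MultiPair m) : ∃ (b : MultiPair m) (c : ℂ),
    ∀ (f : PE m) (φ' : PhiSpace m), multiDeriv a (susyT f).1 (gram φ') =
      c * ∫ φ : PhiSpace m, pairingKernel φ' φ * multiDeriv b f.1 (gram φ) := by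
  obtain ⟨b, ε, hb⟩ := exists_multiMinor_inv a
  have hI : Complex.I / 2 ≠ 0 := div_ne_zero Complex.I_ne_zero two_ne_zero
  set z : ℂ := (2 * Real.pi * Complex.I) ^ (m * halfDim m) with hz
  have hz0 : z ≠ 0 := pow_ne_zero _ (mul_ne_zero (mul_ne_zero two_ne_zero
    (Complex.ofReal_ne_zero.2 Real.pi_ne_zero)) Complex.I_ne_zero)
  -- The factors are the scaling of the minors of -(i/2)B⁻¹, Jacobi's factor ε, the inverse scaling
  -- of the minors of (i/2)B, and the inverse of the Gaussian constant.
  refine ⟨b, (-(Complex.I / 2)) ^ a.size * ε * ((Complex.I / 2) ^ b.size)⁻¹ * z⁻¹, fun f φ' => ?_⟩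
  have hl := isExpDiff_multiDeriv_susyTExt a (gram φ')
  have hr := (isExpDiff_integral (continuous_pairingKernel φ') (norm_pairingKernel φ') b).const_mul
    ((-(Complex.I / 2)) ^ a.size * ε * ((Complex.I / 2) ^ b.size)⁻¹ * z⁻¹)
  have := hl.eq_of_zeta hr (fun B hB hY => ?_) f.2
  · rwa [susyTExt_of_mem f.2] at this
  · have hdet := det_ne_zero_of_im_posDef hB hY
    have h1 : susyTExt (zeta B) = zeta (-B⁻¹) := by
      rw [susyTExt_of_mem (zeta_mem_PE hB hY)]
      exact susyT_eq (zeta_mem_PE (isSymm_neg_inv hB) (im_neg_inv_posDef hB hY))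
        (susyIntegral_zeta hB hY)
    have h2 : (Complex.I / 2) • (-B⁻¹) = (-(Complex.I / 2)) • B⁻¹ := by
      rw [smul_neg, neg_smul]
    have h3 : (fun φ : PhiSpace m => pairingKernel φ' φ * multiDeriv b (zeta B) (gram φ)) =
        fun φ => multiMinor b ((Complex.I / 2) • B) *
          (Complex.exp (Complex.I * (pairing φ' φ : ℂ)) * zeta B (gram φ)) := by
      funext φ
      rw [multiDeriv_zeta hB, Pi.smul_apply, smul_eq_mul, mul_left_comm]
      rfl
    rw [h1, multiDeriv_zeta (isSymm_neg_inv hB), Pi.smul_apply, smul_eq_mul, h2, multiMinor_smul,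
      h3, integral_const_mul, integral_zeta_gram hB hY, multiMinor_smul, ← hz]
    have h4 := hb B hdet
    have h5 := hdet.ne_zero
    have h6 : multiMinor a B⁻¹ = ε * multiMinor b B / B.det ^ halfDim m := by
      rw [eq_div_iff (pow_ne_zero _ h5), h4]
    rw [h6]
    field_simp

end SusyTransform

/-! ### Compact extensions to completions -/

section CompactExtension

open UniformSpace

/-- As J is bounded below, a subset of Q is totally bounded as soon as its image under J is. The
image of the unit ball under J ∘ A = K is totally bounded, hence so is its image under A, and
density carries this over to the completions. -/
theorem exists_compact_extension {P Q R : Type*} [SeminormedAddCommGroup P] [NormedSpace ℂ P]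
    [SeminormedAddCommGroup Q] [NormedSpace ℂ Q] [NormedAddCommGroup R] [NormedSpace ℂ R]
    (A : P →ₗ[ℂ] Q) (J : Q →L[ℂ] R) {C : ℝ} (hC : ∀ g, ‖g‖ ≤ C * ‖J g‖) (K : P →L[ℂ] R)
    (hK : IsCompactOperator K) (h : ∀ f, J (A f) = K f) :
    ∃ S : Completion P →L[ℂ] Completion Q, IsCompactOperator S ∧
      ∀ f : P, S (f : Completion P) = (A f : Completion Q) := by
  have hC0 : ∀ g, ‖g‖ ≤ |C| * ‖J g‖ := fun g => (hC g).trans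
    (mul_le_mul_of_nonneg_right (le_abs_self C) (norm_nonneg _))
  have hA : ∀ f, ‖A f‖ ≤ |C| * ‖K‖ * ‖f‖ := fun f => by
    refine (hC0 _).trans ?_
    rw [h, mul_assoc]
    exact mul_le_mul_of_nonneg_left (K.le_opNorm f) (abs_nonneg C)
  let eP : P →ₗ[ℂ] Completion P := (Completion.toComplₗᵢ (𝕜 := ℂ) (E := P)).toLinearMap
  let eQ : Q →ₗ[ℂ] Completion Q := (Completion.toComplₗᵢ (𝕜 := ℂ) (E := Q)).toLinearMap
  have hd : DenseRange eP := Completion.denseRange_coe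
  have hb : ∃ C, ∀ x, ‖(eQ ∘ₗ A) x‖ ≤ C * ‖eP x‖ := by
    refine ⟨|C| * ‖K‖, fun f => ?_⟩
    have h1 : ‖eP f‖ = ‖f‖ := Completion.norm_coe f
    have h2 : ‖(eQ ∘ₗ A) f‖ = ‖A f‖ := Completion.norm_coe (A f)
    rw [h1, h2]
    exact hA f
  set S := (eQ ∘ₗ A).extendOfNorm eP with hS
  have hSe : ∀ f : P, S (f : Completion P) = (A f : Completion Q) := fun f =>
    LinearMap.extendOfNorm_eq hd hb f
  refine ⟨S, ?_, hSe⟩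
  have hJ : IsUniformInducing J := by
    refine AntilipschitzWith.isUniformInducing (K := |C|.toNNReal)
      (AddMonoidHomClass.antilipschitz_of_bound J fun g => ?_) J.uniformContinuous
    rw [Real.coe_toNNReal _ (abs_nonneg C)]
    exact hC0 g
  have htb : TotallyBounded (A '' Metric.ball 0 1) := by
    have h1 : TotallyBounded (K '' Metric.ball 0 1) :=
      (hK.isCompact_closure_image_ball (f := K.toLinearMap) 1).totallyBounded.subset subset_closure
    refine (totallyBounded_preimage hJ h1).subset ?_
    rintro _ ⟨f, hf, rfl⟩
    exact ⟨f, hf, (h f).symm⟩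
  have htb' : TotallyBounded ((fun g : Q => (g : Completion Q)) '' (A '' Metric.ball 0 1)) :=
    htb.image (Completion.uniformContinuous_coe Q)
  -- The unit ball of the completion is open, so it lies in the closure of its dense part coming
  -- from P.
  have hsub : S '' Metric.ball 0 1 ⊆
      closure ((fun g : Q => (g : Completion Q)) '' (A '' Metric.ball 0 1)) := by
    have h1 := Dense.open_subset_closure_inter (s := Set.range eP) hd
      (Metric.isOpen_ball (x := 0) (ε := 1))
    rintro _ ⟨x, hx, rfl⟩
    refine closure_mono ?_ (image_closure_subset_closure_image S.continuous ⟨x, h1 hx, rfl⟩)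
    rintro _ ⟨_, ⟨hy, ⟨f, rfl⟩⟩, rfl⟩
    have hf : f ∈ Metric.ball (0 : P) 1 := by
      have h2 : ‖eP f‖ = ‖f‖ := Completion.norm_coe f
      rw [mem_ball_zero_iff, h2] at hy
      rwa [mem_ball_zero_iff]
    exact ⟨A f, ⟨f, hf, rfl⟩, (hSe f).symm⟩
  refine (isCompactOperator_iff_isCompact_closure_image_ball (f := S.toLinearMap) one_pos).2 ?_
  exact isCompact_iff_totallyBounded_isComplete.2
    ⟨(htb'.closure.subset hsub).closure, isClosed_closure.isComplete⟩

theorem IsCompactOperator.sum_clm {ι P R : Type*} [SeminormedAddCommGroup P] [NormedSpace ℂ P]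
    [NormedAddCommGroup R] [NormedSpace ℂ R] (s : Finset ι) {K : ι → P →L[ℂ] R}
    (h : ∀ i ∈ s, IsCompactOperator (K i)) : IsCompactOperator (∑ i ∈ s, K i : P →L[ℂ] R) := by
  classical
  induction s using Finset.induction_on with
  | empty => exact isCompactOperator_zero
  | insert i s hi ih =>
    rw [Finset.sum_insert hi]
    exact (h i (by simp)).add (ih fun j hj => h j (by simp [hj]))

theorem exists_isCompactOperator_pi {ι P : Type*} [Fintype ι] [DecidableEq ι] {R : ι → Type*}
    [SeminormedAddCommGroup P] [NormedSpace ℂ P] [∀ i, NormedAddCommGroup (R i)]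
    [∀ i, NormedSpace ℂ (R i)] {K : ∀ i, P →L[ℂ] R i} (h : ∀ i, IsCompactOperator (K i)) :
    IsCompactOperator (ContinuousLinearMap.pi K) := by
  have he : ContinuousLinearMap.pi K =
      ∑ i, (ContinuousLinearMap.single ℂ R i).comp (K i) := by
    refine ContinuousLinearMap.ext fun f => funext fun j => ?_
    rw [sum_apply, Finset.sum_apply]
    simp only [ContinuousLinearMap.pi_apply, ContinuousLinearMap.comp_apply,
      ContinuousLinearMap.single_apply]
    rw [Finset.sum_eq_single j (fun i _ hij => Pi.single_eq_of_ne hij.symm _) (by simp),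
      Pi.single_eq_same]
  rw [he]
  exact IsCompactOperator.sum_clm _ fun i _ => (h i).clm_comp (ContinuousLinearMap.single ℂ R i)

end CompactExtension

/-! ### Linearity of the operators on `L²(ℝᵏ)` -/

section LinearL2

variable {k : ℕ}

theorem fourierL2_smul_add (c : ℂ) (f g : L2 k) :
    fourierL2 (c • f + g) = c • fourierL2 f + fourierL2 g := by
  have hne : (2 * Real.pi)⁻¹ ≠ 0 := by positivity
  have hq : Measure.QuasiMeasurePreserving
      (fun y : EuclideanSpace ℝ (Fin k) => (2 * Real.pi)⁻¹ • y) volume volume := by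
    refine ⟨measurable_const_smul _, ?_⟩
    rw [Measure.map_addHaar_smul volume hne]
    exact Measure.smul_absolutelyContinuous
  have e : (𝓕⁻ (c • f + g) : L2 k) = c • 𝓕⁻ f + 𝓕⁻ g :=
    ((Lp.fourierTransformₗᵢ _ ℂ).symm.map_add (c • f) g).trans
      (congrArg (· + 𝓕⁻ g) ((Lp.fourierTransformₗᵢ _ ℂ).symm.map_smul c f))
  have h1 := hq.ae_eq_comp (Lp.coeFn_add (c • 𝓕⁻ f : L2 k) (𝓕⁻ g))
  have h1' := hq.ae_eq_comp (Lp.coeFn_smul c (𝓕⁻ f : L2 k))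
  apply Lp.ext
  filter_upwards [(memLp_fourier_dilation f).coeFn_toLp, (memLp_fourier_dilation g).coeFn_toLp,
    (memLp_fourier_dilation (c • f + g)).coeFn_toLp, h1, h1',
    Lp.coeFn_add (c • fourierL2 f) (fourierL2 g), Lp.coeFn_smul c (fourierL2 f)]
    with y h2 h3 h4 h5 h5' h6 h7
  rw [h6, Pi.add_apply, h7, Pi.smul_apply, fourierL2, fourierL2, fourierL2, h2, h3, h4, e]
  simp only [Function.comp_apply, Pi.add_apply, Pi.smul_apply] at h5 h5'
  rw [h5, h5', smul_eq_mul, smul_eq_mul]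
  ring

theorem mulL2_smul_add {h : EuclideanSpace ℝ (Fin k) → ℂ} (hm : AEStronglyMeasurable h volume)
    {C : ℝ} (hC : ∀ x, ‖h x‖ ≤ C) (c : ℂ) (f g : L2 k) :
    mulL2 h (c • f + g) = c • mulL2 h f + mulL2 h g := by
  apply Lp.ext
  filter_upwards [mulL2_ae_eq hm hC f, mulL2_ae_eq hm hC g, mulL2_ae_eq hm hC (c • f + g),
    Lp.coeFn_add (c • f) g, Lp.coeFn_smul c f, Lp.coeFn_add (c • mulL2 h f) (mulL2 h g),
    Lp.coeFn_smul c (mulL2 h f)] with y h1 h2 h3 h4 h5 h6 h7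
  rw [h3, h6, h4, Pi.add_apply, Pi.add_apply, h5, h7, Pi.smul_apply, Pi.smul_apply, h1, h2,
    smul_eq_mul, smul_eq_mul]
  ring

theorem map_sum_of_smul_add {E F ι : Type*} [AddCommGroup E] [Module ℂ E] [AddCommGroup F]
    [Module ℂ F] {G : E → F} (hG : ∀ (c : ℂ) f g, G (c • f + g) = c • G f + G g) (s : Finset ι)
    (c : ι → ℂ) (f : ι → E) : G (∑ i ∈ s, c i • f i) = ∑ i ∈ s, c i • G (f i) := by
  classical
  induction s using Finset.induction_on with
  | empty =>
    -- The choice c = -1 gives G 0 = 0.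
    have := hG (-1) 0 0
    simp only [smul_zero, add_zero, neg_smul, one_smul, neg_add_cancel] at this
    simpa using this
  | insert i s hi ih => rw [Finset.sum_insert hi, Finset.sum_insert hi, hG, ih]

end LinearL2

/-! ### Jets of functions and compact operators -/

section Jets

variable {X α : Type} [Fintype α] {k : ℕ} {V : Submodule ℂ (X → ℂ)} {D : α → (X → ℂ) → (X → ℂ)}
  {ρ : EuclideanSpace ℝ (Fin k) → X}

/-- An algebra `V` of functions with operators `D a` which satisfy a Leibniz rule; the functions
`D a f` are considered along `ρ`, where they decay rapidly. -/
structure JetSystem (V : Submodule ℂ (X → ℂ)) (D : α → (X → ℂ) → (X → ℂ))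
    (ρ : EuclideanSpace ℝ (Fin k) → X) : Prop where
  lin : ∀ a, LinearOnSub V (D a)
  decay : ∀ f ∈ V, RapidDecay (fun x => f (ρ x))
  mul_mem : ∀ f ∈ V, ∀ g ∈ V, (fun M => f M * g M) ∈ V
  leibniz : ∀ a, ∃ w : α × α → ℂ, ∀ f ∈ V, ∀ g ∈ V, ∀ x,
    D a (fun M => f M * g M) (ρ x) = ∑ y, w y * (D y.1 f (ρ x) * D y.2 g (ρ x))

theorem coeFn_sum_smul {ι : Type*} (s : Finset ι) {p : ℝ≥0∞} (c : ι → ℂ)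
    (u : ι → Lp ℂ p (volume : Measure (EuclideanSpace ℝ (Fin k)))) :
    (∑ i ∈ s, c i • u i : Lp ℂ p (volume : Measure (EuclideanSpace ℝ (Fin k)))) =ᵐ[volume]
      fun x => ∑ i ∈ s, c i * u i x := by
  classical
  induction s using Finset.induction_on with
  | empty =>
    simp only [Finset.sum_empty]
    exact Lp.coeFn_zero _ _ _
  | insert i s hi ih =>
    rw [Finset.sum_insert hi]
    filter_upwards [Lp.coeFn_add (c i • u i) (∑ i ∈ s, c i • u i), Lp.coeFn_smul (c i) (u i), ih]
      with x h1 h2 h3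
    rw [h1, Pi.add_apply, h2, h3, Finset.sum_insert hi, Pi.smul_apply, smul_eq_mul]

namespace JetSystem

theorem memLp (H : JetSystem V D ρ) {p : ℝ≥0∞} (hp : 1 ≤ p) (a : α) {f : X → ℂ} (hf : f ∈ V) :
    MemLp (fun x => D a f (ρ x)) p volume :=
  (H.decay _ ((H.lin a).mem f hf)).memLp volume hp

/-- The function `D a f` along `ρ` as an element of `Lᵖ`. -/
noncomputable def jet (H : JetSystem V D ρ) (p : ℝ≥0∞) [hp : Fact (1 ≤ p)] (a : α) :
    V →ₗ[ℂ] Lp ℂ p (volume : Measure (EuclideanSpace ℝ (Fin k))) where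
  toFun f := (H.memLp hp.out a f.2).toLp
  map_add' f g := by
    rw [← MemLp.toLp_add]
    refine MemLp.toLp_congr _ _ (Filter.Eventually.of_forall fun x => ?_)
    exact congrFun ((H.lin a).add f f.2 g g.2) (ρ x)
  map_smul' c f := by
    rw [RingHom.id_apply, ← MemLp.toLp_const_smul]
    refine MemLp.toLp_congr _ _ (Filter.Eventually.of_forall fun x => ?_)
    exact congrFun ((H.lin a).smul c f f.2) (ρ x)

theorem jet_ae_eq (H : JetSystem V D ρ) (p : ℝ≥0∞) [hp : Fact (1 ≤ p)] (a : α) (f : V) :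
    H.jet p a f =ᵐ[volume] fun x => D a f.1 (ρ x) :=
  MemLp.coeFn_toLp (H.memLp hp.out a f.2)

theorem norm_jet (H : JetSystem V D ρ) (p : ℝ≥0∞) [hp : Fact (1 ≤ p)] (a : α) (f : V) :
    ‖H.jet p a f‖ = (eLpNorm (fun x => D a f.1 (ρ x)) p volume).toReal :=
  Lp.norm_toLp _ (H.memLp hp.out a f.2)

/-- The multiplication in `V`. -/
def mulV (H : JetSystem V D ρ) (f g : V) : V := ⟨fun M => f.1 M * g.1 M, H.mul_mem _ f.2 _ g.2⟩

/-- The jets of `U f` are linear combinations of the functions which `G` assigns to the jets of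
`f`. -/
def Intertwines (H : JetSystem V D ρ) (U : V → V) (G : L2 k → L2 k) : Prop :=
  ∀ a, ∃ c : α → ℂ, ∀ f, H.jet 2 a (U f) = ∑ b, c b • G (H.jet 2 b f)

theorem Intertwines.comp {H : JetSystem V D ρ} {U U' : V → V} {G G' : L2 k → L2 k}
    (h : H.Intertwines U G) (h' : H.Intertwines U' G')
    (hG : ∀ (c : ℂ) u v, G (c • u + v) = c • G u + G v) :
    H.Intertwines (fun f => U (U' f)) (fun u => G (G' u)) := by
  intro a
  obtain ⟨c, hc⟩ := h a
  choose c' hc' using h'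
  refine ⟨fun e => ∑ b, c b * c' b e, fun f => ?_⟩
  rw [hc]
  simp_rw [hc', map_sum_of_smul_add hG, Finset.smul_sum, Finset.sum_smul, smul_smul]
  exact Finset.sum_comm

theorem Intertwines.iterate {H : JetSystem V D ρ} {U : V → V} {G : L2 k → L2 k}
    (h : H.Intertwines U G) (hG : ∀ (c : ℂ) u v, G (c • u + v) = c • G u + G v) (N : ℕ) :
    H.Intertwines U^[N + 1] G^[N + 1] := by
  induction N with
  | zero => exact h
  | succ N ih =>
    rw [Function.iterate_succ' U, Function.iterate_succ' G]
    exact h.comp ih hG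

theorem iterate_smul_add {E : Type*} [AddCommGroup E] [Module ℂ E] {G : E → E}
    (hG : ∀ (c : ℂ) u v, G (c • u + v) = c • G u + G v) (N : ℕ) (c : ℂ) (u v : E) :
    G^[N] (c • u + v) = c • G^[N] u + G^[N] v := by
  induction N with
  | zero => rfl
  | succ N ih => rw [Function.iterate_succ_apply', ih, hG, Function.iterate_succ_apply',
      Function.iterate_succ_apply']

theorem intertwines_fourierL2 (H : JetSystem V D ρ) {T : V → V}
    (hT : ∀ a, ∃ (b : α) (c : ℂ), ∀ (f : V) (y : EuclideanSpace ℝ (Fin k)),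
      D a (T f).1 (ρ y) =
        c * ∫ x, Complex.exp (Complex.I * (inner ℝ y x : ℝ)) * D b f.1 (ρ x)) :
    H.Intertwines T fourierL2 := by
  classical
  intro a
  obtain ⟨b, c, h⟩ := hT a
  set s : ℂ := (((2 * Real.pi) ^ (-(k : ℝ) / 2) : ℝ) : ℂ) with hs
  have hs0 : s ≠ 0 := Complex.ofReal_ne_zero.2 (by positivity)
  -- Only the jet b contributes; s⁻¹ removes the unitary normalization of ℱ.
  refine ⟨fun e => if e = b then c * s⁻¹ else 0, fun f => ?_⟩
  simp only [ite_smul, zero_smul, Finset.sum_ite_eq', Finset.mem_univ, if_true]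
  have hint : Integrable (H.jet 2 b f) volume :=
    (memLp_one_iff_integrable.1 (H.memLp le_rfl b f.2)).congr (H.jet_ae_eq 2 b f).symm
  apply Lp.ext
  filter_upwards [H.jet_ae_eq 2 a (T f), fourierL2_ae_eq _ hint,
    Lp.coeFn_smul (c * s⁻¹) (fourierL2 (H.jet 2 b f))] with y h1 h2 h3
  rw [h1, h3, Pi.smul_apply, h2, h, smul_eq_mul, ← hs, mul_assoc, inv_mul_cancel_left₀ hs0]
  congr 1
  refine integral_congr_ae ?_
  filter_upwards [H.jet_ae_eq 2 b f] with x hx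
  rw [hx]

theorem intertwines_phase (H : JetSystem V D ρ) {Z : V → V} {E : SymMat k}
    (hZ : ∀ a, ∃ c : α → ℂ, ∀ (f : V) (x : EuclideanSpace ℝ (Fin k)),
      D a (Z f).1 (ρ x) = ∑ b, c b * (phase E x * D b f.1 (ρ x))) :
    H.Intertwines Z (mulL2 (phase E)) := by
  intro a
  obtain ⟨c, h⟩ := hZ a
  refine ⟨c, fun f => ?_⟩
  have hm : ∀ b, mulL2 (phase E) (H.jet 2 b f) =ᵐ[volume] fun x => phase E x * H.jet 2 b f x :=
    fun b => mulL2_ae_eq (continuous_phase E).aestronglyMeasurable (fun x => (norm_phase E x).le) _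
  apply Lp.ext
  filter_upwards [H.jet_ae_eq 2 a (Z f), coeFn_sum_smul Finset.univ c
    (fun b => mulL2 (phase E) (H.jet 2 b f)), eventually_countable_forall.2 hm,
    eventually_countable_forall.2 fun b => H.jet_ae_eq 2 b f] with x h1 h2 h3 h4
  rw [h1, h2, h]
  exact Finset.sum_congr rfl fun b _ => by rw [h3, h4]

theorem jet_mulV (H : JetSystem V D ρ) (a : α) : ∃ w : α × α → ℂ, ∀ f g : V,
    H.jet 2 a (H.mulV f g) =
      ∑ y, w y • mulL2 (fun x => D y.1 f.1 (ρ x)) (H.jet 2 y.2 g) := by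
  obtain ⟨w, hw⟩ := H.leibniz a
  refine ⟨w, fun f g => ?_⟩
  have hm : ∀ y : α × α, mulL2 (fun x => D y.1 f.1 (ρ x)) (H.jet 2 y.2 g) =ᵐ[volume]
      fun x => D y.1 f.1 (ρ x) * H.jet 2 y.2 g x := fun y => by
    have hd := H.decay _ ((H.lin y.1).mem f.1 f.2)
    obtain ⟨C, hC⟩ := hd.bounded
    exact mulL2_ae_eq hd.cont.aestronglyMeasurable hC _
  apply Lp.ext
  filter_upwards [H.jet_ae_eq 2 a (H.mulV f g), coeFn_sum_smul Finset.univ w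
    (fun y => mulL2 (fun x => D y.1 f.1 (ρ x)) (H.jet 2 y.2 g)), eventually_countable_forall.2 hm,
    eventually_countable_forall.2 fun b => H.jet_ae_eq 2 b g] with x h1 h2 h3 h4
  rw [h1, h2]
  refine (hw f.1 f.2 g.1 g.2 x).trans (Finset.sum_congr rfl fun y _ => ?_)
  rw [h3, h4]

/-- Applying the Leibniz rule to both multiplications, with the intertwining relation in between,
writes each jet of the result as a finite sum of sandwiched operators. These start from L², so only
L² jets of f are involved, while p is the exponent of the target. -/
theorem exists_sandwich (H : JetSystem V D ρ) {U : V → V} {G : L2 k → L2 k}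
    (hU : H.Intertwines U G) (hG : ∀ (c : ℂ) u v, G (c • u + v) = c • G u + G v)
    (p : ℝ≥0∞) [Fact (1 ≤ p)] (hS : ∀ h₁ h₂ : EuclideanSpace ℝ (Fin k) → ℂ, RapidDecay h₁ →
      RapidDecay h₂ → IsCompactSandwich h₁ G h₂ p) (f₁ f₂ : V) (a : α) :
    ∃ (ι : Type) (_ : Fintype ι) (K : ι → L2 k →L[ℂ]
      Lp ℂ p (volume : Measure (EuclideanSpace ℝ (Fin k)))) (e : ι → α),
      (∀ i, IsCompactOperator (K i)) ∧ ∀ f : V,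
        H.jet p a (H.mulV f₁ (U (H.mulV f₂ f))) = ∑ i, K i (H.jet 2 (e i) f) := by
  obtain ⟨w, hw⟩ := H.leibniz a
  choose c hc using hU
  choose w' hw' using H.jet_mulV
  choose S hSc hS using fun y z : α => hS _ _ (H.decay _ ((H.lin y).mem f₁.1 f₁.2))
    (H.decay _ ((H.lin z).mem f₂.1 f₂.2))
  -- An index consists of the Leibniz pair of the outer multiplication, the jet at which the
  -- intertwiner takes over, and the Leibniz pair of the inner multiplication.
  refine ⟨(α × α) × α × α × α, inferInstance,
    fun i => (w i.1 * (c i.1.2 i.2.1 * w' i.2.1 i.2.2)) • S i.1.1 i.2.2.1, fun i => i.2.2.2,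
    fun i => (hSc i.1.1 i.2.2.1).smul (w i.1 * (c i.1.2 i.2.1 * w' i.2.1 i.2.2)), fun f => ?_⟩
  have h2 : ∀ y, H.jet 2 y (U (H.mulV f₂ f)) = ∑ j : α × α × α, (c y j.1 * w' j.1 j.2) •
      G (mulL2 (fun x => D j.2.1 f₂.1 (ρ x)) (H.jet 2 j.2.2 f)) := fun y => by
    rw [hc, Fintype.sum_prod_type]
    refine Finset.sum_congr rfl fun b _ => ?_
    rw [hw', map_sum_of_smul_add hG, Finset.smul_sum]
    exact Finset.sum_congr rfl fun z _ => smul_smul _ _ _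
  apply Lp.ext
  simp only [smul_apply]
  filter_upwards [H.jet_ae_eq p a (H.mulV f₁ (U (H.mulV f₂ f))),
    coeFn_sum_smul Finset.univ (fun i : (α × α) × α × α × α =>
      w i.1 * (c i.1.2 i.2.1 * w' i.2.1 i.2.2))
      (fun i => S i.1.1 i.2.2.1 (H.jet 2 i.2.2.2 f)),
    eventually_countable_forall.2 fun i : α × α × α => hS i.1 i.2.1 (H.jet 2 i.2.2 f),
    eventually_countable_forall.2 fun y => H.jet_ae_eq 2 y (U (H.mulV f₂ f)),
    eventually_countable_forall.2 fun y => coeFn_sum_smul Finset.univ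
      (fun j : α × α × α => c y j.1 * w' j.1 j.2)
      (fun j => G (mulL2 (fun x => D j.2.1 f₂.1 (ρ x)) (H.jet 2 j.2.2 f)))]
    with x e1 e2 e3 e4 e5
  rw [e1, e2, Fintype.sum_prod_type]
  refine (hw f₁.1 f₁.2 _ (U (H.mulV f₂ f)).2 x).trans (Finset.sum_congr rfl fun y _ => ?_)
  rw [← e4, h2, e5, Finset.mul_sum, Finset.mul_sum]
  refine Finset.sum_congr rfl fun j _ => ?_
  rw [e3 (y.1, j.2)]
  ring

/-- Here J collects all jets in all target exponents. The bounds `hP` and `hQ` make the jets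
continuous on source and target, and `hC` says that together they bound the target norm. -/
theorem exists_compact_extension (H : JetSystem V D ρ) {U : V → V} {G : L2 k → L2 k}
    (hU : H.Intertwines U G) (hUl : ∀ (c : ℂ) f g, U (c • f + g) = c • U f + U g)
    (hG : ∀ (c : ℂ) u v, G (c • u + v) = c • G u + G v)
    (hS : ∀ (p : ℝ≥0∞) [Fact (1 ≤ p)] (h₁ h₂ : EuclideanSpace ℝ (Fin k) → ℂ), RapidDecay h₁ →
      RapidDecay h₂ → IsCompactSandwich h₁ G h₂ p) (f₁ f₂ : V)
    {P Q : Type} [SeminormedAddCommGroup P] [NormedSpace ℂ P] [SeminormedAddCommGroup Q]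
    [NormedSpace ℂ Q] (eP : P ≃ₗ[ℂ] V) (eQ : Q ≃ₗ[ℂ] V)
    (hP : ∀ a f, ‖H.jet 2 a (eP f)‖ ≤ ‖f‖) {κ : Type} [Fintype κ] (r : κ → ℝ≥0∞)
    [∀ j, Fact (1 ≤ r j)] (hQ : ∀ j a g, ‖H.jet (r j) a (eQ g)‖ ≤ ‖g‖) (C : ℝ)
    (hC : ∀ g M, (∀ j a, ‖H.jet (r j) a (eQ g)‖ ≤ M) → ‖g‖ ≤ C * M) :
    ∃ S : UniformSpace.Completion P →L[ℂ] UniformSpace.Completion Q, IsCompactOperator S ∧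
      ∀ f : P, S (f : UniformSpace.Completion P) =
        (eQ.symm (H.mulV f₁ (U (H.mulV f₂ (eP f)))) : UniformSpace.Completion Q) := by
  classical
  have hmul : ∀ (h : V) (c : ℂ) (f g : V), H.mulV h (c • f + g) = c • H.mulV h f + H.mulV h g :=
    fun h c f g => Subtype.ext (funext fun M => by
      simp only [mulV, Submodule.coe_add, Submodule.coe_smul, Pi.add_apply, Pi.smul_apply,
        smul_eq_mul]
      ring)
  have hlin : ∀ (c : ℂ) (f g : P), eQ.symm (H.mulV f₁ (U (H.mulV f₂ (eP (c • f + g))))) =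
      c • eQ.symm (H.mulV f₁ (U (H.mulV f₂ (eP f)))) +
        eQ.symm (H.mulV f₁ (U (H.mulV f₂ (eP g)))) := fun c f g => by
    rw [map_add, map_smul, hmul, hUl, hmul, map_add, map_smul]
  let A : P →ₗ[ℂ] Q :=
    { toFun := fun f => eQ.symm (H.mulV f₁ (U (H.mulV f₂ (eP f))))
      map_add' := fun f g => by simpa using hlin 1 f g
      map_smul' := fun c f => by
        have h0 := hlin (-1) 0 0
        have h1 := hlin c f 0
        simp only [neg_smul, one_smul, add_zero, neg_zero, neg_add_cancel] at h0
        rw [h0, add_zero, add_zero] at h1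
        exact h1 }
  let J : ∀ i : κ × α, Q →L[ℂ] Lp ℂ (r i.1) (volume : Measure (EuclideanSpace ℝ (Fin k))) :=
    fun i => ((H.jet (r i.1) i.2) ∘ₗ eQ.toLinearMap).mkContinuous 1 fun g => by
      rw [one_mul]
      exact hQ i.1 i.2 g
  let j₂ : α → P →L[ℂ] L2 k := fun a => ((H.jet 2 a) ∘ₗ eP.toLinearMap).mkContinuous 1 fun f => by
    rw [one_mul]
    exact hP a f
  choose ι hι K e hK hKe using fun i : κ × α => H.exists_sandwich hU hG (r i.1) (hS (r i.1)) f₁ f₂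
    i.2
  have hcomp : IsCompactOperator (ContinuousLinearMap.pi fun i : κ × α =>
      ∑ s, (K i s).comp (j₂ (e i s))) :=
    exists_isCompactOperator_pi fun i => IsCompactOperator.sum_clm _ fun s _ =>
      (hK i s).comp_clm (j₂ (e i s))
  refine _root_.exists_compact_extension A (ContinuousLinearMap.pi J) (C := C) (fun g => ?_) _
    hcomp fun f => ?_
  · exact hC g _ fun j a => norm_le_pi_norm (ContinuousLinearMap.pi J g) (j, a)
  · funext i
    rw [ContinuousLinearMap.pi_apply, ContinuousLinearMap.pi_apply, sum_apply]
    have : J i (A f) = H.jet (r i.1) i.2 (H.mulV f₁ (U (H.mulV f₂ (eP f)))) :=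
      congrArg (H.jet (r i.1) i.2) (eQ.apply_symm_apply _)
    rw [this, hKe]
    rfl

end JetSystem

end Jets

/-! ### Block diagonal phases -/

section BlockPhase

variable {m k : ℕ} {Λ : Type*} [DecidableEq Λ]

/-- The block diagonal matrix with the blocks `ε l • B`. -/
noncomputable def blockPhase (e : Fin k ≃ Fin m × Λ) (ε : Λ → ℝ) (B : SymMat m) : SymMat k :=
  ⟨Matrix.of fun x y => if (e x).2 = (e y).2 then ε (e x).2 * B.1 (e x).1 (e y).1 else 0, by
    have hB : B.1.IsSymm := B.2
    change Matrix.IsSymm _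
    ext x y
    simp only [Matrix.transpose_apply, Matrix.of_apply]
    by_cases h : (e x).2 = (e y).2
    · rw [if_pos h, if_pos h.symm, h, hB.apply]
    · rw [if_neg h, if_neg (Ne.symm h)]⟩

theorem sum_blockPhase_mul [Fintype Λ] (e : Fin k ≃ Fin m × Λ) (ε : Λ → ℝ) (B : SymMat m)
    (x : Fin k) (v : Fin k → ℝ) : ∑ y, (blockPhase e ε B).1 x y * v y =
      ε (e x).2 * ∑ j, B.1 (e x).1 j * v (e.symm (j, (e x).2)) := by
  rw [← e.symm.sum_comp, Fintype.sum_prod_type, Finset.mul_sum]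
  refine Finset.sum_congr rfl fun j _ => ?_
  simp [blockPhase, ite_mul, mul_assoc]

theorem phase_blockPhase [Fintype Λ] (e : Fin k ≃ Fin m × Λ) (ε : Λ → ℝ) (B : SymMat m)
    (x : EuclideanSpace ℝ (Fin k)) : phase (blockPhase e ε B) x =
      Complex.exp (Complex.I / 2 * ((∑ l, ε l * ∑ i, ∑ j,
        x (e.symm (i, l)) * B.1 i j * x (e.symm (j, l)) : ℝ) : ℂ)) := by
  rw [phase]
  congr 3
  simp only [mul_assoc, ← Finset.mul_sum]
  simp only [sum_blockPhase_mul]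
  rw [← e.symm.sum_comp, Fintype.sum_prod_type_right]
  refine Finset.sum_congr rfl fun l _ => ?_
  rw [Finset.mul_sum]
  refine Finset.sum_congr rfl fun i _ => ?_
  simp only [Equiv.apply_symm_apply]
  ring

/-- The recursion decouples into blocks. In a block with sign ε the substitution z_i = ε^i y_i turns
the recursion of εB into that of B because ε² = 1; in particular B and -B are nondegenerate
together. -/
theorem blockPhase_mem_nondegSet [Fintype Λ] (e : Fin k ≃ Fin m × Λ) {ε : Λ → ℝ}
    (hε : ∀ l, ε l * ε l = 1) {B : SymMat m} {L : ℕ} (hB : B ∈ nondegSet m L) :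
    blockPhase e ε B ∈ nondegSet k L := by
  intro N h1 hN
  have hBN := (isUnit_blockTridiag_iff B N).1 (hB N h1 hN)
  refine (isUnit_blockTridiag_iff _ N).2 fun y hy i hi => ?_
  have key : ∀ l, ∀ i < N, (fun j => ε l ^ i * y i (e.symm (j, l))) = 0 := by
    intro l
    refine hBN (fun i j => ε l ^ i * y i (e.symm (j, l))) fun i hi => ?_
    funext j
    have h := congrFun (hy i hi) (e.symm (j, l))
    have hs : ((blockPhase e ε B).1.mulVec (y i)) (e.symm (j, l)) =
        ε l * ∑ j', B.1 j j' * y i (e.symm (j', l)) := by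
      refine (sum_blockPhase_mul e ε B _ _).trans ?_
      simp only [Equiv.apply_symm_apply]
    rw [hs] at h
    have h2 : (B.1.mulVec fun j => ε l ^ i * y i (e.symm (j, l))) j =
        ε l ^ (i + 1) * (ε l * ∑ j', B.1 j j' * y i (e.symm (j', l))) := by
      simp only [Matrix.mulVec, dotProduct]
      rw [pow_succ, mul_assoc, ← mul_assoc (ε l) (ε l), hε, one_mul, Finset.mul_sum]
      exact Finset.sum_congr rfl fun j' _ => by ring
    rw [h2, h]
    simp only [Pi.add_apply, mul_add]
    congr 1
    · split_ifs <;> simp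
    · rcases i with _ | i
      · simp
      · simp only [Nat.succ_pos, if_true, Nat.add_sub_cancel]
        rw [pow_succ, pow_succ, mul_assoc (ε l ^ i), hε, mul_one]
  funext x
  have h := congrFun (key (e x).2 i hi) (e x).1
  simp only [Prod.mk.eta, Equiv.symm_apply_apply, Pi.zero_apply, mul_eq_zero] at h
  refine h.resolve_left (pow_ne_zero _ fun h0 => ?_)
  have := hε (e x).2
  rw [h0, mul_zero] at this
  exact zero_ne_one this

end BlockPhase

/-! ### Weighted norms of jets -/

section JetNorm

theorem le_sqrt_sum {ι : Type*} [Fintype ι] {w : ι → ℝ} (x : ι → ℝ) (hw : ∀ i, 1 ≤ w i)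
    (i : ι) : x i ≤ Real.sqrt (∑ i, w i * x i ^ 2) := by
  have hw0 : ∀ i, 0 ≤ w i := fun i => zero_le_one.trans (hw i)
  refine Real.le_sqrt_of_sq_le (le_trans ?_ (Finset.single_le_sum
    (f := fun i => w i * x i ^ 2) (fun i _ => mul_nonneg (hw0 i) (sq_nonneg _))
    (Finset.mem_univ i)))
  nlinarith [hw i, sq_nonneg (x i)]

theorem sqrt_sum_le {ι : Type*} [Fintype ι] {w x : ι → ℝ} {M : ℝ} (hw : ∀ i, 1 ≤ w i)
    (hx : ∀ i, 0 ≤ x i) (hM : 0 ≤ M) (h : ∀ i, x i ≤ M) :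
    Real.sqrt (∑ i, w i * x i ^ 2) ≤ Real.sqrt (∑ i, w i) * M := by
  have hw0 : ∀ i, 0 ≤ w i := fun i => zero_le_one.trans (hw i)
  rw [← Real.sqrt_sq hM, ← Real.sqrt_mul (Finset.sum_nonneg fun i _ => hw0 i), Finset.sum_mul]
  refine Real.sqrt_le_sqrt (Finset.sum_le_sum fun i _ => mul_le_mul_of_nonneg_left ?_ (hw0 i))
  exact pow_le_pow_left₀ (hx i) (h i) 2

/-- The weighted norm of the jets of `f`. -/
noncomputable def JetSystem.jetNorm {X α : Type} [Fintype α] {k : ℕ} {V : Submodule ℂ (X → ℂ)}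
    {D : α → (X → ℂ) → (X → ℂ)} {ρ : EuclideanSpace ℝ (Fin k) → X} (H : JetSystem V D ρ)
    (w : α → ℝ) (p : ℝ≥0∞) [Fact (1 ≤ p)] (f : V) : ℝ :=
  Real.sqrt (∑ a, w a * ‖H.jet p a f‖ ^ 2)

theorem JetSystem.exists_compact_extension_jetNorm {X α : Type} [Fintype α] {k : ℕ}
    {V : Submodule ℂ (X → ℂ)} {D : α → (X → ℂ) → (X → ℂ)} {ρ : EuclideanSpace ℝ (Fin k) → X}
    (H : JetSystem V D ρ) {U : V → V} {G : L2 k → L2 k}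
    (hU : H.Intertwines U G) (hUl : ∀ (c : ℂ) f g, U (c • f + g) = c • U f + U g)
    (hG : ∀ (c : ℂ) u v, G (c • u + v) = c • G u + G v)
    (hS : ∀ (p : ℝ≥0∞) [Fact (1 ≤ p)] (h₁ h₂ : EuclideanSpace ℝ (Fin k) → ℂ), RapidDecay h₁ →
      RapidDecay h₂ → IsCompactSandwich h₁ G h₂ p) (f₁ f₂ : V)
    {P Q : Type} [SeminormedAddCommGroup P] [NormedSpace ℂ P] [SeminormedAddCommGroup Q]
    [NormedSpace ℂ Q] (eP : P ≃ₗ[ℂ] V) (eQ : Q ≃ₗ[ℂ] V) {w : α → ℝ} (hw : ∀ a, 1 ≤ w a)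
    (p q : ℝ≥0∞) [Fact (1 ≤ p)] [Fact (1 ≤ q)]
    (hP : ∀ f, ‖f‖ = H.jetNorm w 2 (eP f) + H.jetNorm w p (eP f))
    (hQ : ∀ g, ‖g‖ = H.jetNorm w 2 (eQ g) + H.jetNorm w q (eQ g)) :
    ∃ S : UniformSpace.Completion P →L[ℂ] UniformSpace.Completion Q, IsCompactOperator S ∧
      ∀ f : P, S (f : UniformSpace.Completion P) =
        (eQ.symm (H.mulV f₁ (U (H.mulV f₂ (eP f)))) : UniformSpace.Completion Q) := by
  -- The index `false` stands for L² and `true` for the exponent q; the constant below has a factor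
  -- 2 because the target norm is the sum of both parts.
  have hr : ∀ j : Bool, Fact (1 ≤ cond j q 2) := by
    rintro (_ | _) <;> simp only [cond_true, cond_false] <;> infer_instance
  have hle : ∀ (r : ℝ≥0∞) [Fact (1 ≤ r)] (f : V) (a : α), ‖H.jet r a f‖ ≤ H.jetNorm w r f :=
    fun r _ f a => le_sqrt_sum (fun a => ‖H.jet r a f‖) hw a
  have h0 : ∀ (r : ℝ≥0∞) [Fact (1 ≤ r)] (f : V), 0 ≤ H.jetNorm w r f :=
    fun r _ f => Real.sqrt_nonneg _
  refine H.exists_compact_extension hU hUl hG hS f₁ f₂ eP eQ (fun a f => ?_)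
    (fun j : Bool => cond j q 2) (fun j a g => ?_) (2 * Real.sqrt (∑ a, w a)) fun g M hM => ?_
  · rw [hP]
    exact (hle 2 _ a).trans (le_add_of_nonneg_right (h0 p _))
  · rw [hQ]
    cases j
    · exact (hle 2 _ a).trans (le_add_of_nonneg_right (h0 q _))
    · exact (hle q _ a).trans (le_add_of_nonneg_left (h0 2 _))
  · rw [hQ]
    -- That M is nonnegative follows only from the presence of some jet; without jets the norm is 0.
    rcases isEmpty_or_nonempty α with hα | ⟨⟨a⟩⟩
    · simp [JetSystem.jetNorm]
    · have hM0 : 0 ≤ M := (norm_nonneg _).trans (hM true a)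
      have h2 : H.jetNorm w 2 (eQ g) ≤ Real.sqrt (∑ a, w a) * M :=
        sqrt_sum_le hw (fun _ => norm_nonneg _) hM0 fun a => hM false a
      have hq : H.jetNorm w q (eQ g) ≤ Real.sqrt (∑ a, w a) * M :=
        sqrt_sum_le hw (fun _ => norm_nonneg _) hM0 fun a => hM true a
      linarith

end JetNorm

/-! ### Compact operators on the spaces `ℋ_p` -/

section SpaceH

variable {m : ℕ}

/-- An enumeration of the coordinates of `ℝ^{m × 2n}`. -/
noncomputable def phiIndex (m : ℕ) :
    Fin (Fintype.card (Fin m × Fin (2 * halfDim m))) ≃ Fin m × Fin (2 * halfDim m) :=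
  (Fintype.equivFin _).symm

/-- The identification of `ℝ^{2mn}` with `ℝ^{m × 2n}`. -/
noncomputable def phiEquiv (m : ℕ) :
    EuclideanSpace ℝ (Fin (Fintype.card (Fin m × Fin (2 * halfDim m)))) ≃ₗᵢ[ℝ] PhiSpace m :=
  LinearIsometryEquiv.piLpCongrLeft 2 ℝ ℝ (phiIndex m)

theorem phiEquiv_apply (x : EuclideanSpace ℝ (Fin (Fintype.card (Fin m × Fin (2 * halfDim m)))))
    (i : Fin m × Fin (2 * halfDim m)) : phiEquiv m x i = x ((phiIndex m).symm i) := by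
  simp [phiEquiv, LinearIsometryEquiv.piLpCongrLeft_apply, Equiv.piCongrLeft'_apply]

theorem jetSystem_PE (m : ℕ) : JetSystem (PE m) (multiDeriv (m := m))
    (fun x => gram (phiEquiv m x)) where
  lin := linearOnSub_multiDeriv
  decay f hf := by
    have h := rapidDecay_PE f hf
    refine ⟨h.cont.comp (phiEquiv m).continuous, fun N => ?_⟩
    obtain ⟨C, hC⟩ := h.decay N
    refine ⟨C, fun x => ?_⟩
    have := hC (phiEquiv m x)
    rwa [LinearIsometryEquiv.norm_map] at this
  mul_mem f hf g hg := PE_mul_mem hf hg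
  leibniz a := by
    obtain ⟨w, hw⟩ := exists_multiDeriv_mul a
    exact ⟨w, fun f hf g hg x => hw f hf g hg _⟩

theorem inner_eq_pairing
    (y x : EuclideanSpace ℝ (Fin (Fintype.card (Fin m × Fin (2 * halfDim m))))) :
    inner ℝ y x = pairing (phiEquiv m y) (phiEquiv m x) := by
  rw [← (phiEquiv m).inner_map_map, PiLp.inner_apply, pairing]
  exact Finset.sum_congr rfl fun i _ => by simp [mul_comm]

theorem intertwines_susyT (m : ℕ) : (jetSystem_PE m).Intertwines susyT fourierL2 := by
  refine (jetSystem_PE m).intertwines_fourierL2 fun a => ?_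
  obtain ⟨b, c, h⟩ := exists_multiDeriv_susyT a
  refine ⟨b, c, fun f y => ?_⟩
  rw [h, ← (phiEquiv m).measurePreserving.integral_comp
    (phiEquiv m).toHomeomorph.measurableEmbedding]
  simp only [inner_eq_pairing]
  rfl

theorem zeta_complexify_gram (B : SymMat m) (φ : PhiSpace m) : zeta (complexify B) (gram φ) =
    Complex.exp (Complex.I / 2 * ((∑ l, ∑ i, ∑ j, φ (i, l) * B.1 i j * φ (j, l) : ℝ) : ℂ)) := by
  rw [zeta_gram]
  congr 2
  simp [quadC, complexify]

theorem zeta_complexify_phiEquiv (B : SymMat m)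
    (x : EuclideanSpace ℝ (Fin (Fintype.card (Fin m × Fin (2 * halfDim m))))) :
    zeta (complexify B) (gram (phiEquiv m x)) =
      phase (blockPhase (phiIndex m) (fun _ => 1) B) x := by
  rw [zeta_complexify_gram, phase_blockPhase]
  simp only [phiEquiv_apply, one_mul]

theorem intertwines_mulZeta (B : SymMat m) : (jetSystem_PE m).Intertwines (mulZeta B)
    (mulL2 (phase (blockPhase (phiIndex m) (fun _ => 1) B))) := by
  refine (jetSystem_PE m).intertwines_phase fun a => ?_
  obtain ⟨c, h⟩ := exists_multiDeriv_zeta_mul a B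
  refine ⟨c, fun f x => ?_⟩
  rw [← zeta_complexify_phiEquiv]
  exact h f.1 f.2 _

/-- `NormedPE m p` is `PE m`. -/
def normedPEEquiv (m : ℕ) (p : ℝ≥0∞) : NormedPE m p ≃ₗ[ℂ] PE m where
  toFun f := f
  invFun f := f
  map_add' _ _ := rfl
  map_smul' _ _ := rfl
  left_inv _ := rfl
  right_inv _ := rfl

theorem susyNorm_eq (p : ℝ≥0∞) [Fact (1 ≤ p)] (f : PE m) : susyNorm p f.1 =
    (jetSystem_PE m).jetNorm (fun a => 4 ^ a.size) p f := by
  rw [susyNorm, JetSystem.jetNorm]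
  congr 1
  refine Finset.sum_congr rfl fun a _ => ?_
  rw [JetSystem.norm_jet]
  congr 3
  exact (eLpNorm_comp_measurePreserving (rapidDecay_PE _
    ((linearOnSub_multiDeriv a).mem f.1 f.2)).cont.aestronglyMeasurable
    (phiEquiv m).measurePreserving).symm

theorem isCompactFromHToH_of_intertwines {U : PE m → PE m}
    {G : L2 (Fintype.card (Fin m × Fin (2 * halfDim m))) →
      L2 (Fintype.card (Fin m × Fin (2 * halfDim m)))}
    (hU : (jetSystem_PE m).Intertwines U G) (hUl : ∀ (c : ℂ) f g, U (c • f + g) = c • U f + U g)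
    (hG : ∀ (c : ℂ) u v, G (c • u + v) = c • G u + G v)
    (hS : ∀ (p : ℝ≥0∞) [Fact (1 ≤ p)] (h₁ h₂ : EuclideanSpace ℝ (Fin _) → ℂ), RapidDecay h₁ →
      RapidDecay h₂ → IsCompactSandwich h₁ G h₂ p) (f₁ f₂ : PE m)
    (p q : ℝ≥0∞) [Fact (1 ≤ p)] [Fact (1 ≤ q)] :
    IsCompactFromHToH (fun f => mulPE f₁ (U (mulPE f₂ f))) p q := by
  have hn : ∀ (r : ℝ≥0∞) [Fact (1 ≤ r)] (f : NormedPE m r), ‖f‖ =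
      (jetSystem_PE m).jetNorm (fun a => 4 ^ a.size) 2 (normedPEEquiv m r f) +
        (jetSystem_PE m).jetNorm (fun a => 4 ^ a.size) r (normedPEEquiv m r f) := fun r _ f => by
    rw [← susyNorm_eq, ← susyNorm_eq]
    rfl
  obtain ⟨S, hSc, h⟩ := (jetSystem_PE m).exists_compact_extension_jetNorm hU hUl hG hS f₁ f₂
    (normedPEEquiv m p) (normedPEEquiv m q) (fun a => one_le_pow₀ (by norm_num)) p q (hn p) (hn q)
  exact ⟨S, hSc, fun f => h f⟩

theorem susyT_smul_add (c : ℂ) (f g : PE m) : susyT (c • f + g) = c • susyT f + susyT g := by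
  rw [susyT_add, susyT_smul]

theorem mulZeta_smul_add (B : SymMat m) (c : ℂ) (f g : PE m) :
    mulZeta B (c • f + g) = c • mulZeta B f + mulZeta B g :=
  Subtype.ext (funext fun M => by
    simp only [mulZeta, Submodule.coe_add, Submodule.coe_smul, Pi.add_apply, Pi.smul_apply,
      smul_eq_mul]
    ring)

theorem fourierL2_phase_smul_add {k : ℕ} (E : SymMat k) (c : ℂ) (u v : L2 k) :
    fourierL2 (mulL2 (phase E) (c • u + v)) =
      c • fourierL2 (mulL2 (phase E) u) + fourierL2 (mulL2 (phase E) v) := by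
  rw [mulL2_smul_add (continuous_phase E).aestronglyMeasurable (fun x => (norm_phase E x).le),
    fourierL2_smul_add]

theorem isCompactFromHToH_susyT (f₁ f₂ : PE m) (p q : ℝ≥0∞) [Fact (1 ≤ p)] [Fact (1 ≤ q)] :
    IsCompactFromHToH (fun f => mulPE f₁ (susyT (mulPE f₂ f))) p q :=
  isCompactFromHToH_of_intertwines (intertwines_susyT m) susyT_smul_add fourierL2_smul_add
    (fun p _ _ _ h₁ h₂ => isCompactSandwich_fourierL2 h₁ h₂ p) f₁ f₂ p q

theorem isCompactFromHToH_iterate {L : ℕ} {B : SymMat m} (hB : B ∈ nondegSet m L) (f₁ f₂ : PE m)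
    (p q : ℝ≥0∞) [Fact (1 ≤ p)] [Fact (1 ≤ q)] :
    IsCompactFromHToH
      (fun f => mulPE f₁ ((fun u => susyT (mulZeta B u))^[L + 1] (mulPE f₂ f))) p q := by
  have hl : ∀ (c : ℂ) (f g : PE m), susyT (mulZeta B (c • f + g)) =
      c • susyT (mulZeta B f) + susyT (mulZeta B g) := fun c f g => by
    rw [mulZeta_smul_add, susyT_smul_add]
  exact isCompactFromHToH_of_intertwines
    (((intertwines_susyT m).comp (intertwines_mulZeta B) fourierL2_smul_add).iterate
      (fourierL2_phase_smul_add _) L)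
    (JetSystem.iterate_smul_add hl _) (JetSystem.iterate_smul_add (fourierL2_phase_smul_add _) _)
    (fun p _ _ _ h₁ h₂ => isCompactSandwich_iterate h₁ h₂
      (blockPhase_mem_nondegSet _ (fun _ => one_mul 1) hB) p) f₁ f₂ p q

end SpaceH

/-! ### Functions of two symmetric matrices -/

section TwoMatrices

variable {m : ℕ}

/-- Functionals which are linear on `V`. -/
structure FunctionalOnSub {X : Type*} (V : Submodule ℂ (X → ℂ)) (Λ : (X → ℂ) → ℂ) : Prop where
  add : ∀ f ∈ V, ∀ g ∈ V, Λ (f + g) = Λ f + Λ g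
  smul : ∀ (c : ℂ), ∀ f ∈ V, Λ (c • f) = c * Λ f

theorem FunctionalOnSub.comp {X : Type*} {V : Submodule ℂ (X → ℂ)} {Λ : (X → ℂ) → ℂ}
    (h : FunctionalOnSub V Λ) {A : (X → ℂ) → (X → ℂ)} (hA : LinearOnSub V A) :
    FunctionalOnSub V (fun f => Λ (A f)) where
  add f hf g hg := by rw [hA.add f hf g hg, h.add _ (hA.mem f hf) _ (hA.mem g hg)]
  smul c f hf := by rw [hA.smul c f hf, h.smul c _ (hA.mem f hf)]

theorem functionalOnSub_eval {X : Type*} (V : Submodule ℂ (X → ℂ)) (M : X) :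
    FunctionalOnSub V (fun f => f M) := ⟨fun _ _ _ _ => rfl, fun _ _ _ => rfl⟩

theorem FunctionalOnSub.sum_mul {X ι : Type*} [Fintype ι] {V : Submodule ℂ (X → ℂ)} (c : ι → ℂ)
    {Λ : ι → (X → ℂ) → ℂ} (h : ∀ i, FunctionalOnSub V (Λ i)) :
    FunctionalOnSub V (fun f => ∑ i, c i * Λ i f) where
  add f hf g hg := by
    rw [← Finset.sum_add_distrib]
    exact Finset.sum_congr rfl fun i _ => by rw [(h i).add f hf g hg, mul_add]
  smul a f hf := by
    rw [Finset.mul_sum]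
    exact Finset.sum_congr rfl fun i _ => by rw [(h i).smul a f hf, mul_left_comm]

theorem FunctionalOnSub.const_mul {X : Type*} {V : Submodule ℂ (X → ℂ)} (c : ℂ)
    {Λ : (X → ℂ) → ℂ} (h : FunctionalOnSub V Λ) : FunctionalOnSub V (fun f => c * Λ f) where
  add f hf g hg := by rw [h.add f hf g hg, mul_add]
  smul a f hf := by rw [h.smul a f hf, mul_left_comm]

/-- The function `f₁(M₊) f₂(M₋)`. -/
def tensorFun (f₁ f₂ : SymMat m → ℂ) (M : SymMat m × SymMat m) : ℂ := f₁ M.1 * f₂ M.2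

theorem tensorFun_mem {f₁ f₂ : SymMat m → ℂ} (h₁ : f₁ ∈ PE m) (h₂ : f₂ ∈ PE m) :
    tensorFun f₁ f₂ ∈ PE2 m := Submodule.subset_span ⟨f₁, h₁, f₂, h₂, rfl⟩

theorem FunctionalOnSub.eq_of_tensorFun {Λ₁ Λ₂ : (SymMat m × SymMat m → ℂ) → ℂ}
    (h₁ : FunctionalOnSub (PE2 m) Λ₁) (h₂ : FunctionalOnSub (PE2 m) Λ₂)
    (h : ∀ f₁ ∈ PE m, ∀ f₂ ∈ PE m, Λ₁ (tensorFun f₁ f₂) = Λ₂ (tensorFun f₁ f₂))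
    {g : SymMat m × SymMat m → ℂ} (hg : g ∈ PE2 m) : Λ₁ g = Λ₂ g := by
  induction hg using Submodule.span_induction with
  | mem g hg =>
    obtain ⟨f₁, k₁, f₂, k₂, rfl⟩ := hg
    exact h f₁ k₁ f₂ k₂
  | zero =>
    have h0 := h₁.smul 0 0 (PE2 m).zero_mem
    have h0' := h₂.smul 0 0 (PE2 m).zero_mem
    rw [zero_smul, zero_mul] at h0 h0'
    rw [h0, h0']
  | add f g hf hg hf' hg' => rw [h₁.add f hf g hg, h₂.add f hf g hg, hf', hg']
  | smul c f hf hf' => rw [h₁.smul c f hf, h₂.smul c f hf, hf']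

/-- The operator `D^{(+)}_{a} D^{(-)}_{b}`. -/
noncomputable def multiDeriv2 (a : MultiPair m × MultiPair m) (g : SymMat m × SymMat m → ℂ) :
    SymMat m × SymMat m → ℂ := multiDerivPlus a.1 (multiDerivMinus a.2 g)

theorem linearOnSub_multiDeriv2 (a : MultiPair m × MultiPair m) :
    LinearOnSub (PE2 m) (multiDeriv2 a) :=
  (linearOnSub_multiDerivPlus a.1).comp (linearOnSub_multiDerivMinus a.2)

theorem multiDeriv2_tensorFun (a : MultiPair m × MultiPair m) {f₁ f₂ : SymMat m → ℂ}
    (h₁ : f₁ ∈ PE m) (h₂ : f₂ ∈ PE m) :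
    multiDeriv2 a (tensorFun f₁ f₂) = tensorFun (multiDeriv a.1 f₁) (multiDeriv a.2 f₂) := by
  have e1 : multiDerivMinus a.2 (tensorFun f₁ f₂) = tensorFun f₁ (multiDeriv a.2 f₂) :=
    funext fun M => congrFun ((linearOnSub_multiDeriv a.2).smul (f₁ M.1) f₂ h₂) M.2
  rw [multiDeriv2, e1]
  funext M
  have h := congrFun ((linearOnSub_multiDeriv a.1).smul (multiDeriv a.2 f₂ M.2) f₁ h₁) M.1
  have e2 : (fun M' => tensorFun f₁ (multiDeriv a.2 f₂) (M', M.2)) =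
      multiDeriv a.2 f₂ M.2 • f₁ := funext fun M' => mul_comm _ _
  rw [multiDerivPlus, e2, h, Pi.smul_apply, smul_eq_mul, tensorFun, mul_comm]

theorem linearOnSub_mul2 {f : SymMat m × SymMat m → ℂ} (hf : f ∈ PE2 m) :
    LinearOnSub (PE2 m) (fun g M => f M * g M) where
  mem _ hg := PE2_mul_mem hf hg
  add _ _ _ _ := funext fun _ => mul_add _ _ _
  smul _ _ _ := funext fun _ => mul_left_comm _ _ _

theorem linearOnSub_xi (B : SymMat m) : LinearOnSub (PE2 m) (fun g M => xi B M * g M) where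
  mem _ hg := PE2_xi_mul_mem B hg
  add _ _ _ _ := funext fun _ => mul_add _ _ _
  smul _ _ _ := funext fun _ => mul_left_comm _ _ _

theorem functionalOnSub_multiDeriv2 (a : MultiPair m × MultiPair m) (M : SymMat m × SymMat m) :
    FunctionalOnSub (PE2 m) (fun g => multiDeriv2 a g M) :=
  (functionalOnSub_eval _ M).comp (linearOnSub_multiDeriv2 a)

/-- On pure tensors this is the product of the one-variable rules in M₊ and M₋; bilinearity extends
it first in f and then in g. -/
theorem exists_multiDeriv2_mul (a : MultiPair m × MultiPair m) :
    ∃ w : (MultiPair m × MultiPair m) × (MultiPair m × MultiPair m) → ℂ,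
      ∀ f ∈ PE2 m, ∀ g ∈ PE2 m, ∀ M, multiDeriv2 a (fun M => f M * g M) M =
        ∑ y, w y * (multiDeriv2 y.1 f M * multiDeriv2 y.2 g M) := by
  obtain ⟨w, hw⟩ := exists_multiDeriv_mul a.1
  obtain ⟨w', hw'⟩ := exists_multiDeriv_mul a.2
  refine ⟨fun y => w (y.1.1, y.2.1) * w' (y.1.2, y.2.2), fun f hf g hg M => ?_⟩
  have key : ∀ f₁ ∈ PE m, ∀ f₂ ∈ PE m, ∀ g₁ ∈ PE m, ∀ g₂ ∈ PE m,
      multiDeriv2 a (fun M => tensorFun f₁ f₂ M * tensorFun g₁ g₂ M) M =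
        ∑ y : (MultiPair m × MultiPair m) × (MultiPair m × MultiPair m),
          w (y.1.1, y.2.1) * w' (y.1.2, y.2.2) *
          (multiDeriv2 y.1 (tensorFun f₁ f₂) M * multiDeriv2 y.2 (tensorFun g₁ g₂) M) := by
    intro f₁ hf₁ f₂ hf₂ g₁ hg₁ g₂ hg₂
    have he : (fun M => tensorFun f₁ f₂ M * tensorFun g₁ g₂ M) =
        tensorFun (fun M => f₁ M * g₁ M) (fun M => f₂ M * g₂ M) :=
      funext fun M => mul_mul_mul_comm _ _ _ _
    rw [he, multiDeriv2_tensorFun a (PE_mul_mem hf₁ hg₁) (PE_mul_mem hf₂ hg₂), tensorFun,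
      hw f₁ hf₁ g₁ hg₁, hw' f₂ hf₂ g₂ hg₂, Finset.sum_mul_sum, ← Finset.univ_product_univ,
      ← Finset.sum_product', Finset.univ_product_univ, Finset.univ_product_univ,
      ← (Equiv.prodProdProdComm _ _ _ _).sum_comp]
    refine Finset.sum_congr rfl fun y _ => ?_
    rw [multiDeriv2_tensorFun _ hf₁ hf₂, multiDeriv2_tensorFun _ hg₁ hg₂]
    simp only [tensorFun, Equiv.prodProdProdComm_apply]
    ring
  have h1 : ∀ g₁ ∈ PE m, ∀ g₂ ∈ PE m, multiDeriv2 a (fun M => f M * tensorFun g₁ g₂ M) M =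
      ∑ y : (MultiPair m × MultiPair m) × (MultiPair m × MultiPair m),
        w (y.1.1, y.2.1) * w' (y.1.2, y.2.2) *
          (multiDeriv2 y.1 f M * multiDeriv2 y.2 (tensorFun g₁ g₂) M) := by
    intro g₁ hg₁ g₂ hg₂
    have hl := (functionalOnSub_multiDeriv2 a M).comp (linearOnSub_mul2 (tensorFun_mem hg₁ hg₂))
    have hr := FunctionalOnSub.sum_mul
      (fun y : (MultiPair m × MultiPair m) × (MultiPair m × MultiPair m) =>
        w (y.1.1, y.2.1) * w' (y.1.2, y.2.2) * multiDeriv2 y.2 (tensorFun g₁ g₂) M)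
      (fun y => functionalOnSub_multiDeriv2 y.1 M)
    have := hl.eq_of_tensorFun hr (fun f₁ hf₁ f₂ hf₂ => ?_) hf
    · simp_rw [mul_comm (f _)]
      rw [this]
      exact Finset.sum_congr rfl fun y _ => by ring
    · simp_rw [mul_comm (tensorFun g₁ g₂ _)]
      rw [key f₁ hf₁ f₂ hf₂ g₁ hg₁ g₂ hg₂]
      exact Finset.sum_congr rfl fun y _ => by ring
  have hl := (functionalOnSub_multiDeriv2 a M).comp (linearOnSub_mul2 hf)
  have hr := FunctionalOnSub.sum_mul
    (fun y : (MultiPair m × MultiPair m) × (MultiPair m × MultiPair m) =>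
      w (y.1.1, y.2.1) * w' (y.1.2, y.2.2) * multiDeriv2 y.1 f M)
    (fun y => functionalOnSub_multiDeriv2 y.2 M)
  rw [hl.eq_of_tensorFun hr (fun g₁ hg₁ g₂ hg₂ => ?_) hg]
  · exact Finset.sum_congr rfl fun y _ => by ring
  · rw [h1 g₁ hg₁ g₂ hg₂]
    exact Finset.sum_congr rfl fun y _ => by ring

/-- The factorization of ξ_B into ζ_B(M₊) ζ_{-B}(M₋) reduces this to one variable at a time. -/
theorem exists_multiDeriv2_xi_mul (a : MultiPair m × MultiPair m) (B : SymMat m) :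
    ∃ c : MultiPair m × MultiPair m → ℂ, ∀ g ∈ PE2 m, ∀ M,
      multiDeriv2 a (fun M => xi B M * g M) M = ∑ b, c b * (xi B M * multiDeriv2 b g M) := by
  obtain ⟨c, hc⟩ := exists_multiDeriv_zeta_mul a.1 B
  obtain ⟨c', hc'⟩ := exists_multiDeriv_zeta_mul a.2 (-B)
  refine ⟨fun b => c b.1 * c' b.2, fun g hg M => ?_⟩
  have hl := (functionalOnSub_multiDeriv2 a M).comp (linearOnSub_xi B)
  have hr := FunctionalOnSub.sum_mul
    (fun b : MultiPair m × MultiPair m => c b.1 * c' b.2 * xi B M)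
    (fun b => functionalOnSub_multiDeriv2 b M)
  rw [hl.eq_of_tensorFun hr (fun f₁ hf₁ f₂ hf₂ => ?_) hg]
  · exact Finset.sum_congr rfl fun y _ => by ring
  · have he : (fun M => xi B M * tensorFun f₁ f₂ M) =
        tensorFun (fun M => zeta (complexify B) M * f₁ M)
          (fun M => zeta (complexify (-B)) M * f₂ M) :=
      funext fun M => by
        rw [xi_eq, tensorFun, tensorFun]
        ring
    rw [he, multiDeriv2_tensorFun a (PE_zeta_mul_mem B hf₁) (PE_zeta_mul_mem (-B) hf₂), tensorFun,
      hc f₁ hf₁, hc' f₂ hf₂, Finset.sum_mul_sum, Fintype.sum_prod_type, xi_eq]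
    refine Finset.sum_congr rfl fun y _ => Finset.sum_congr rfl fun z _ => ?_
    rw [multiDeriv2_tensorFun _ hf₁ hf₂, tensorFun]
    ring

/-! ### The supersymmetric Fourier transform on `PE(m) ⊗ PE(m)` -/

theorem isAddHaarMeasure_phi2 :
    (volume : Measure (PhiSpace m × PhiSpace m)).IsAddHaarMeasure :=
  Measure.prod.instIsAddHaarMeasure _ _

/-- The kernel `e^{i Tr(φ'₊ φ₊ᵀ + φ'₋ φ₋ᵀ)}`. -/
noncomputable def pairingKernel2 (φ' φ : PhiSpace m × PhiSpace m) : ℂ :=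
  Complex.exp (Complex.I * ((pairing φ'.1 φ.1 + pairing φ'.2 φ.2 : ℝ) : ℂ))

theorem pairingKernel2_eq (φ' φ : PhiSpace m × PhiSpace m) :
    pairingKernel2 φ' φ = pairingKernel φ'.1 φ.1 * pairingKernel φ'.2 φ.2 := by
  rw [pairingKernel2, pairingKernel, pairingKernel, ← Complex.exp_add]
  congr 1
  push_cast
  ring

theorem integrable_pairingKernel2_mul (φ' : PhiSpace m × PhiSpace m)
    {g : SymMat m × SymMat m → ℂ} (hg : g ∈ PE2 m) :
    Integrable (fun φ : PhiSpace m × PhiSpace m =>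
      pairingKernel2 φ' φ * g (gram φ.1, gram φ.2)) := by
  have : (volume : Measure (PhiSpace m × PhiSpace m)).IsAddHaarMeasure := isAddHaarMeasure_phi2
  have h1 : Integrable (fun φ : PhiSpace m × PhiSpace m => g (gram φ.1, gram φ.2)) :=
    memLp_one_iff_integrable.1 ((rapidDecay_PE2 g hg).memLp volume le_rfl)
  refine h1.bdd_mul (c := 1) (Continuous.aestronglyMeasurable ?_)
    (Filter.Eventually.of_forall fun φ => (norm_exp_I_mul_ofReal _).le)
  unfold pairingKernel2 pairing
  fun_prop

theorem functionalOnSub_integral (φ' : PhiSpace m × PhiSpace m) (a : MultiPair m × MultiPair m) :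
    FunctionalOnSub (PE2 m) (fun g => ∫ φ : PhiSpace m × PhiSpace m,
      pairingKernel2 φ' φ * multiDeriv2 a g (gram φ.1, gram φ.2)) where
  add f hf g hg := by
    rw [← integral_add (integrable_pairingKernel2_mul φ' ((linearOnSub_multiDeriv2 a).mem f hf))
      (integrable_pairingKernel2_mul φ' ((linearOnSub_multiDeriv2 a).mem g hg))]
    refine integral_congr_ae (Filter.Eventually.of_forall fun φ => ?_)
    simp only [(linearOnSub_multiDeriv2 a).add f hf g hg, Pi.add_apply, mul_add]
  smul c f hf := by
    rw [← integral_const_mul]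
    refine integral_congr_ae (Filter.Eventually.of_forall fun φ => ?_)
    simp only [(linearOnSub_multiDeriv2 a).smul c f hf, Pi.smul_apply, smul_eq_mul]
    ring

theorem integral_tensorFun (φ' : PhiSpace m × PhiSpace m) (f₁ f₂ : SymMat m → ℂ) :
    ∫ φ : PhiSpace m × PhiSpace m, pairingKernel2 φ' φ * tensorFun f₁ f₂ (gram φ.1, gram φ.2) =
      (∫ φ, pairingKernel φ'.1 φ * f₁ (gram φ)) * ∫ φ, pairingKernel φ'.2 φ * f₂ (gram φ) := by
  rw [← integral_prod_mul]
  refine integral_congr_ae (Filter.Eventually.of_forall fun φ => ?_)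
  simp only [pairingKernel2_eq, tensorFun]
  ring

theorem functionalOnSub_susyIntegral2 (φ' : PhiSpace m × PhiSpace m) :
    FunctionalOnSub (PE2 m) (fun g => susyIntegral2 g φ') :=
  (functionalOnSub_integral φ' (MultiPair.full m, MultiPair.full m)).const_mul _

/-- Fubini. The two signs (-1)^{mn} multiply to 1, which is why the prefactor of 𝒯 carries none. -/
theorem susyIntegral2_tensorFun (φ' : PhiSpace m × PhiSpace m) {f₁ f₂ : SymMat m → ℂ}
    (h₁ : f₁ ∈ PE m) (h₂ : f₂ ∈ PE m) : susyIntegral2 (tensorFun f₁ f₂) φ' =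
      susyIntegral f₁ φ'.1 * susyIntegral f₂ φ'.2 := by
  have h := integral_tensorFun φ' (multiDeriv (MultiPair.full m) f₁)
    (multiDeriv (MultiPair.full m) f₂)
  rw [← multiDeriv2_tensorFun (MultiPair.full m, MultiPair.full m) h₁ h₂] at h
  have hpi : (Real.pi : ℂ) ≠ 0 := Complex.ofReal_ne_zero.2 Real.pi_ne_zero
  have hs : ((-1 : ℂ)) ^ (m * halfDim m) * (-1) ^ (m * halfDim m) = 1 := by
    rw [← mul_pow]
    norm_num
  refine (congrArg (1 / (Real.pi : ℂ) ^ (2 * m * halfDim m) * ·) h).trans ?_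
  rw [susyIntegral, susyIntegral, show 2 * m * halfDim m = m * halfDim m + m * halfDim m by ring,
    pow_add]
  simp only [pairingKernel]
  field_simp
  rw [sq, hs, mul_one]

/-- Uniqueness in one variable is applied to M₊ with M₋ a Gram matrix, and then to M₋ with M₊
arbitrary. -/
theorem PE2_eq_of_gram {f g : SymMat m × SymMat m → ℂ} (hf : f ∈ PE2 m) (hg : g ∈ PE2 m)
    (h : ∀ φ : PhiSpace m × PhiSpace m, f (gram φ.1, gram φ.2) = g (gram φ.1, gram φ.2)) :
    f = g := by
  have h1 : ∀ (M : SymMat m) (φ : PhiSpace m), f (M, gram φ) = g (M, gram φ) := fun M φ =>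
    congrFun (PE_eq_of_gram (PE2_slice_left (gram φ) f hf) (PE2_slice_left (gram φ) g hg)
      fun ψ => h (ψ, φ)) M
  funext M
  exact congrFun (PE_eq_of_gram (PE2_slice_right M.1 f hf) (PE2_slice_right M.1 g hg)
    fun φ => h1 M.1 φ) M.2

theorem exists_susyT2 (g : SymMat m × SymMat m → ℂ) (hg : g ∈ PE2 m) :
    ∃ u ∈ PE2 m, ∀ φ' : PhiSpace m × PhiSpace m,
      u (gram φ'.1, gram φ'.2) = susyIntegral2 g φ' := by
  induction hg using Submodule.span_induction with
  | mem g hg =>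
    obtain ⟨f₁, h₁, f₂, h₂, rfl⟩ := hg
    refine ⟨_, tensorFun_mem (susyT ⟨f₁, h₁⟩).2 (susyT ⟨f₂, h₂⟩).2, fun φ' => ?_⟩
    rw [tensorFun, susyT_gram, susyT_gram]
    exact (susyIntegral2_tensorFun φ' h₁ h₂).symm
  | zero =>
    refine ⟨0, (PE2 m).zero_mem, fun φ' => ?_⟩
    have := (functionalOnSub_susyIntegral2 φ').smul 0 0 (PE2 m).zero_mem
    rw [zero_smul, zero_mul] at this
    rw [this, Pi.zero_apply]
  | add f g hf hg hf' hg' =>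
    obtain ⟨f', hf', h⟩ := hf'
    obtain ⟨g', hg', h'⟩ := hg'
    exact ⟨f' + g', (PE2 m).add_mem hf' hg', fun φ' => by
      rw [Pi.add_apply, h, h', (functionalOnSub_susyIntegral2 φ').add f hf g hg]⟩
  | smul c f hf hf' =>
    obtain ⟨f', hf', h⟩ := hf'
    exact ⟨c • f', (PE2 m).smul_mem c hf', fun φ' => by
      rw [Pi.smul_apply, h, (functionalOnSub_susyIntegral2 φ').smul c f hf, smul_eq_mul]⟩

theorem susyT2_gram (g : PE2 m) (φ' : PhiSpace m × PhiSpace m) :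
    (susyT2 g).1 (gram φ'.1, gram φ'.2) = susyIntegral2 g.1 φ' := by
  have h : ∃ u : PE2 m, ∀ φ' : PhiSpace m × PhiSpace m,
      u.1 (gram φ'.1, gram φ'.2) = susyIntegral2 g.1 φ' := by
    obtain ⟨u, hu, h⟩ := exists_susyT2 g.1 g.2
    exact ⟨⟨u, hu⟩, h⟩
  rw [susyT2, dif_pos h]
  exact h.choose_spec φ'

theorem susyT2_eq {g : PE2 m} {u : SymMat m × SymMat m → ℂ} (hu : u ∈ PE2 m)
    (h : ∀ φ' : PhiSpace m × PhiSpace m, susyIntegral2 g.1 φ' = u (gram φ'.1, gram φ'.2)) :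
    (susyT2 g).1 = u :=
  PE2_eq_of_gram (susyT2 g).2 hu fun φ' => by rw [susyT2_gram, h]

theorem susyT2_smul_add (c : ℂ) (f g : PE2 m) :
    susyT2 (c • f + g) = c • susyT2 f + susyT2 g :=
  Subtype.ext (susyT2_eq (c • susyT2 f + susyT2 g).2 fun φ' => by
    have h := functionalOnSub_susyIntegral2 φ'
    rw [Submodule.coe_add, h.add _ (c • f).2 _ g.2, Submodule.coe_smul, h.smul c _ f.2,
      Submodule.coe_add, Pi.add_apply, susyT2_gram, Submodule.coe_smul, Pi.smul_apply, susyT2_gram,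
      smul_eq_mul])

theorem susyT2_tensorFun {f₁ f₂ : SymMat m → ℂ} (h₁ : f₁ ∈ PE m) (h₂ : f₂ ∈ PE m) :
    (susyT2 ⟨tensorFun f₁ f₂, tensorFun_mem h₁ h₂⟩).1 =
      tensorFun (susyT ⟨f₁, h₁⟩).1 (susyT ⟨f₂, h₂⟩).1 :=
  susyT2_eq (tensorFun_mem (susyT ⟨f₁, h₁⟩).2 (susyT ⟨f₂, h₂⟩).2) fun φ' => by
    rw [tensorFun, susyT_gram, susyT_gram]
    exact susyIntegral2_tensorFun φ' h₁ h₂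

open Classical in
/-- The transform `𝒯`, extended by zero to all functions. -/
noncomputable def susyT2Ext (g : SymMat m × SymMat m → ℂ) : SymMat m × SymMat m → ℂ :=
  if hg : g ∈ PE2 m then (susyT2 ⟨g, hg⟩).1 else 0

theorem susyT2Ext_of_mem {g : SymMat m × SymMat m → ℂ} (hg : g ∈ PE2 m) :
    susyT2Ext g = (susyT2 ⟨g, hg⟩).1 := dif_pos hg

theorem linearOnSub_susyT2Ext : LinearOnSub (PE2 m) susyT2Ext where
  mem f hf := by
    rw [susyT2Ext_of_mem hf]
    exact (susyT2 ⟨f, hf⟩).2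
  add f hf g hg := by
    rw [susyT2Ext_of_mem hf, susyT2Ext_of_mem hg, susyT2Ext_of_mem ((PE2 m).add_mem hf hg)]
    have := susyT2_smul_add 1 (⟨f, hf⟩ : PE2 m) ⟨g, hg⟩
    rw [one_smul, one_smul] at this
    exact congrArg Subtype.val this
  smul c f hf := by
    rw [susyT2Ext_of_mem hf, susyT2Ext_of_mem ((PE2 m).smul_mem c hf)]
    have h0 : susyT2 (0 : PE2 m) = 0 := by
      simpa using susyT2_smul_add 1 (0 : PE2 m) 0
    have := susyT2_smul_add c (⟨f, hf⟩ : PE2 m) 0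
    rw [h0, add_zero, add_zero] at this
    exact congrArg Subtype.val this

theorem exists_multiDeriv2_susyT2 (a : MultiPair m × MultiPair m) :
    ∃ (b : MultiPair m × MultiPair m) (c : ℂ), ∀ (g : PE2 m) (φ' : PhiSpace m × PhiSpace m),
      multiDeriv2 a (susyT2 g).1 (gram φ'.1, gram φ'.2) =
        c * ∫ φ : PhiSpace m × PhiSpace m,
          pairingKernel2 φ' φ * multiDeriv2 b g.1 (gram φ.1, gram φ.2) := by
  obtain ⟨b, c, h⟩ := exists_multiDeriv_susyT a.1
  obtain ⟨b', c', h'⟩ := exists_multiDeriv_susyT a.2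
  refine ⟨(b, b'), c * c', fun g φ' => ?_⟩
  have hl := (functionalOnSub_multiDeriv2 a (gram φ'.1, gram φ'.2)).comp linearOnSub_susyT2Ext
  have hr := (functionalOnSub_integral φ' (b, b')).const_mul (c * c')
  have := hl.eq_of_tensorFun hr (fun f₁ hf₁ f₂ hf₂ => ?_) g.2
  · rwa [susyT2Ext_of_mem g.2] at this
  · rw [susyT2Ext_of_mem (tensorFun_mem hf₁ hf₂), susyT2_tensorFun hf₁ hf₂,
      multiDeriv2_tensorFun a (susyT _).2 (susyT _).2, multiDeriv2_tensorFun _ hf₁ hf₂,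
      integral_tensorFun, tensorFun, h, h']
    ring

end TwoMatrices

/-! ### Compact operators on the spaces `𝒦_p` -/

section SpaceK

variable {m : ℕ}

/-- The dimension of `(ℝ^{m × 2n})²`. -/
abbrev phi2Dim (m : ℕ) : ℕ :=
  Fintype.card ((Fin m × Fin (2 * halfDim m)) ⊕ (Fin m × Fin (2 * halfDim m)))

/-- An enumeration of the coordinates of `(ℝ^{m × 2n})²`. -/
noncomputable def phi2Index (m : ℕ) :
    Fin (phi2Dim m) ≃ (Fin m × Fin (2 * halfDim m)) ⊕ (Fin m × Fin (2 * halfDim m)) :=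
  (Fintype.equivFin _).symm

/-- The identification of `ℝ^{4mn}` with `(ℝ^{m × 2n})²`. -/
noncomputable def phi2Map (m : ℕ) (x : EuclideanSpace ℝ (Fin (phi2Dim m))) :
    PhiSpace m × PhiSpace m :=
  (WithLp.toLp 2 fun i => x ((phi2Index m).symm (Sum.inl i)),
    WithLp.toLp 2 fun i => x ((phi2Index m).symm (Sum.inr i)))

theorem continuous_phi2Map (m : ℕ) : Continuous (phi2Map m) := by
  unfold phi2Map
  fun_prop

theorem measurePreserving_phi2Map (m : ℕ) : MeasurePreserving (phi2Map m) volume volume := by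
  have h1 := PiLp.volume_preserving_ofLp (Fin (phi2Dim m))
  have h2 := volume_measurePreserving_piCongrLeft
    (fun _ : (Fin m × Fin (2 * halfDim m)) ⊕ (Fin m × Fin (2 * halfDim m)) => ℝ) (phi2Index m)
  have h3 := volume_measurePreserving_sumPiEquivProdPi
    (fun _ : (Fin m × Fin (2 * halfDim m)) ⊕ (Fin m × Fin (2 * halfDim m)) => ℝ)
  have h4 := (PiLp.volume_preserving_toLp (Fin m × Fin (2 * halfDim m))).prod
    (PiLp.volume_preserving_toLp (Fin m × Fin (2 * halfDim m)))
  have h := h4.comp (h3.comp (h2.comp h1))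
  have hc : ∀ (x : EuclideanSpace ℝ (Fin (phi2Dim m))) i, MeasurableEquiv.piCongrLeft
      (fun _ : (Fin m × Fin (2 * halfDim m)) ⊕ (Fin m × Fin (2 * halfDim m)) => ℝ) (phi2Index m)
      x.ofLp i = x ((phi2Index m).symm i) := fun x i => by
    obtain ⟨j, rfl⟩ := (phi2Index m).surjective i
    rw [MeasurableEquiv.piCongrLeft_apply_apply, Equiv.symm_apply_apply]
  have he : phi2Map m = Prod.map (WithLp.toLp 2) (WithLp.toLp 2) ∘
      (MeasurableEquiv.sumPiEquivProdPi
        (fun _ : (Fin m × Fin (2 * halfDim m)) ⊕ (Fin m × Fin (2 * halfDim m)) => ℝ)) ∘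
      (MeasurableEquiv.piCongrLeft
        (fun _ : (Fin m × Fin (2 * halfDim m)) ⊕ (Fin m × Fin (2 * halfDim m)) => ℝ)
        (phi2Index m)) ∘ WithLp.ofLp := by
    funext x
    refine Prod.ext ?_ ?_
    · exact congrArg (WithLp.toLp 2) (funext fun i => (hc x (Sum.inl i)).symm)
    · exact congrArg (WithLp.toLp 2) (funext fun i => (hc x (Sum.inr i)).symm)
  rw [he]
  exact h

theorem sum_phi2Index (f : Fin (phi2Dim m) → ℝ) : ∑ x, f x =
    ∑ i, f ((phi2Index m).symm (Sum.inl i)) + ∑ i, f ((phi2Index m).symm (Sum.inr i)) := by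
  rw [← (phi2Index m).symm.sum_comp, Fintype.sum_sum_type]

/-- The product space carries the maximum norm and ℝ^{4mn} the Euclidean one, so `phi2Map` is not an
isometry. The comparison suffices to transport rapid decay. -/
theorem norm_le_phi2Map (x : EuclideanSpace ℝ (Fin (phi2Dim m))) : ‖x‖ ≤ 2 * ‖phi2Map m x‖ := by
  have h1 : ‖x‖ ^ 2 = ‖(phi2Map m x).1‖ ^ 2 + ‖(phi2Map m x).2‖ ^ 2 := by
    rw [EuclideanSpace.norm_sq_eq, EuclideanSpace.norm_sq_eq, EuclideanSpace.norm_sq_eq,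
      sum_phi2Index]
    rfl
  have h2 := norm_fst_le (phi2Map m x)
  have h3 := norm_snd_le (phi2Map m x)
  refine abs_le_of_sq_le_sq' ?_ (by positivity) |>.2
  nlinarith [norm_nonneg (phi2Map m x).1, norm_nonneg (phi2Map m x).2]

theorem inner_eq_pairing_add (y x : EuclideanSpace ℝ (Fin (phi2Dim m))) :
    inner ℝ y x = pairing (phi2Map m y).1 (phi2Map m x).1 +
      pairing (phi2Map m y).2 (phi2Map m x).2 := by
  rw [PiLp.inner_apply, sum_phi2Index]
  simp [pairing, phi2Map, mul_comm]

/-- The pair of matrices `(φ₊ φ₊ᵀ, φ₋ φ₋ᵀ)`. -/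
noncomputable def gram2 (m : ℕ) (x : EuclideanSpace ℝ (Fin (phi2Dim m))) :
    SymMat m × SymMat m :=
  (gram (phi2Map m x).1, gram (phi2Map m x).2)

theorem jetSystem_PE2 (m : ℕ) : JetSystem (PE2 m) (multiDeriv2 (m := m)) (gram2 m) where
  lin := linearOnSub_multiDeriv2
  decay f hf := by
    have h := rapidDecay_PE2 f hf
    refine ⟨h.cont.comp (continuous_phi2Map m), fun N => ?_⟩
    obtain ⟨C, hC⟩ := h.decay N
    refine ⟨2 ^ N * C, fun x => ?_⟩
    calc ‖f (gram2 m x)‖ * (1 + ‖x‖) ^ N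
        ≤ ‖f (gram2 m x)‖ * (2 * (1 + ‖phi2Map m x‖)) ^ N := by
          gcongr
          linarith [norm_le_phi2Map x, norm_nonneg (phi2Map m x)]
      _ = 2 ^ N * (‖f (gram2 m x)‖ * (1 + ‖phi2Map m x‖) ^ N) := by
          rw [mul_pow]
          ring
      _ ≤ 2 ^ N * C := by
          gcongr
          exact hC (phi2Map m x)
  mul_mem f hf g hg := PE2_mul_mem hf hg
  leibniz a := by
    obtain ⟨w, hw⟩ := exists_multiDeriv2_mul a
    exact ⟨w, fun f hf g hg x => hw f hf g hg _⟩

theorem intertwines_susyT2 (m : ℕ) : (jetSystem_PE2 m).Intertwines susyT2 fourierL2 := by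
  refine (jetSystem_PE2 m).intertwines_fourierL2 fun a => ?_
  obtain ⟨b, c, h⟩ := exists_multiDeriv2_susyT2 a
  refine ⟨b, c, fun f y => (h f (phi2Map m y)).trans ?_⟩
  have hm := measurePreserving_phi2Map m
  rw [← hm.map_eq, integral_map hm.measurable.aemeasurable]
  · simp only [pairingKernel2, inner_eq_pairing_add]
    rfl
  · rw [hm.map_eq]
    exact (integrable_pairingKernel2_mul _ ((linearOnSub_multiDeriv2 b).mem f.1 f.2)).1

/-- The coordinates of `(ℝ^{m × 2n})²`, grouped by columns. -/
noncomputable def phi2Columns (m : ℕ) :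
    Fin (phi2Dim m) ≃ Fin m × (Fin (2 * halfDim m) ⊕ Fin (2 * halfDim m)) :=
  (phi2Index m).trans (Equiv.prodSumDistrib _ _ _).symm

/-- The signs of the two groups of columns. -/
def phi2Sign (m : ℕ) : Fin (2 * halfDim m) ⊕ Fin (2 * halfDim m) → ℝ :=
  Sum.elim (fun _ => 1) fun _ => -1

/-- Each column of φ₊ contributes a block B and each column of φ₋ a block -B. -/
theorem xi_gram2 (B : SymMat m) (x : EuclideanSpace ℝ (Fin (phi2Dim m))) :
    xi B (gram2 m x) = phase (blockPhase (phi2Columns m) (phi2Sign m) B) x := by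
  rw [xi_eq, gram2, zeta_complexify_gram, zeta_complexify_gram, phase_blockPhase, ← Complex.exp_add,
    ← mul_add, ← Complex.ofReal_add, Fintype.sum_sum_type]
  congr 4
  · simp only [phi2Sign, Sum.elim_inl, one_mul]
    rfl
  · refine Finset.sum_congr rfl fun l _ => ?_
    simp only [phi2Sign, Sum.elim_inr, neg_mul, one_mul, ← Finset.sum_neg_distrib]
    refine Finset.sum_congr rfl fun i _ => Finset.sum_congr rfl fun j _ => ?_
    have : (-B).1 i j = -B.1 i j := rfl
    rw [this, mul_neg, neg_mul]
    rfl

theorem intertwines_mulXi (B : SymMat m) : (jetSystem_PE2 m).Intertwines (mulXi B)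
    (mulL2 (phase (blockPhase (phi2Columns m) (phi2Sign m) B))) := by
  refine (jetSystem_PE2 m).intertwines_phase fun a => ?_
  obtain ⟨c, h⟩ := exists_multiDeriv2_xi_mul a B
  refine ⟨c, fun f x => ?_⟩
  rw [← xi_gram2]
  exact h f.1 f.2 _

/-- `NormedPE2 m p` is `PE2 m`. -/
def normedPE2Equiv (m : ℕ) (p : ℝ≥0∞) : NormedPE2 m p ≃ₗ[ℂ] PE2 m where
  toFun f := f
  invFun f := f
  map_add' _ _ := rfl
  map_smul' _ _ := rfl
  left_inv _ := rfl
  right_inv _ := rfl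

theorem susyNorm2_eq (p : ℝ≥0∞) [Fact (1 ≤ p)] (f : PE2 m) : susyNorm2 p f.1 =
    (jetSystem_PE2 m).jetNorm (fun a => 4 ^ (a.1.size + a.2.size)) p f := by
  rw [susyNorm2, JetSystem.jetNorm]
  congr 1
  refine Finset.sum_congr rfl fun a _ => ?_
  rw [JetSystem.norm_jet]
  congr 3
  exact (eLpNorm_comp_measurePreserving (rapidDecay_PE2 _
    ((linearOnSub_multiDeriv2 a).mem f.1 f.2)).cont.aestronglyMeasurable
    (measurePreserving_phi2Map m)).symm

theorem isCompactFromKToK_of_intertwines {U : PE2 m → PE2 m}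
    {G : L2 (phi2Dim m) → L2 (phi2Dim m)} (hU : (jetSystem_PE2 m).Intertwines U G)
    (hUl : ∀ (c : ℂ) f g, U (c • f + g) = c • U f + U g)
    (hG : ∀ (c : ℂ) u v, G (c • u + v) = c • G u + G v)
    (hS : ∀ (p : ℝ≥0∞) [Fact (1 ≤ p)] (h₁ h₂ : EuclideanSpace ℝ (Fin _) → ℂ), RapidDecay h₁ →
      RapidDecay h₂ → IsCompactSandwich h₁ G h₂ p) (g₁ g₂ : PE2 m)
    (p q : ℝ≥0∞) [Fact (1 ≤ p)] [Fact (1 ≤ q)] :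
    IsCompactFromKToK (fun g => mulPE2 g₁ (U (mulPE2 g₂ g))) p q := by
  have hn : ∀ (r : ℝ≥0∞) [Fact (1 ≤ r)] (f : NormedPE2 m r), ‖f‖ =
      (jetSystem_PE2 m).jetNorm (fun a => 4 ^ (a.1.size + a.2.size)) 2 (normedPE2Equiv m r f) +
        (jetSystem_PE2 m).jetNorm (fun a => 4 ^ (a.1.size + a.2.size)) r
          (normedPE2Equiv m r f) := fun r _ f => by
    rw [← susyNorm2_eq, ← susyNorm2_eq]
    rfl
  obtain ⟨S, hSc, h⟩ := (jetSystem_PE2 m).exists_compact_extension_jetNorm hU hUl hG hS g₁ g₂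
    (normedPE2Equiv m p) (normedPE2Equiv m q) (fun a => one_le_pow₀ (by norm_num)) p q (hn p) (hn q)
  exact ⟨S, hSc, fun f => h f⟩

theorem mulXi_smul_add (B : SymMat m) (c : ℂ) (f g : PE2 m) :
    mulXi B (c • f + g) = c • mulXi B f + mulXi B g :=
  Subtype.ext (funext fun M => by
    simp only [mulXi, Submodule.coe_add, Submodule.coe_smul, Pi.add_apply, Pi.smul_apply,
      smul_eq_mul]
    ring)

theorem isCompactFromKToK_susyT2 (g₁ g₂ : PE2 m) (p q : ℝ≥0∞) [Fact (1 ≤ p)] [Fact (1 ≤ q)] :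
    IsCompactFromKToK (fun g => mulPE2 g₁ (susyT2 (mulPE2 g₂ g))) p q :=
  isCompactFromKToK_of_intertwines (intertwines_susyT2 m) susyT2_smul_add fourierL2_smul_add
    (fun p _ _ _ h₁ h₂ => isCompactSandwich_fourierL2 h₁ h₂ p) g₁ g₂ p q

theorem isCompactFromKToK_iterate {L : ℕ} {B : SymMat m} (hB : B ∈ nondegSet m L) (g₁ g₂ : PE2 m)
    (p q : ℝ≥0∞) [Fact (1 ≤ p)] [Fact (1 ≤ q)] :
    IsCompactFromKToK
      (fun g => mulPE2 g₁ ((fun u => susyT2 (mulXi B u))^[L + 1] (mulPE2 g₂ g))) p q := by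
  have hl : ∀ (c : ℂ) (f g : PE2 m), susyT2 (mulXi B (c • f + g)) =
      c • susyT2 (mulXi B f) + susyT2 (mulXi B g) := fun c f g => by
    rw [mulXi_smul_add, susyT2_smul_add]
  have hε : ∀ l, phi2Sign m l * phi2Sign m l = 1 := by
    rintro (l | l) <;> simp [phi2Sign]
  exact isCompactFromKToK_of_intertwines
    (((intertwines_susyT2 m).comp (intertwines_mulXi B) fourierL2_smul_add).iterate
      (fourierL2_phase_smul_add _) L)
    (JetSystem.iterate_smul_add hl _) (JetSystem.iterate_smul_add (fourierL2_phase_smul_add _) _)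
    (fun p _ _ _ h₁ h₂ => isCompactSandwich_iterate h₁ h₂
      (blockPhase_mem_nondegSet _ hε hB) p) g₁ g₂ p q

end SpaceK

/-! ### The proposition -/

theorem propositionC1 :
    (∀ (k L : ℕ) (h₁ h₂ : EuclideanSpace ℝ (Fin k) → ℂ),
      Continuous h₁ → ExpDecay h₁ → Continuous h₂ → ExpDecay h₂ →
      ∀ D ∈ nondegSet k L, ∀ (p : ℝ≥0∞) [Fact (1 ≤ p)],
        IsCompactSandwich h₁ fourierL2 h₂ p ∧
        IsCompactSandwich h₁ (fun f => fourierL2 (mulL2 (phase D) f))^[L + 1] h₂ p) ∧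
    -- `T` is well defined on `PE(m)`, and the operators on the spaces `ℋ_p` are compact
    (∀ m : ℕ,
      (∀ (f : PE m) (φ' : PhiSpace m), (susyT f).1 (gram φ') = susyIntegral f.1 φ') ∧
      ∀ (L : ℕ) (f₁ f₂ : PE m), ∀ B ∈ nondegSet m L,
        ∀ (p q : ℝ≥0∞) [Fact (1 ≤ p)] [Fact (1 ≤ q)],
          IsCompactFromHToH (fun f => mulPE f₁ (susyT (mulPE f₂ f))) p q ∧
          IsCompactFromHToH
            (fun f => mulPE f₁ ((fun u => susyT (mulZeta B u))^[L + 1] (mulPE f₂ f))) p q) ∧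
    -- `𝒯` is well defined on `PE(m) ⊗ PE(m)`, and the operators on the spaces `𝒦_p` are compact
    (∀ m : ℕ,
      (∀ (g : PE2 m) (φ' : PhiSpace m × PhiSpace m),
        (susyT2 g).1 (gram φ'.1, gram φ'.2) = susyIntegral2 g.1 φ') ∧
      ∀ (L : ℕ) (g₁ g₂ : PE2 m), ∀ B ∈ nondegSet m L,
        ∀ (p q : ℝ≥0∞) [Fact (1 ≤ p)] [Fact (1 ≤ q)],
          IsCompactFromKToK (fun g => mulPE2 g₁ (susyT2 (mulPE2 g₂ g))) p q ∧
          IsCompactFromKToK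
            (fun g => mulPE2 g₁ ((fun u => susyT2 (mulXi B u))^[L + 1] (mulPE2 g₂ g))) p q) := by
  refine ⟨fun k L h₁ h₂ hc₁ he₁ hc₂ he₂ D hD p _ => ?_,
    fun m => ⟨susyT_gram, fun L f₁ f₂ B hB p q _ _ => ?_⟩,
    fun m => ⟨susyT2_gram, fun L g₁ g₂ B hB p q _ _ => ?_⟩⟩
  · exact ⟨isCompactSandwich_fourierL2 (he₁.rapidDecay hc₁) (he₂.rapidDecay hc₂) p,
      isCompactSandwich_iterate (he₁.rapidDecay hc₁) (he₂.rapidDecay hc₂) hD p⟩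
  · exact ⟨isCompactFromHToH_susyT f₁ f₂ p q, isCompactFromHToH_iterate hB f₁ f₂ p q⟩
  · exact ⟨isCompactFromKToK_susyT2 g₁ g₂ p q, isCompactFromKToK_iterate hB g₁ g₂ p q⟩
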